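/- **Theorem 1.** For integers $\ell,m\ge 0$ consider the following quantum circuit $Q_{\ell,m}$, which has a first index register of $\ell+m$ qubits, a second index register of $\ell$ qubits and a register that holds an element of a finite group, and which takes two group elements $g,x$ as input. Starting from $|0\rangle|0\rangle|1\rangle$ it (i) applies a Hadamard gate to every qubit, (ii) maps $|a,b,y\rangle$ to $|a,b,\,y\,g^{a}x^{-b}\rangle$, (iii) applies to the first and to the second index register a quantum Fourier transform of size $2^{\ell+m}$ and $2^{\ell}$, respectively (implemented by the usual circuit of Hadamard, controlled phase and swap gates); then the registers are measured, and the contents $(j,k)$ of the index registers, $0\le j<2^{\ell+m}$, $0\le k<2^{\ell}$, are the output. The following holds. 1. The circuit $Q_{\ell,m}$ contains exactly one exponentiation of $g$ in superposition, to an exponent of length $\ell+m$ bits, exactly one exponentiation of $x$, to an exponent of length $\ell$ bits, and besides these only $O((\ell+m)^2)$ gates on at most two qubits, with an absolute implied constant. 2. For every $\delta>0$ there is a constant $C$ such that for all integers $s\ge 1$ and $c\ge 0$ there are a deterministic classical algorithm $P$ and a polynomial $p$ (depending only on $\delta,s,c$) with the following property. Let $m,\ell\ge 0$ and $d$ be integers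 with $0<d<2^m$ and $|\ell-m/s|\le c$, and let $g$ be a generator of a finite cyclic group $\mathbb G$ of order $r\ge 2^{\ell+m}+2^{\ell}d$; put $x=g^d$. Then: * the probabilities of the pairs $(j,k)$ that $Q_{\ell,m}$ may yield on input $g,x$ sum to $1$; * for arbitrary pairs $(j_1,k_1),\dots,(j_s,k_s)$ with $0\le j_i<2^{\ell+m}$ and $0\le k_i<2^{\ell}$, the algorithm $P$ on input $\ell,m,g,x,(j_1,k_1),\dots,(j_s,k_s)$ halts within $p(m)$ steps and outputs either $d$ or $0$ (which means failure); * if $Q_{\ell,m}$ is executed $t=Cs$ times, independently, on input $g,x$, then with probability at least $1-\delta$ there is a set of $s$ of the $t$ executions such that $P$ outputs $d$ when its input pairs are those yielded by these $s$ executions, in any order. Hence $d$ is computed by executing $P$ with all unordered selections of $s$ of the $t$ pairs. Here a classical algorithm is a while-program with integer registers and registers for group elements; an arithmetic operation or comparison of integers is charged the product of the bit lengths (each increased by one) of its operands, and a group multiplication, a group inversion or a test of equality of group elements is charged as one step. -/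

import Mathlib

namespace ShortDLog

/-! ### Quantum circuits with two index registers and one group register -/

/-- The qubits: a first index register of `ℓ + m` qubits and a second one of `ℓ` qubits. -/
abbrev Qubit (ℓ m : ℕ) : Type := Fin (ℓ + m) ⊕ Fin ℓ

/-- A computational basis state of the index registers (hence also a measurement outcome). -/
abbrev Outcome (ℓ m : ℕ) : Type := Qubit ℓ m → Bool

/-- The two group elements that the quantum algorithm receives as input. -/
inductive Base
  | g
  | x
  deriving DecidableEq

/-- The gates. `hadamard`, `cphase` (controlled phase `exp (2πi / 2^k)`) and `swap` are elementary
gates on at most two qubits. `power b reg neg` is an exponentiation in superposition: the group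
register is multiplied by the input `b` to the power whose binary digits, least significant first,
are the qubits of `reg` (by the inverse of that power if `neg` is true). -/
inductive Gate (ℓ m : ℕ)
  | hadamard (q : Qubit ℓ m)
  | cphase (q q' : Qubit ℓ m) (k : ℕ)
  | swap (q q' : Qubit ℓ m)
  | power (b : Base) (reg : List (Qubit ℓ m)) (neg : Bool)

/-- A circuit is a list of gates, the first one being applied first. It mentions the inputs `g`
and `x` only as symbols. -/
abbrev Circuit (ℓ m : ℕ) : Type := List (Gate ℓ m)

/-- The integer with the given binary digits, least significant first. -/
def regValue {ℓ m : ℕ} (w : Outcome ℓ m) : List (Qubit ℓ m) → ℕ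
  | [] => 0
  | q :: qs => (w q).toNat + 2 * regValue w qs

/-- A (possibly unnormalised) state vector, given by its amplitudes. -/
abbrev QState (ℓ m : ℕ) (G : Type*) : Type _ := Outcome ℓ m × G → ℂ

/-- The value of a base, given the inputs. -/
def Base.value {G : Type*} (g x : G) : Base → G
  | .g => g
  | .x => x

/-- The exponent (an integer) of an exponentiation gate on a basis state. -/
def signedValue {ℓ m : ℕ} (w : Outcome ℓ m) (reg : List (Qubit ℓ m)) (neg : Bool) : ℤ :=
  if neg then -(regValue w reg : ℤ) else (regValue w reg : ℤ)

/-- The action of a gate on amplitudes. In the last case `|w, y⟩ ↦ |w, y * h ^ e(w)⟩`. -/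
noncomputable def Gate.apply {ℓ m : ℕ} {G : Type*} [Group G] (g x : G) :
    Gate ℓ m → QState ℓ m G → QState ℓ m G
  | .hadamard q, ψ => fun v =>
      ((1 / Real.sqrt 2 : ℝ) : ℂ) *
        (ψ (Function.update v.1 q false, v.2)
          + (if v.1 q then -1 else 1) * ψ (Function.update v.1 q true, v.2))
  | .cphase q q' k, ψ => fun v =>
      (if v.1 q && v.1 q' then Complex.exp (2 * Real.pi * Complex.I / 2 ^ k) else 1) * ψ v
  | .swap q q', ψ => fun v => ψ (v.1 ∘ Equiv.swap q q', v.2)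
  | .power b reg neg, ψ => fun v =>
      ψ (v.1, v.2 * (b.value g x ^ signedValue v.1 reg neg)⁻¹)

open Classical in
/-- The initial state: all qubits `0`, and the neutral element in the group register. -/
noncomputable def initialState (ℓ m : ℕ) (G : Type*) [Group G] : QState ℓ m G :=
  Pi.single ((fun _ => false), 1) 1

/-- The final state of a circuit. -/
noncomputable def Circuit.run {ℓ m : ℕ} {G : Type*} [Group G] (Q : Circuit ℓ m) (g x : G) :
    QState ℓ m G :=
  Q.foldl (fun ψ U => U.apply g x ψ) (initialState ℓ m G)

/-- The probability of observing `w` in the index registers when everything is measured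
after the circuit has been executed on inputs `g`, `x`. -/
noncomputable def Circuit.prob {ℓ m : ℕ} {G : Type*} [Group G] [Fintype G]
    (Q : Circuit ℓ m) (g x : G) (w : Outcome ℓ m) : ℝ :=
  ∑ y : G, ‖Q.run g x (w, y)‖ ^ 2

/-- The lengths in bits of the exponents in the exponentiations of `b` that a circuit contains. -/
def Circuit.exponentLengths {ℓ m : ℕ} (b : Base) (Q : Circuit ℓ m) : List ℕ :=
  Q.filterMap fun
    | .power b' reg _ => if b' = b then some reg.length else none
    | _ => none

/-- The number of gates on at most two qubits, i.e. of all gates but the exponentiations. -/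
def Circuit.elementaryCount {ℓ m : ℕ} (Q : Circuit ℓ m) : ℕ :=
  Q.countP fun
    | .power _ _ _ => false
    | _ => true

/-! ### The quantum algorithm -/

/-- The first index register, least significant qubit first. -/
def firstReg (ℓ m : ℕ) : List (Qubit ℓ m) := (List.finRange (ℓ + m)).map Sum.inl

/-- The second index register, least significant qubit first. -/
def secondReg (ℓ m : ℕ) : List (Qubit ℓ m) := (List.finRange ℓ).map Sum.inr

/-- The usual circuit for the quantum Fourier transform
`|a⟩ ↦ 2^(-n/2) ∑ c, exp (2πi a c / 2^n) |c⟩` on the `n` qubits `r 0, …, r (n-1)`,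
least significant qubit first. -/
def qft {ℓ m : ℕ} (n : ℕ) (r : Fin n → Qubit ℓ m) : Circuit ℓ m :=
  ((List.finRange n).reverse.flatMap fun i =>
    Gate.hadamard (r i) ::
      ((List.finRange n).filter (fun i' => i' < i)).map fun i' =>
        Gate.cphase (r i) (r i') (i.val - i'.val + 1))
  ++ ((List.finRange n).filter (fun i => i < i.rev)).map fun i => Gate.swap (r i) (r i.rev)

/-- The quantum algorithm: prepare the uniform superposition over all `a < 2^(ℓ+m)` and `b < 2^ℓ`,
compute `g ^ a * x ^ (-b)` in the group register, and apply a quantum Fourier transform to each of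
the index registers. -/
def circuit (ℓ m : ℕ) : Circuit ℓ m :=
  (firstReg ℓ m ++ secondReg ℓ m).map Gate.hadamard
  ++ [Gate.power .g (firstReg ℓ m) false, Gate.power .x (secondReg ℓ m) true]
  ++ qft (ℓ + m) Sum.inl ++ qft ℓ Sum.inr

/-- The pair `(j, k)` of integers read off the index registers. -/
def Outcome.pair {ℓ m : ℕ} (w : Outcome ℓ m) : ℕ × ℕ :=
  (regValue w (firstReg ℓ m), regValue w (secondReg ℓ m))

open Classical in
/-- The probability of the event `E` for `t` independent draws from a finite distribution `μ`. -/
noncomputable def probOfRuns {Ω : Type*} [Fintype Ω] (μ : Ω → ℝ) (t : ℕ)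
    (E : (Fin t → Ω) → Prop) : ℝ :=
  ∑ ω : Fin t → Ω, if E ω then ∏ i, μ (ω i) else 0

/-! ### Classical algorithms

Deterministic while-programs over integer registers with logarithmic (bit) cost, which also have
registers holding elements of a black-box group. An operation on integers is charged the product
of the bit lengths of its operands (each increased by one), which bounds the cost of schoolbook
arithmetic; a group operation or an equality test in the group is charged as one step. -/

/-- Integer expressions; `div` and `mod` are Euclidean, with `a / 0 = 0` and `a % 0 = a`. -/
inductive Expr
  | const (z : ℤ)
  | reg (i : ℕ)
  | add (e₁ e₂ : Expr)
  | sub (e₁ e₂ : Expr)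
  | mul (e₁ e₂ : Expr)
  | div (e₁ e₂ : Expr)
  | mod (e₁ e₂ : Expr)

/-- Tests. -/
inductive Test
  | lt (e₁ e₂ : Expr)
  | eq (e₁ e₂ : Expr)
  | groupEq (i i' : ℕ)
  | not (c : Test)
  | and (c₁ c₂ : Test)

/-- Programs. `groupMul i a b` and `groupInv i a` store a product or an inverse of the contents of
group registers in group register `i`. -/
inductive Program
  | skip
  | assign (i : ℕ) (e : Expr)
  | groupMul (i a b : ℕ)
  | groupInv (i a : ℕ)
  | seq (P₁ P₂ : Program)
  | ite (c : Test) (P₁ P₂ : Program)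
  | while (c : Test) (P : Program)

/-- The contents of the registers. -/
structure Store (G : Type*) where
  int : ℕ → ℤ
  grp : ℕ → G

/-- One more than the bit length of an integer. -/
def bitCost (z : ℤ) : ℕ := z.natAbs.size + 1

def Expr.eval (σ : ℕ → ℤ) : Expr → ℤ
  | .const z => z
  | .reg i => σ i
  | .add e₁ e₂ => e₁.eval σ + e₂.eval σ
  | .sub e₁ e₂ => e₁.eval σ - e₂.eval σ
  | .mul e₁ e₂ => e₁.eval σ * e₂.eval σ
  | .div e₁ e₂ => e₁.eval σ / e₂.eval σ
  | .mod e₁ e₂ => e₁.eval σ % e₂.eval σ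

def Expr.cost (σ : ℕ → ℤ) : Expr → ℕ
  | .const z => bitCost z
  | .reg i => bitCost (σ i)
  | .add e₁ e₂ | .sub e₁ e₂ | .mul e₁ e₂ | .div e₁ e₂ | .mod e₁ e₂ =>
      e₁.cost σ + e₂.cost σ + bitCost (e₁.eval σ) * bitCost (e₂.eval σ)

def Test.Holds {G : Type*} (σ : Store G) : Test → Prop
  | .lt e₁ e₂ => e₁.eval σ.int < e₂.eval σ.int
  | .eq e₁ e₂ => e₁.eval σ.int = e₂.eval σ.int
  | .groupEq i i' => σ.grp i = σ.grp i'
  | .not c => ¬ c.Holds σ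
  | .and c₁ c₂ => c₁.Holds σ ∧ c₂.Holds σ

def Test.cost {G : Type*} (σ : Store G) : Test → ℕ
  | .lt e₁ e₂ | .eq e₁ e₂ =>
      e₁.cost σ.int + e₂.cost σ.int + bitCost (e₁.eval σ.int) * bitCost (e₂.eval σ.int)
  | .groupEq _ _ => 1
  | .not c => c.cost σ + 1
  | .and c₁ c₂ => c₁.cost σ + c₂.cost σ + 1

/-- `Exec P σ σ' T`: started in `σ`, the program `P` halts in `σ'` after `T` steps. -/
inductive Exec {G : Type*} [Group G] : Program → Store G → Store G → ℕ → Prop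
  | skip (σ : Store G) : Exec .skip σ σ 1
  | assign (i : ℕ) (e : Expr) (σ : Store G) :
      Exec (.assign i e) σ { σ with int := Function.update σ.int i (e.eval σ.int) }
        (e.cost σ.int + 1)
  | groupMul (i a b : ℕ) (σ : Store G) :
      Exec (.groupMul i a b) σ
        { σ with grp := Function.update σ.grp i (σ.grp a * σ.grp b) } 1
  | groupInv (i a : ℕ) (σ : Store G) :
      Exec (.groupInv i a) σ { σ with grp := Function.update σ.grp i (σ.grp a)⁻¹ } 1
  | seq {P₁ P₂ : Program} {σ₁ σ₂ σ₃ : Store G} {T₁ T₂ : ℕ} :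
      Exec P₁ σ₁ σ₂ T₁ → Exec P₂ σ₂ σ₃ T₂ → Exec (.seq P₁ P₂) σ₁ σ₃ (T₁ + T₂)
  | ite_true {c : Test} {P₁ P₂ : Program} {σ σ' : Store G} {T : ℕ} :
      c.Holds σ → Exec P₁ σ σ' T → Exec (.ite c P₁ P₂) σ σ' (c.cost σ + T + 1)
  | ite_false {c : Test} {P₁ P₂ : Program} {σ σ' : Store G} {T : ℕ} :
      ¬ c.Holds σ → Exec P₂ σ σ' T → Exec (.ite c P₁ P₂) σ σ' (c.cost σ + T + 1)
  | while_true {c : Test} {P : Program} {σ₁ σ₂ σ₃ : Store G} {T₁ T₂ : ℕ} :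
      c.Holds σ₁ → Exec P σ₁ σ₂ T₁ → Exec (.while c P) σ₂ σ₃ T₂ →
        Exec (.while c P) σ₁ σ₃ (c.cost σ₁ + T₁ + T₂ + 1)
  | while_false {c : Test} {P : Program} {σ : Store G} :
      ¬ c.Holds σ → Exec (.while c P) σ σ (c.cost σ + 1)

/-- The initial contents of the registers on input `ℓ`, `m`, `g`, `x` and the pairs
`f 0, …, f (s-1)`: the integer registers hold `ℓ, m, j₀, k₀, j₁, k₁, …, 0, 0, …` and the group
registers hold `g, x, 1, 1, …`. -/
def inputStore {G : Type*} [Group G] (ℓ m : ℕ) (g x : G) {s : ℕ} (f : Fin s → ℕ × ℕ) :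
    Store G where
  int n :=
    if n = 0 then (ℓ : ℤ)
    else if n = 1 then (m : ℤ)
    else if h : (n - 2) / 2 < s then
      (if n % 2 = 0 then ((f ⟨(n - 2) / 2, h⟩).1 : ℤ) else ((f ⟨(n - 2) / 2, h⟩).2 : ℤ))
    else 0
  grp n := if n = 0 then g else if n = 1 then x else 1

/-- On input `ℓ`, `m`, `g`, `x` and the pairs `f`, the program halts within `B` steps and leaves
`out` in integer register `0`. -/
def Program.OutputsWithin {G : Type*} [Group G] (P : Program) (B ℓ m : ℕ) (g x : G) {s : ℕ}
    (f : Fin s → ℕ × ℕ) (out : ℤ) : Prop :=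
  ∃ (σ : Store G) (T : ℕ), Exec P (inputStore ℓ m g x f) σ T ∧ T ≤ B ∧ σ.int 0 = out

end ShortDLog

open ShortDLog

namespace ShortDLog

/-! ### Counting gates -/

/-! Notation: N = 2^(ℓ+m), L = 2^ℓ.

Quantum part. The amplitude of (j, k, g^e) is 1/(N L) times the sum of exp(2πi(a j/N + b k/L)) over
all (a, b) with g^(a - d b) = g^e. The group is so large that distinct integers e in [-L d, N) give
distinct group elements. For such e, a = e + d b is determined by b, and b runs through an interval.
Call (j, k) good if d j + 2^m k is within 2^(m-1) of a multiple of N. For a good pair the phases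
along the interval turn by at most half a circle altogether, so they hardly cancel: the sum is at
least 2/π times the number of its terms. Cauchy-Schwarz over e then gives every good pair
probability at least 1/(5 N) (`pairProb_ge`). As every j has a good k, a run is good with
probability at least 1/5, and a Chernoff bound yields s good runs among C s (`probOfRuns_card_lt`).
By Parseval in b, the value j is exactly uniform (`sum_pairProb`).

Classical part. Given s good pairs, d is a small integer a for which all a j_i + 2^m k_i are near to
multiples of N. This is a close vector problem in dimension s + 1. It is approached through levels h
= 0, …, ℓ: at level h one considers boxes where |a| is of order 2^(s h) and the distances to
multiples of N are of order N/2^h. After rescaling by these orders the vectors (a, a j_i - b_i N)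
form a lattice. The tuple is balanced if at no level this lattice has a nonzero vector shorter than
1/κ. Since the j_i are uniform and independent, a union bound shows that, with κ a large constant
times m + 1, unbalanced tuples are unlikely (`probOfRuns_unbalanced_le`).

Balance has two consequences. The lattice has a covering radius polynomial in κ
(`exists_near_of_balanced`), because the pigeonhole principle gives so many short vectors that they
cannot lie in a hyperplane. Moreover, a box contains only polynomially many points
(`card_le_boxBound`). The first fact makes every point of a slightly longer box a sum of two points
of the box, since some lattice point lies near to its half (`InBox.exists_add`). So from a list of
the whole box one gets the longer box by forming all pairwise sums. A bounded number of such
enlargements multiplies the range of a by 2^s; then the bound on the distances is halved, and the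
next level is reached. At level 0 all a can be tried, and at level ℓ the list contains d. The points
are coded as 8 a + q, where q = 1 marks the inhomogeneous problem and q = 0 the lattice itself.

The lists are cut off at the length that balance guarantees, and each candidate is checked by
computing g^a. Therefore the time bound and the correctness of a nonzero output hold for arbitrary
input pairs; balance and goodness are needed only for success. -/

/-- A gate that is not an exponentiation. -/
def Gate.IsElementary {ℓ m : ℕ} : Gate ℓ m → Prop
  | .power _ _ _ => False
  | _ => True

theorem exponentLengths_eq_nil {ℓ m : ℕ} (b : Base) (Q : Circuit ℓ m)
    (h : ∀ U ∈ Q, U.IsElementary) : Q.exponentLengths b = [] := by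
  rw [Circuit.exponentLengths, List.filterMap_eq_nil_iff]
  intro U hU
  have := h U hU
  cases U <;> simp_all [Gate.IsElementary]

theorem exponentLengths_append {ℓ m : ℕ} (b : Base) (Q Q' : Circuit ℓ m) :
    Circuit.exponentLengths b (Q ++ Q') = Q.exponentLengths b ++ Q'.exponentLengths b := by
  simp [Circuit.exponentLengths, List.filterMap_append]

theorem isElementary_of_mem_qft {ℓ m n : ℕ} (r : Fin n → Qubit ℓ m) :
    ∀ U ∈ qft n r, U.IsElementary := by
  intro U hU
  simp only [qft, List.mem_append, List.mem_flatMap, List.mem_cons, List.mem_map] at hU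
  rcases hU with ⟨i, _, rfl | ⟨i', _, rfl⟩⟩ | ⟨i, _, rfl⟩ <;> trivial

theorem length_qft_le {ℓ m n : ℕ} (r : Fin n → Qubit ℓ m) :
    (qft n r).length ≤ n * (n + 1) + n := by
  have key : ∀ l : List (Fin n), (l.flatMap fun i => Gate.hadamard (r i) ::
      ((List.finRange n).filter (fun i' => i' < i)).map fun i' =>
        Gate.cphase (r i) (r i') (i.val - i'.val + 1)).length ≤ l.length * (n + 1) := by
    intro l
    induction l with
    | nil => simp
    | cons i l ih =>
      have h := List.length_filter_le (fun i' => decide (i' < i)) (List.finRange n)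
      rw [List.length_finRange] at h
      simp only [List.flatMap_cons, List.length_append, List.length_cons, List.length_map]
      rw [add_mul, one_mul]
      omega
  have h1 := key (List.finRange n).reverse
  have h2 := List.length_filter_le (fun i : Fin n => decide (i < i.rev)) (List.finRange n)
  rw [List.length_reverse, List.length_finRange] at h1
  rw [List.length_finRange] at h2
  rw [qft, List.length_append, List.length_map]
  exact add_le_add h1 h2

theorem circuit_exponentLengths_g (ℓ m : ℕ) : (circuit ℓ m).exponentLengths .g = [ℓ + m] := by
  rw [circuit, exponentLengths_append, exponentLengths_append, exponentLengths_append,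
    exponentLengths_eq_nil _ _ (isElementary_of_mem_qft _),
    exponentLengths_eq_nil _ _ (isElementary_of_mem_qft _),
    exponentLengths_eq_nil .g (List.map _ _)]
  · simp [Circuit.exponentLengths, firstReg]
  · intro U hU
    obtain ⟨q, _, rfl⟩ := List.mem_map.1 hU
    trivial

theorem circuit_exponentLengths_x (ℓ m : ℕ) : (circuit ℓ m).exponentLengths .x = [ℓ] := by
  rw [circuit, exponentLengths_append, exponentLengths_append, exponentLengths_append,
    exponentLengths_eq_nil _ _ (isElementary_of_mem_qft _),
    exponentLengths_eq_nil _ _ (isElementary_of_mem_qft _),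
    exponentLengths_eq_nil .x (List.map _ _)]
  · simp [Circuit.exponentLengths, secondReg]
  · intro U hU
    obtain ⟨q, _, rfl⟩ := List.mem_map.1 hU
    trivial

theorem circuit_elementaryCount_le (ℓ m : ℕ) :
    (circuit ℓ m).elementaryCount ≤ 8 * (ℓ + m) ^ 2 := by
  have h1 : (circuit ℓ m).elementaryCount ≤
      ((ℓ + m) + ℓ) + (qft (ℓ + m) (Sum.inl : _ → Qubit ℓ m)).length
        + (qft ℓ (Sum.inr : _ → Qubit ℓ m)).length := by
    simp only [circuit, Circuit.elementaryCount, List.countP_append]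
    refine add_le_add (add_le_add ?_ List.countP_le_length) List.countP_le_length
    refine (add_le_add List.countP_le_length le_rfl).trans ?_
    simp [firstReg, secondReg]
  have h2 := length_qft_le (Sum.inl : _ → Qubit ℓ m)
  have h3 := length_qft_le (Sum.inr : _ → Qubit ℓ m)
  have h4 : ℓ ≤ ℓ + m := Nat.le_add_right _ _
  have h5 : ℓ + m ≤ (ℓ + m) ^ 2 := Nat.le_self_pow (by norm_num) _
  have h6 : ℓ * (ℓ + 1) ≤ (ℓ + m) * (ℓ + m + 1) := Nat.mul_le_mul h4 (by omega)
  have h7 : (ℓ + m) * (ℓ + m + 1) = (ℓ + m) ^ 2 + (ℓ + m) := by ring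
  omega

/-! ### Phases -/

/-- The complex number `exp (2πi t)`. -/
noncomputable def phase (t : ℝ) : ℂ := Complex.exp (2 * Real.pi * t * Complex.I)

theorem phase_add (t u : ℝ) : phase (t + u) = phase t * phase u := by
  rw [phase, phase, phase, ← Complex.exp_add]; congr 1; push_cast; ring

@[simp] theorem phase_zero : phase 0 = 1 := by simp [phase]

theorem phase_intCast (z : ℤ) : phase z = 1 := by
  rw [phase, Complex.exp_eq_one_iff]; exact ⟨z, by push_cast; ring⟩

theorem phase_natCast (z : ℕ) : phase z = 1 := by exact_mod_cast phase_intCast z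

theorem phase_add_intCast (t : ℝ) (z : ℤ) : phase (t + z) = phase t := by
  rw [phase_add, phase_intCast, mul_one]

theorem phase_add_natCast (t : ℝ) (z : ℕ) : phase (t + z) = phase t := by
  rw [phase_add, phase_natCast, mul_one]

theorem norm_phase (t : ℝ) : ‖phase t‖ = 1 := by
  rw [phase, show (2 * Real.pi * t * Complex.I : ℂ) = ((2 * Real.pi * t : ℝ) : ℂ) * Complex.I by
    push_cast; ring]
  exact Complex.norm_exp_ofReal_mul_I _

theorem phase_half : phase (1 / 2) = -1 := by
  rw [phase, ← Complex.exp_pi_mul_I]; congr 1; push_cast; ring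

theorem phase_nat_mul (n : ℕ) (t : ℝ) : phase (n * t) = phase t ^ n := by
  rw [phase, phase, ← Complex.exp_nat_mul]; congr 1; push_cast; ring

/-! ### Binary numbers -/

/-- The integer with the binary digits `c 0, c 1, …`, least significant first. -/
def bitsValue {n : ℕ} (c : Fin n → Bool) : ℕ := ∑ i, (c i).toNat * 2 ^ i.val

theorem regValue_map_finRange {ℓ m n : ℕ} (w : Outcome ℓ m) (r : Fin n → Qubit ℓ m) :
    regValue w ((List.finRange n).map r) = bitsValue (w ∘ r) := by
  induction n with
  | zero => simp [regValue, bitsValue]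
  | succ n ih =>
    have h := ih (r ∘ Fin.succ)
    rw [List.finRange_succ, List.map_cons, List.map_map, regValue, h, bitsValue, bitsValue,
      Fin.sum_univ_succ, Finset.mul_sum]
    simp [pow_succ]
    exact Finset.sum_congr rfl fun i _ => by ring

theorem bitsValue_snoc {n : ℕ} (c : Fin n → Bool) (t : Bool) :
    bitsValue (Fin.snoc c t : Fin (n + 1) → Bool) = bitsValue c + t.toNat * 2 ^ n := by
  simp [bitsValue, Fin.sum_univ_castSucc]

theorem bitsValue_rev {n : ℕ} (c : Fin (n + 1) → Bool) :
    bitsValue (c ∘ Fin.rev) =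
      (c (Fin.last n)).toNat + 2 * bitsValue ((c ∘ Fin.castSucc) ∘ Fin.rev) := by
  simp only [bitsValue, Fin.sum_univ_succ, Finset.mul_sum]
  simp [Fin.rev_succ, pow_succ]
  exact Finset.sum_congr rfl fun i _ => by ring

theorem sum_snoc {M : Type*} [AddCommMonoid M] {n : ℕ} (F : (Fin (n + 1) → Bool) → M) :
    ∑ c, F c = ∑ c : Fin n → Bool, ∑ t : Bool, F (Fin.snoc c t) := by
  rw [← (Fin.snocEquiv fun _ : Fin (n + 1) => Bool).sum_comp F, Fintype.sum_prod_type,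
    Finset.sum_comm]
  rfl

/-- Splitting off the top digit cuts the range below 2^(n+1) into two halves that differ by a shift
by 2^n. -/
theorem sum_bitsValue {M : Type*} [AddCommMonoid M] {n : ℕ} (F : ℕ → M) :
    ∑ c : Fin n → Bool, F (bitsValue c) = ∑ a ∈ Finset.range (2 ^ n), F a := by
  induction n generalizing F with
  | zero => simp [bitsValue]
  | succ n ih =>
    rw [sum_snoc]
    simp only [bitsValue_snoc, Fintype.sum_bool, Bool.toNat_true, Bool.toNat_false, one_mul,
      zero_mul, add_zero]
    rw [Finset.sum_add_distrib, ih fun a => F (a + 2 ^ n), ih F, pow_succ, mul_two,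
      Finset.sum_range_add, add_comm]
    simp only [add_comm]


/-! ### The action of circuits -/

/-- The state into which a circuit transforms `ψ`. -/
noncomputable def Circuit.evolve {ℓ m : ℕ} {G : Type*} [Group G] (Q : Circuit ℓ m) (g x : G)
    (ψ : QState ℓ m G) : QState ℓ m G :=
  Q.foldl (fun ψ U => U.apply g x ψ) ψ

section Evolve

variable {ℓ m : ℕ} {G : Type*} [Group G] (g x : G)

theorem evolve_append (Q Q' : Circuit ℓ m) (ψ : QState ℓ m G) :
    Circuit.evolve (Q ++ Q') g x ψ = Q'.evolve g x (Q.evolve g x ψ) :=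
  List.foldl_append

theorem evolve_cons (U : Gate ℓ m) (Q : Circuit ℓ m) (ψ : QState ℓ m G) :
    Circuit.evolve (U :: Q) g x ψ = Q.evolve g x (U.apply g x ψ) := rfl

theorem evolve_nil (ψ : QState ℓ m G) : Circuit.evolve ([] : Circuit ℓ m) g x ψ = ψ := rfl

-- The last gate acts on the state produced by the others, hence the induction from the right.
-- Before that gate its qubit is still 0, so only one of the two Hadamard terms survives.
open Classical in
theorem evolve_hadamards (l : List (Qubit ℓ m)) (hl : l.Nodup) (w : Outcome ℓ m) (y : G) :
    Circuit.evolve (l.map Gate.hadamard) g x (initialState ℓ m G) (w, y) =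
      if (∀ q, q ∉ l → w q = false) ∧ y = 1 then
        (((1 / Real.sqrt 2 : ℝ) : ℂ)) ^ l.length else 0 := by
  induction l using List.reverseRecOn generalizing w with
  | nil =>
    simp only [List.map_nil, evolve_nil, initialState, List.length_nil, pow_zero, Pi.single_apply,
      Prod.mk.injEq, funext_iff, List.not_mem_nil, not_false_eq_true, true_imp_iff]
  | append_singleton l q ih =>
    have hq : q ∉ l := by
      rw [List.nodup_append] at hl
      intro h; exact hl.2.2 q h q (by simp) rfl
    have hl' : l.Nodup := (List.nodup_append.1 hl).1
    rw [List.map_append, evolve_append]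
    simp only [List.map_cons, List.map_nil, evolve_cons, evolve_nil, Gate.apply, ih hl']
    have h1 : ¬ ((∀ q', q' ∉ l → Function.update w q true q' = false) ∧ y = 1) := by
      intro h; simpa using h.1 q hq
    have h2 : (∀ q', q' ∉ l → Function.update w q false q' = false) ↔
        ∀ q', q' ∉ l ++ [q] → w q' = false := by
      refine forall_congr' fun q' => ?_
      by_cases hqq : q' = q
      · simp [hqq]
      · simp [hqq, Function.update_of_ne]
    rw [if_neg h1]
    simp only [h2, mul_zero, add_zero, mul_ite, List.length_append, List.length_singleton,
      pow_succ']

theorem evolve_cphases {n : ℕ} (q : Qubit ℓ m) (r : Fin n → Qubit ℓ m) (k : Fin n → ℕ)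
    (l : List (Fin n)) (ψ : QState ℓ m G) (v : Outcome ℓ m × G) :
    Circuit.evolve (l.map fun i => Gate.cphase q (r i) (k i)) g x ψ v =
      phase ((l.map fun i => ((v.1 q).toNat * (v.1 (r i)).toNat / 2 ^ k i : ℝ)).sum) * ψ v := by
  induction l generalizing ψ with
  | nil => simp [evolve_nil]
  | cons i l ih =>
    rw [List.map_cons, evolve_cons, ih, List.map_cons, List.sum_cons, phase_add, Gate.apply]
    have hgate : (if v.1 q && v.1 (r i) then Complex.exp (2 * Real.pi * Complex.I / 2 ^ k i) else 1)
        = phase ((v.1 q).toNat * (v.1 (r i)).toNat / 2 ^ k i) := by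
      cases v.1 q <;> cases v.1 (r i) <;> simp
      simp only [phase]
      congr 1
      push_cast
      ring
    dsimp only
    rw [hgate]
    ring

/-- The part of the Fourier transform before the swaps. -/
def qftCore (n : ℕ) (r : Fin n → Qubit ℓ m) : Circuit ℓ m :=
  (List.finRange n).reverse.flatMap fun i =>
    Gate.hadamard (r i) ::
      ((List.finRange n).filter (fun i' => i' < i)).map fun i' =>
        Gate.cphase (r i) (r i') (i.val - i'.val + 1)

theorem qftCore_succ (n : ℕ) (r : Fin (n + 1) → Qubit ℓ m) :
    qftCore (n + 1) r = Gate.hadamard (r (Fin.last n)) ::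
      ((List.finRange n).map fun i =>
        Gate.cphase (r (Fin.last n)) ((r ∘ Fin.castSucc) i) (n - i.val + 1))
      ++ qftCore n (r ∘ Fin.castSucc) := by
  rw [qftCore, List.finRange_succ_last, List.reverse_append, List.reverse_singleton,
    List.singleton_append, List.flatMap_cons, ← List.map_reverse, List.flatMap_map, qftCore]
  congr 1
  · congr 1
    rw [List.filter_append, List.filter_map]
    simp [Function.comp_def]
  · congr 1
    funext i
    rw [List.filter_append, List.filter_map]
    simp [Function.comp_def]
    exact (Fin.castSucc_lt_last i).le

/-- `Function.extend r c w` is the basis state `w` with the digits of the register `r` replaced by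
`c`; it occurs as the summation variable of all Fourier transforms below. -/
theorem extend_snoc {n : ℕ} (r : Fin (n + 1) → Qubit ℓ m) (hr : Function.Injective r)
    (c : Fin n → Bool) (t : Bool) (w : Outcome ℓ m) :
    Function.extend r (Fin.snoc c t) w =
      Function.update (Function.extend (r ∘ Fin.castSucc) c w) (r (Fin.last n)) t := by
  funext q
  by_cases hq : ∃ i, r i = q
  · obtain ⟨i, rfl⟩ := hq
    rw [hr.extend_apply]
    induction i using Fin.lastCases with
    | last => simp
    | cast i =>
      rw [Fin.snoc_castSucc, Function.update_of_ne]
      · exact ((hr.comp (Fin.castSucc_injective n)).extend_apply c w i).symm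
      · intro h; exact (Fin.castSucc_lt_last i).ne (hr h)
  · rw [Function.extend_apply' _ _ _ hq, Function.update_of_ne,
      Function.extend_apply']
    · rintro ⟨i, rfl⟩; exact hq ⟨_, rfl⟩
    · rintro rfl; exact hq ⟨_, rfl⟩

/-- Without the swaps the output is the Fourier transform with reversed digits. The induction splits
off the most significant input digit t and the output digit x of the same qubit. With V and R the
values of the remaining input and reversed output digits, (V + t 2^n)(x + 2R)/2^(n+1) = V R/2^n + x
V/2^(n+1) + t x/2 + t R. The terms stem from the smaller transform, the controlled phases and the
Hadamard gate; the last one is an integer. -/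
theorem evolve_qftCore (n : ℕ) (r : Fin n → Qubit ℓ m) (hr : Function.Injective r)
    (ψ : QState ℓ m G) (w : Outcome ℓ m) (y : G) :
    Circuit.evolve (qftCore n r) g x ψ (w, y) =
      ((1 / Real.sqrt 2 : ℝ) : ℂ) ^ n * ∑ c : Fin n → Bool,
        phase (bitsValue c * bitsValue ((w ∘ r) ∘ Fin.rev) / 2 ^ n) *
          ψ (Function.extend r c w, y) := by
  induction n generalizing ψ with
  | zero =>
    have h : ∀ c, Function.extend r c w = w := fun c => by
      funext q; exact Function.extend_apply' _ _ _ fun ⟨i, _⟩ => i.elim0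
    simp [qftCore, evolve_nil, bitsValue, h]
  | succ n ih =>
    have hr' := hr.comp (Fin.castSucc_injective n)
    have hlast : ∀ c : Fin n → Bool, Function.extend (r ∘ Fin.castSucc) c w (r (Fin.last n)) =
        w (r (Fin.last n)) := fun c => Function.extend_apply' _ _ _ (by
      rintro ⟨i, hi⟩; exact (Fin.castSucc_lt_last i).ne (hr hi))
    rw [qftCore_succ, List.cons_append, evolve_cons, evolve_append, ih _ hr', sum_snoc, pow_succ,
      mul_assoc]
    congr 1
    rw [Finset.mul_sum]
    refine Finset.sum_congr rfl fun c _ => ?_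
    rw [evolve_cphases]
    have hsum : ((List.finRange n).map fun i =>
        (((Function.extend (r ∘ Fin.castSucc) c w (r (Fin.last n))).toNat *
          (Function.extend (r ∘ Fin.castSucc) c w ((r ∘ Fin.castSucc) i)).toNat
            / 2 ^ (n - i.val + 1) : ℝ))).sum =
        (w (r (Fin.last n))).toNat * bitsValue c / 2 ^ (n + 1) := by
      rw [← List.ofFn_eq_map, List.sum_ofFn, bitsValue]
      push_cast
      rw [Finset.mul_sum, Finset.sum_div]
      refine Finset.sum_congr rfl fun i _ => ?_
      rw [hlast, hr'.extend_apply]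
      have hpow : (2 : ℝ) ^ (n + 1) = 2 ^ (n - i.val + 1) * 2 ^ i.val := by
        rw [← pow_add]; congr 1; omega
      rw [hpow]
      field_simp
    simp only [hsum]
    simp only [Gate.apply, extend_snoc r hr, bitsValue_snoc, bitsValue_rev, Fintype.sum_bool,
      Function.comp_apply, hlast]
    have hcomp : ((w ∘ r) ∘ Fin.castSucc) ∘ Fin.rev = (w ∘ r ∘ Fin.castSucc) ∘ Fin.rev := rfl
    rw [hcomp]
    set R := bitsValue ((w ∘ r ∘ Fin.castSucc) ∘ Fin.rev) with hR
    set V := bitsValue c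
    have e1 : phase ((V : ℝ) * R / 2 ^ n) * phase ((w (r (Fin.last n))).toNat * V / 2 ^ (n + 1)) =
        phase (((V + false.toNat * 2 ^ n : ℕ) : ℝ) *
          (((w (r (Fin.last n))).toNat + 2 * R : ℕ) : ℝ) / 2 ^ (n + 1)) := by
      rw [← phase_add]
      congr 1
      push_cast
      rw [pow_succ]
      simp
      field_simp
      ring
    -- For t = 1 the Hadamard sign is the phase of x/2, and the integer R is added for free.
    have e2 : phase ((V : ℝ) * R / 2 ^ n) * phase ((w (r (Fin.last n))).toNat * V / 2 ^ (n + 1)) *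
        (if w (r (Fin.last n)) then -1 else 1) =
        phase (((V + true.toNat * 2 ^ n : ℕ) : ℝ) *
          (((w (r (Fin.last n))).toNat + 2 * R : ℕ) : ℝ) / 2 ^ (n + 1)) := by
      have : (if w (r (Fin.last n)) then (-1 : ℂ) else 1) =
          phase ((w (r (Fin.last n))).toNat / 2) := by
        cases w (r (Fin.last n)) <;> simp [← phase_half]
      rw [this, ← phase_add, ← phase_add, ← phase_add_natCast _ R]
      congr 1
      push_cast
      rw [pow_succ]
      simp
      field_simp
      ring
    rw [← e1, ← e2]
    ring

/-- The condition `i < i.rev` ensures that each pair is swapped only once, so the swaps act on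
disjoint pairs and do not undo each other. -/
theorem evolve_swaps {n : ℕ} (r : Fin n → Qubit ℓ m) (hr : Function.Injective r)
    (l : List (Fin n)) (hl : l.Nodup) (hl' : ∀ i ∈ l, i < i.rev) (ψ : QState ℓ m G)
    (w : Outcome ℓ m) (y : G) :
    Circuit.evolve (l.map fun i => Gate.swap (r i) (r i.rev)) g x ψ (w, y) =
      ψ (Function.extend r (fun i => w (r (if i ∈ l ∨ i.rev ∈ l then i.rev else i))) w, y) := by
  induction l generalizing ψ with
  | nil =>
    simp only [List.map_nil, evolve_nil, List.not_mem_nil, or_self, if_false]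
    congr 2
    funext q
    by_cases hq : ∃ i, r i = q
    · obtain ⟨i, rfl⟩ := hq
      rw [hr.extend_apply]
    · rw [Function.extend_apply' _ _ _ hq]
  | cons i l ih =>
    rw [List.nodup_cons] at hl
    rw [List.map_cons, evolve_cons, ih hl.2 fun i' h => hl' i' (List.mem_cons_of_mem _ h),
      Gate.apply]
    have hi : i < i.rev := hl' i List.mem_cons_self
    have hrev : i.rev ∉ l := fun h => by
      have := hl' _ (List.mem_cons_of_mem _ h)
      rw [Fin.rev_rev] at this
      exact absurd this hi.asymm
    change ψ (_, y) = ψ (_, y)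
    congr 2
    funext q
    by_cases hq : ∃ i, r i = q
    · obtain ⟨a, rfl⟩ := hq
      rw [Function.comp_apply]
      dsimp only
      rw [hr.swap_apply, hr.extend_apply, hr.extend_apply]
      congr 2
      by_cases h1 : a = i
      · subst h1; simp [hl.1, hrev]
      · by_cases h2 : a = i.rev
        · subst h2; simp [hl.1, hrev]
        · have h3 : a.rev ≠ i := fun h => h2 (by rw [← h, Fin.rev_rev])
          rw [Equiv.swap_apply_of_ne_of_ne h1 h2]
          simp [h1, h3]
    · rw [Function.extend_apply' _ _ _ hq, Function.comp_apply, Equiv.swap_apply_of_ne_of_ne]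
      · dsimp only; rw [Function.extend_apply' _ _ _ hq]
      · rintro rfl; exact hq ⟨_, rfl⟩
      · rintro rfl; exact hq ⟨_, rfl⟩

theorem evolve_qft (n : ℕ) (r : Fin n → Qubit ℓ m) (hr : Function.Injective r)
    (ψ : QState ℓ m G) (w : Outcome ℓ m) (y : G) :
    Circuit.evolve (qft n r) g x ψ (w, y) =
      ((1 / Real.sqrt 2 : ℝ) : ℂ) ^ n * ∑ c : Fin n → Bool,
        phase (bitsValue c * bitsValue (w ∘ r) / 2 ^ n) * ψ (Function.extend r c w, y) := by
  rw [show qft n r = qftCore n r ++ ((List.finRange n).filter (fun i => i < i.rev)).map fun i =>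
    Gate.swap (r i) (r i.rev) from rfl, evolve_append, evolve_swaps g x r hr _
    ((List.nodup_finRange n).filter _) (by simp), evolve_qftCore g x n r hr]
  congr 1
  have hfun : ∀ i : Fin n, (if i ∈ (List.finRange n).filter (fun i => i < i.rev) ∨
      i.rev ∈ (List.finRange n).filter (fun i => i < i.rev) then i.rev else i) = i.rev := by
    intro i
    split_ifs with h
    · rfl
    · simp only [List.mem_filter, List.mem_finRange, true_and, decide_eq_true_eq, Fin.rev_rev,
        not_or, not_lt] at h
      exact le_antisymm h.2 h.1
  simp only [hfun]
  refine Finset.sum_congr rfl fun c _ => ?_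
  have h1 : (Function.extend r (fun i => w (r i.rev)) w ∘ r) ∘ Fin.rev = w ∘ r := by
    funext i
    simp [hr.extend_apply]
  have h2 : Function.extend r c (Function.extend r (fun i => w (r i.rev)) w) =
      Function.extend r c w := by
    funext q
    by_cases hq : ∃ i, r i = q
    · obtain ⟨i, rfl⟩ := hq
      rw [hr.extend_apply, hr.extend_apply]
    · rw [Function.extend_apply' _ _ _ hq, Function.extend_apply' _ _ _ hq,
        Function.extend_apply' _ _ _ hq]
  rw [h1, h2]

end Evolve

open Classical in
/-- The final amplitudes. -/
theorem circuit_run {G : Type*} [Group G] (g x : G) (ℓ m : ℕ) (w : Outcome ℓ m) (y : G) :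
    (circuit ℓ m).run g x (w, y) =
      (1 / 2 ^ (ℓ + m + ℓ) : ℂ) * ∑ a ∈ Finset.range (2 ^ (ℓ + m)), ∑ b ∈ Finset.range (2 ^ ℓ),
        phase (a * w.pair.1 / 2 ^ (ℓ + m)) * phase (b * w.pair.2 / 2 ^ ℓ) *
          (if y = g ^ a * (x ^ b)⁻¹ then 1 else 0) := by
  have hp1 : ∀ v : Outcome ℓ m, regValue v (firstReg ℓ m) = bitsValue (v ∘ Sum.inl) :=
    fun v => regValue_map_finRange v _
  have hp2 : ∀ v : Outcome ℓ m, regValue v (secondReg ℓ m) = bitsValue (v ∘ Sum.inr) :=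
    fun v => regValue_map_finRange v _
  have hrun : (circuit ℓ m).run g x = (circuit ℓ m).evolve g x (initialState ℓ m G) := rfl
  rw [hrun, circuit, evolve_append, evolve_append, evolve_append,
    evolve_qft g x _ _ Sum.inr_injective]
  simp only [evolve_qft g x _ _ Sum.inl_injective, evolve_cons, evolve_nil, Gate.apply]
  have hnodup : (firstReg ℓ m ++ secondReg ℓ m).Nodup := by
    rw [List.nodup_append]
    refine ⟨(List.nodup_finRange _).map Sum.inl_injective,
      (List.nodup_finRange _).map Sum.inr_injective, ?_⟩
    intro a ha b hb
    obtain ⟨i, _, rfl⟩ := List.mem_map.1 ha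
    obtain ⟨j, _, rfl⟩ := List.mem_map.1 hb
    simp
  have hmem : ∀ q, q ∈ firstReg ℓ m ++ secondReg ℓ m := by
    rintro (i | i) <;> simp [firstReg, secondReg]
  have hlen : (firstReg ℓ m ++ secondReg ℓ m).length = ℓ + m + ℓ := by
    simp [firstReg, secondReg]
  simp only [evolve_hadamards g x _ hnodup, hmem, not_true_eq_false, false_imp_iff, implies_true,
    true_and, hlen]
  have hl : ∀ (b : Fin ℓ → Bool) (a : Fin (ℓ + m) → Bool),
      Function.extend Sum.inl a (Function.extend Sum.inr b w) ∘ Sum.inl = a := fun b a => by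
    funext i; exact Sum.inl_injective.extend_apply _ _ _
  have hr : ∀ (b : Fin ℓ → Bool) (a : Fin (ℓ + m) → Bool),
      Function.extend Sum.inl a (Function.extend Sum.inr b w) ∘ Sum.inr = b := fun b a => by
    funext i
    rw [Function.comp_apply, Function.extend_apply' _ _ _ (by simp),
      Sum.inr_injective.extend_apply]
  have hw : ∀ (b : Fin ℓ → Bool), Function.extend Sum.inr b w ∘ Sum.inl = w ∘ Sum.inl :=
    fun b => by
      funext i
      rw [Function.comp_apply, Function.extend_apply' _ _ _ (by simp)]; rfl
  simp only [signedValue, hp1, hp2, hl, hr, hw, Outcome.pair, Base.value]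
  rw [← sum_bitsValue (n := ℓ + m) (fun a => ∑ b ∈ Finset.range (2 ^ ℓ),
    phase (a * (bitsValue (w ∘ Sum.inl) : ℕ) / 2 ^ (ℓ + m)) *
      phase (b * (bitsValue (w ∘ Sum.inr) : ℕ) / 2 ^ ℓ) *
          (if y = g ^ a * (x ^ b)⁻¹ then (1 : ℂ) else 0))]
  have hinner : ∀ F : ℕ → ℂ, ∑ b ∈ Finset.range (2 ^ ℓ), F b =
      ∑ b : Fin ℓ → Bool, F (bitsValue b) :=
    fun F => (sum_bitsValue F).symm
  simp only [hinner]
  rw [Finset.sum_comm, Finset.mul_sum, Finset.mul_sum]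
  refine Finset.sum_congr rfl fun b _ => ?_
  simp only [Finset.mul_sum]
  refine Finset.sum_congr rfl fun a _ => ?_
  have hiff : (y * (x ^ (-(bitsValue b : ℤ)))⁻¹ * (g ^ (bitsValue a : ℤ))⁻¹ = 1) ↔
      y = g ^ bitsValue a * (x ^ bitsValue b)⁻¹ := by
    rw [mul_inv_eq_one, zpow_neg, inv_inv, zpow_natCast, zpow_natCast, eq_mul_inv_iff_mul_eq]
  have hsq : (((1 / Real.sqrt 2 : ℝ) : ℂ)) ^ ℓ * (((1 / Real.sqrt 2 : ℝ) : ℂ)) ^ (ℓ + m) *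
      (((1 / Real.sqrt 2 : ℝ) : ℂ)) ^ (ℓ + m + ℓ) = 1 / 2 ^ (ℓ + m + ℓ) := by
    rw [← pow_add, ← pow_add, show ℓ + (ℓ + m) + (ℓ + m + ℓ) = 2 * (ℓ + m + ℓ) by ring, pow_mul,
      ← Complex.ofReal_pow, div_pow, one_pow, Real.sq_sqrt (by norm_num)]
    push_cast
    rw [div_pow, one_pow]
  simp only [if_true, Bool.false_eq_true, if_false, hiff]
  rw [← hsq]
  split_ifs <;> ring


/-! ### Exponential sums -/

theorem norm_phase_sub_one (t : ℝ) : ‖phase t - 1‖ = 2 * |Real.sin (Real.pi * t)| := by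
  have h : phase t = Complex.exp (Complex.I * ((2 * Real.pi * t : ℝ) : ℂ)) := by
    rw [phase]; congr 1; push_cast; ring
  rw [h, Complex.norm_exp_I_mul_ofReal_sub_one, norm_mul, Real.norm_eq_abs, Real.norm_eq_abs,
    abs_two, show 2 * Real.pi * t / 2 = Real.pi * t by ring]

theorem sum_phase_eq_zero {n : ℕ} {t : ℝ} (h1 : phase t ≠ 1) (hn : phase (n * t) = 1) :
    ∑ k ∈ Finset.range n, phase (k * t) = 0 := by
  simp only [phase_nat_mul] at hn ⊢
  have h := geom_sum_mul (phase t) n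
  rw [hn, sub_self] at h
  exact (mul_eq_zero.1 h).resolve_right (sub_ne_zero.2 h1)

theorem conj_phase (t : ℝ) : (starRingEnd ℂ) (phase t) = phase (-t) := by
  rw [phase, phase, ← Complex.exp_conj]
  congr 1
  simp [map_ofNat]

/-- Orthogonality of characters: for distinct b, b' below n the ratio is a nontrivial n-th root of
unity, whose powers sum to zero. -/
theorem sum_phase_mul_div {n : ℕ} {b b' : ℕ} (hb : b < n) (hb' : b' < n) :
    ∑ k ∈ Finset.range n, phase (b * k / n) * (starRingEnd ℂ) (phase (b' * k / n)) =
      if b = b' then (n : ℂ) else 0 := by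
  have hn : (n : ℝ) ≠ 0 := by exact_mod_cast (by omega : n ≠ 0)
  have h : ∀ k : ℕ, phase (b * k / n) * (starRingEnd ℂ) (phase (b' * k / n)) =
      phase (k * (((b : ℤ) - b' : ℤ) / n)) := fun k => by
    rw [conj_phase, ← phase_add]; congr 1; push_cast; ring
  simp only [h]
  split_ifs with hbb
  · subst hbb; simp
  · apply sum_phase_eq_zero
    · intro h1
      rw [phase, Complex.exp_eq_one_iff] at h1
      obtain ⟨z, hz⟩ := h1
      have h2 : ((((b : ℤ) - b' : ℤ) / n : ℝ) : ℂ) = ((z : ℝ) : ℂ) := by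
        have hpi : (2 * Real.pi * Complex.I : ℂ) ≠ 0 := Complex.two_pi_I_ne_zero
        apply mul_left_cancel₀ hpi
        push_cast at hz ⊢
        linear_combination hz
      have h3 := Complex.ofReal_injective h2
      rw [div_eq_iff hn] at h3
      have h4 : ((b : ℤ) - b' : ℤ) = z * n := by exact_mod_cast h3
      have hz0 : z = 0 := by
        by_contra hz0
        have h5 : (n : ℤ) ≤ |z * n| := by
          rw [abs_mul, Nat.abs_cast]
          exact le_mul_of_one_le_left (by positivity) (Int.one_le_abs hz0)
        rw [← h4] at h5
        have h6 : |(b : ℤ) - b'| < n := by rw [abs_lt]; constructor <;> omega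
        omega
      rw [hz0] at h4
      omega
    · rw [mul_div_cancel₀ _ hn]; exact phase_intCast _

theorem sum_norm_sq_fourier (n : ℕ) (c : ℕ → ℂ) :
    ∑ k ∈ Finset.range n, ‖∑ b ∈ Finset.range n, phase (b * k / n) * c b‖ ^ 2 =
      n * ∑ b ∈ Finset.range n, ‖c b‖ ^ 2 := by
  have hC : ((∑ k ∈ Finset.range n, ‖∑ b ∈ Finset.range n, phase (b * k / n) * c b‖ ^ 2 : ℝ) : ℂ) =
      ((n * ∑ b ∈ Finset.range n, ‖c b‖ ^ 2 : ℝ) : ℂ) := by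
    push_cast
    simp only [← Complex.mul_conj', map_sum, map_mul, Finset.sum_mul_sum]
    rw [Finset.sum_comm, Finset.mul_sum]
    refine Finset.sum_congr rfl fun b hb => ?_
    rw [Finset.sum_comm]
    have : ∀ b' ∈ Finset.range n, ∑ k ∈ Finset.range n, phase (b * k / n) * c b *
        ((starRingEnd ℂ) (phase (b' * k / n)) * (starRingEnd ℂ) (c b')) =
        if b = b' then n * (c b * (starRingEnd ℂ) (c b')) else 0 := by
      intro b' hb'
      have h := sum_phase_mul_div (Finset.mem_range.1 hb) (Finset.mem_range.1 hb')
      calc _ = (∑ k ∈ Finset.range n, phase (b * k / n) * (starRingEnd ℂ) (phase (b' * k / n))) *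
            (c b * (starRingEnd ℂ) (c b')) := by
            rw [Finset.sum_mul]; exact Finset.sum_congr rfl fun k _ => by ring
        _ = _ := by rw [h, ite_mul, zero_mul]
    rw [Finset.sum_congr rfl this, Finset.sum_ite_eq, if_pos hb]
  exact_mod_cast hC

/-- The geometric sum has absolute value |sin(π n t)| / |sin(π t)|. Jordan's inequality bounds the
numerator below, which is where n |t| ≤ 1/2 is needed, and |sin y| ≤ |y| bounds the denominator
above. -/
theorem le_norm_sum_range_phase (n : ℕ) (t : ℝ) (h : n * |t| ≤ 1 / 2) :
    2 / Real.pi * n ≤ ‖∑ i ∈ Finset.range n, phase (i * t)‖ := by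
  have hpi := Real.pi_pos
  by_cases ht : t = 0
  · subst ht
    have : 2 / Real.pi ≤ 1 := by rw [div_le_one hpi]; exact Real.two_le_pi
    simp only [mul_zero, phase_zero, Finset.sum_const, Finset.card_range, nsmul_eq_mul, mul_one,
      Complex.norm_natCast]
    exact mul_le_of_le_one_left (by positivity) this
  · have ht' : 0 < |t| := abs_pos.2 ht
    have h1 := congrArg norm (geom_sum_mul (phase t) n)
    rw [norm_mul, ← phase_nat_mul, norm_phase_sub_one, norm_phase_sub_one] at h1
    simp only [← phase_nat_mul] at h1
    have h2 : |Real.sin (Real.pi * t)| ≤ Real.pi * |t| := by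
      refine Real.abs_sin_le_abs.trans ?_
      rw [abs_mul, abs_of_pos hpi]
    have h3 : 2 / Real.pi * |Real.pi * (n * t)| ≤ |Real.sin (Real.pi * (n * t))| := by
      apply Real.mul_abs_le_abs_sin
      rw [abs_mul, abs_mul, abs_of_pos hpi, Nat.abs_cast]
      nlinarith
    rw [abs_mul, abs_mul, abs_of_pos hpi, Nat.abs_cast] at h3
    have h4 : 2 / Real.pi * (Real.pi * (n * |t|)) = 2 * (n * |t|) := by field_simp
    rw [h4] at h3
    set S := ‖∑ i ∈ Finset.range n, phase (i * t)‖
    have h5 : 2 * (n * |t|) ≤ S * Real.pi * |t| := by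
      have : S * |Real.sin (Real.pi * t)| ≤ S * (Real.pi * |t|) :=
        mul_le_mul_of_nonneg_left h2 (norm_nonneg _)
      nlinarith
    have h6 : 2 * (n : ℝ) ≤ S * Real.pi := by
      by_contra hlt
      push Not at hlt
      nlinarith
    rw [div_mul_eq_mul_div, div_le_iff₀ hpi]
    exact h6

theorem le_norm_sum_phase_of_ordConnected {n : ℕ} (B : Finset ℕ) (hB : B ⊆ Finset.range n)
    (hconv : ∀ a ∈ B, ∀ b ∈ B, ∀ i, a ≤ i → i ≤ b → i ∈ B) (t : ℝ) (h : n * |t| ≤ 1 / 2) :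
    2 / Real.pi * B.card ≤ ‖∑ b ∈ B, phase (b * t)‖ := by
  rcases B.eq_empty_or_nonempty with rfl | hne
  · simp
  obtain ⟨p, q, rfl⟩ : ∃ p q, B = Finset.Ico p q := by
    refine ⟨B.min' hne, B.max' hne + 1, ?_⟩
    ext i
    rw [Finset.mem_Ico]
    constructor
    · intro hi; exact ⟨B.min'_le i hi, Nat.lt_succ_of_le (B.le_max' i hi)⟩
    · intro hi
      exact hconv _ (B.min'_mem hne) _ (B.max'_mem hne) i hi.1 (Nat.le_of_lt_succ hi.2)
  have hcard : (Finset.Ico p q).card ≤ n := by simpa using Finset.card_le_card hB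
  rw [Finset.sum_Ico_eq_sum_range]
  have hterm : ∀ i, phase ((p + i : ℕ) * t) = phase (p * t) * phase (i * t) := fun i => by
    rw [← phase_add]; congr 1; push_cast; ring
  simp only [hterm]
  rw [← Finset.mul_sum, norm_mul, norm_phase, one_mul, Nat.card_Ico]
  rw [Nat.card_Ico] at hcard
  apply le_norm_sum_range_phase
  refine le_trans (mul_le_mul_of_nonneg_right ?_ (abs_nonneg t)) h
  exact_mod_cast hcard

/-! ### The distribution of the pairs -/

theorem sum_outcome {ℓ m : ℕ} {M : Type*} [AddCommMonoid M] (F : ℕ × ℕ → M) :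
    ∑ w : Outcome ℓ m, F w.pair =
      ∑ j ∈ Finset.range (2 ^ (ℓ + m)), ∑ k ∈ Finset.range (2 ^ ℓ), F (j, k) := by
  rw [← (Equiv.sumArrowEquivProdArrow _ _ _).symm.sum_comp, Fintype.sum_prod_type,
    ← sum_bitsValue]
  refine Finset.sum_congr rfl fun a _ => ?_
  rw [← sum_bitsValue]
  refine Finset.sum_congr rfl fun b _ => ?_
  rw [Outcome.pair, firstReg, secondReg, regValue_map_finRange, regValue_map_finRange]
  rfl

/-- Otherwise the indicator function of this pair would have sum zero by `sum_outcome`, although it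
is 1 at `w`. -/
theorem pair_fst_lt {ℓ m : ℕ} (w : Outcome ℓ m) : w.pair.1 < 2 ^ (ℓ + m) := by
  by_contra hlt
  have h := sum_outcome (ℓ := ℓ) (m := m) fun p => if p = w.pair then 1 else 0
  rw [Finset.sum_eq_zero (s := Finset.range _)] at h
  · have h1 := Finset.sum_eq_zero_iff.1 h w (Finset.mem_univ _)
    simp at h1
  · intro j hj
    refine Finset.sum_eq_zero fun k _ => if_neg fun h' => hlt ?_
    rw [← h']; exact Finset.mem_range.1 hj

theorem pair_snd_lt {ℓ m : ℕ} (w : Outcome ℓ m) : w.pair.2 < 2 ^ ℓ := by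
  by_contra hlt
  have h := sum_outcome (ℓ := ℓ) (m := m) fun p => if p = w.pair then 1 else 0
  rw [Finset.sum_eq_zero (s := Finset.range _)] at h
  · have h1 := Finset.sum_eq_zero_iff.1 h w (Finset.mem_univ _)
    simp at h1
  · intro j _
    refine Finset.sum_eq_zero fun k hk => if_neg fun h' => hlt ?_
    rw [← h']; exact Finset.mem_range.1 hk

section Distribution

variable {ℓ m d : ℕ} {G : Type*} [Group G] [Fintype G] {g : G}

open Classical in
/-- The probability of the pair `(j, k)`. -/
noncomputable def pairProb (ℓ m d : ℕ) (g : G) (p : ℕ × ℕ) : ℝ :=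
  ∑ y : G, ‖(1 / 2 ^ (ℓ + m + ℓ) : ℂ) * ∑ b ∈ Finset.range (2 ^ ℓ),
    phase (b * p.2 / (2 ^ ℓ : ℕ)) * ∑ a ∈ Finset.range (2 ^ (ℓ + m)),
      phase (a * p.1 / 2 ^ (ℓ + m)) * (if y = g ^ ((a : ℤ) - d * b) then 1 else 0)‖ ^ 2

theorem circuit_prob (w : Outcome ℓ m) :
    (circuit ℓ m).prob g (g ^ d) w = pairProb ℓ m d g w.pair := by
  classical
  rw [Circuit.prob, pairProb]
  refine Finset.sum_congr rfl fun y _ => ?_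
  rw [circuit_run, Finset.sum_comm]
  simp only [Finset.mul_sum]
  congr 2
  refine Finset.sum_congr rfl fun b _ => ?_
  refine Finset.sum_congr rfl fun a _ => ?_
  have : g ^ a * ((g ^ d) ^ b)⁻¹ = g ^ ((a : ℤ) - d * b) := by
    rw [zpow_sub, zpow_mul, zpow_natCast, zpow_natCast, zpow_natCast]
  rw [this]
  push_cast
  ring

/-- The order of the group enters the proof only through this lemma: exponents that differ by less
than the order do not collide. -/
theorem zpow_injOn_of_lt (hg : ∀ y : G, y ∈ Subgroup.zpowers g) {e e' : ℤ}
    (h : |e - e'| < Fintype.card G) (heq : g ^ e = g ^ e') : e = e' := by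
  rw [zpow_eq_zpow_iff_modEq, orderOf_eq_card_of_forall_mem_zpowers hg, Nat.card_eq_fintype_card,
    Int.modEq_iff_dvd] at heq
  have h1 : e' - e = 0 := Int.eq_zero_of_abs_lt_dvd heq (by rwa [abs_sub_comm])
  omega

theorem pairProb_nonneg (p : ℕ × ℕ) : 0 ≤ pairProb ℓ m d g p :=
  Finset.sum_nonneg fun _ _ => by positivity

/-- The first component is exactly uniform. Summing over k removes the second Fourier transform by
Parseval. What remains counts, for each b, the a with y = g^(a - d b), and summing over y gives
2^(ℓ+m) for each b. -/
theorem sum_pairProb (hg : ∀ y : G, y ∈ Subgroup.zpowers g)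
    (hcard : 2 ^ (ℓ + m) ≤ Fintype.card G) (j : ℕ) :
    ∑ k ∈ Finset.range (2 ^ ℓ), pairProb ℓ m d g (j, k) = 1 / 2 ^ (ℓ + m) := by
  classical
  simp only [pairProb]
  rw [Finset.sum_comm]
  simp only [norm_mul, mul_pow]
  -- For fixed y and b at most one a contributes, because the a are fewer than the elements of the
  -- group.
  have hcol : ∀ (y : G) (b : ℕ), ‖∑ a ∈ Finset.range (2 ^ (ℓ + m)),
      phase (a * j / 2 ^ (ℓ + m)) * (if y = g ^ ((a : ℤ) - d * b) then 1 else 0)‖ ^ 2 =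
      ∑ a ∈ Finset.range (2 ^ (ℓ + m)), if y = g ^ ((a : ℤ) - d * b) then (1 : ℝ) else 0 := by
    intro y b
    by_cases hex : ∃ a ∈ Finset.range (2 ^ (ℓ + m)), y = g ^ ((a : ℤ) - d * b)
    · obtain ⟨a, ha, hy⟩ := hex
      have huniq : ∀ a' ∈ Finset.range (2 ^ (ℓ + m)), a' ≠ a → ¬ y = g ^ ((a' : ℤ) - d * b) := by
        intro a' ha' hne hy'
        rw [Finset.mem_range] at ha ha'
        have h : ((a' : ℤ) - d * b) = (a : ℤ) - d * b := by
          refine zpow_injOn_of_lt hg ?_ (hy'.symm.trans hy)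
          have hc : ((2 ^ (ℓ + m) : ℕ) : ℤ) ≤ Fintype.card G := by exact_mod_cast hcard
          rw [abs_lt]
          constructor <;> omega
        exact hne (by omega)
      rw [Finset.sum_eq_single_of_mem a ha, Finset.sum_eq_single_of_mem a ha, if_pos hy, if_pos hy,
        mul_one, norm_phase, one_pow]
      · intro a' ha' hne; rw [if_neg (huniq a' ha' hne)]
      · intro a' ha' hne; rw [if_neg (huniq a' ha' hne), mul_zero]
    · push Not at hex
      rw [Finset.sum_eq_zero, Finset.sum_eq_zero]
      · simp
      · intro a ha; rw [if_neg (hex a ha)]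
      · intro a ha; rw [if_neg (hex a ha), mul_zero]
  have hk : ∀ y : G, ∑ k ∈ Finset.range (2 ^ ℓ), ‖(1 / 2 ^ (ℓ + m + ℓ) : ℂ)‖ ^ 2 *
      ‖∑ b ∈ Finset.range (2 ^ ℓ), phase (b * k / (2 ^ ℓ : ℕ)) *
        ∑ a ∈ Finset.range (2 ^ (ℓ + m)), phase (a * j / 2 ^ (ℓ + m)) *
          (if y = g ^ ((a : ℤ) - d * b) then 1 else 0)‖ ^ 2 =
      ‖(1 / 2 ^ (ℓ + m + ℓ) : ℂ)‖ ^ 2 * ((2 ^ ℓ : ℕ) * ∑ b ∈ Finset.range (2 ^ ℓ),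
        ∑ a ∈ Finset.range (2 ^ (ℓ + m)), if y = g ^ ((a : ℤ) - d * b) then (1 : ℝ) else 0) := by
    intro y
    rw [← Finset.mul_sum, sum_norm_sq_fourier]
    simp only [hcol]
  rw [Finset.sum_congr rfl fun y _ => hk y, ← Finset.mul_sum, ← Finset.mul_sum, Finset.sum_comm]
  have hsum : ∀ b ∈ Finset.range (2 ^ ℓ), ∑ y : G, ∑ a ∈ Finset.range (2 ^ (ℓ + m)),
      (if y = g ^ ((a : ℤ) - d * b) then (1 : ℝ) else 0) = 2 ^ (ℓ + m) := by
    intro b _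
    rw [Finset.sum_comm]
    simp
  rw [Finset.sum_congr rfl hsum]
  simp only [one_div, norm_inv, norm_pow, Complex.norm_ofNat, Finset.sum_const, Finset.card_range,
    nsmul_eq_mul]
  push_cast
  rw [pow_add 2 (ℓ + m) ℓ]
  field_simp

/-- The pairs from which the logarithm can be recovered. -/
def GoodPair (ℓ m d : ℕ) (p : ℕ × ℕ) : Prop :=
  ∃ z : ℤ, 2 * |(d * p.1 + 2 ^ m * p.2 - z * 2 ^ (ℓ + m) : ℤ)| ≤ 2 ^ m

/-- With t the integer nearest to d j / 2^m, the residue k of -t modulo 2^ℓ works: d j + 2^m k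
differs from d j - 2^m t by a multiple of 2^(ℓ+m). -/
theorem exists_goodPair (ℓ m d j : ℕ) : ∃ k < 2 ^ ℓ, GoodPair ℓ m d (j, k) := by
  have hM : (0 : ℤ) < 2 ^ m := by positivity
  have hL : (0 : ℤ) < 2 ^ ℓ := by positivity
  set t : ℤ := (2 * (d * j) + 2 ^ m) / (2 * 2 ^ m) with ht
  have h1 := Int.mul_ediv_add_emod (2 * (d * j) + 2 ^ m : ℤ) (2 * 2 ^ m)
  have h2 := Int.emod_nonneg (2 * (d * j) + 2 ^ m : ℤ) (by positivity : (2 * 2 ^ m : ℤ) ≠ 0)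
  have h3 := Int.emod_lt_of_pos (2 * (d * j) + 2 ^ m : ℤ) (by positivity : (0 : ℤ) < 2 * 2 ^ m)
  rw [← ht] at h1
  have h4 := Int.mul_ediv_add_emod (-t) (2 ^ ℓ)
  have h5 := Int.emod_nonneg (-t) hL.ne'
  have h6 := Int.emod_lt_of_pos (-t) hL
  refine ⟨((-t) % 2 ^ ℓ).toNat, ?_, -((-t) / 2 ^ ℓ), ?_⟩
  · zify; rw [Int.toNat_of_nonneg h5]; exact h6
  · rw [Int.toNat_of_nonneg h5]
    have h7 : (d * j + 2 ^ m * ((-t) % 2 ^ ℓ) - -((-t) / 2 ^ ℓ) * 2 ^ (ℓ + m) : ℤ) =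
        d * j - 2 ^ m * t := by
      rw [pow_add]; linear_combination (2 ^ m : ℤ) * h4
    dsimp only
    rw [h7, ← abs_two, ← abs_mul, abs_le, abs_two]
    constructor <;> linarith

/-- The constant 1/5 comes from (2/π)² / 2 = 2/π² and π² ≤ 10. -/
theorem one_fifth_div_le {n L S : ℝ} (hn : 0 < n) (hL : 0 < L) (hS : n * L ^ 2 ≤ 2 * S) :
    1 / 5 / n ≤ (1 / (n * L)) ^ 2 * ((2 / Real.pi) ^ 2 * S) := by
  have hpi : Real.pi ^ 2 ≤ 10 := by
    have h1 := Real.pi_lt_d2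
    have h2 := Real.pi_pos
    nlinarith
  have hpi0 : 0 < Real.pi ^ 2 := by positivity
  have h1 : (1 / (n * L)) ^ 2 * ((2 / Real.pi) ^ 2 * (n * L ^ 2 / 2)) = 2 / Real.pi ^ 2 / n := by
    field_simp
  have h2 : (1 / (n * L)) ^ 2 * ((2 / Real.pi) ^ 2 * (n * L ^ 2 / 2)) ≤
      (1 / (n * L)) ^ 2 * ((2 / Real.pi) ^ 2 * S) := by
    gcongr; linarith
  refine le_trans ?_ h2
  rw [h1]
  refine div_le_div_of_nonneg_right ?_ hn.le
  rw [div_le_div_iff₀ (by norm_num) hpi0]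
  linarith

/-- For y = g^e with e fixed, substituting a = e + d b turns the phase into a constant times the
phase of b t, where t is the deviation of d j + 2^m k from a multiple of 2^(ℓ+m), divided by
2^(ℓ+m). Goodness means 2^ℓ |t| ≤ 1/2, so the terms do not cancel. -/
theorem pairProb_ge (hg : ∀ y : G, y ∈ Subgroup.zpowers g) (hd : d < 2 ^ m)
    (hcard : 2 ^ (ℓ + m) + 2 ^ ℓ * d ≤ Fintype.card G) (p : ℕ × ℕ) (hp : GoodPair ℓ m d p) :
    1 / 5 / 2 ^ (ℓ + m) ≤ pairProb ℓ m d g p := by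
  classical
  obtain ⟨z, hz⟩ := hp
  set n : ℕ := 2 ^ (ℓ + m) with hn
  set L : ℕ := 2 ^ ℓ with hL
  set D : ℤ := (d * p.1 + 2 ^ m * p.2 - z * 2 ^ (ℓ + m) : ℤ) with hD
  set t : ℝ := (D : ℝ) / n with ht
  have hnpos : (0 : ℝ) < n := by rw [hn]; positivity
  have hLpos : (0 : ℝ) < L := by rw [hL]; positivity
  have hnL : (n : ℝ) = L * 2 ^ m := by rw [hn, hL]; push_cast; rw [pow_add]
  have htL : L * |t| ≤ 1 / 2 := by
    have hz' : 2 * |(D : ℝ)| ≤ 2 ^ m := by exact_mod_cast hz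
    rw [ht, abs_div, abs_of_pos hnpos, hnL, ← div_div]
    rw [show (L : ℝ) * (|(D : ℝ)| / L / 2 ^ m) = |(D : ℝ)| / 2 ^ m by field_simp]
    rw [div_le_iff₀ (by positivity)]
    linarith
  -- `T` contains all values of a - d b, and `B e` is the set of those b that occur together with
  -- the value e. It is an interval, as e + d b is monotone in b.
  let B : ℤ → Finset ℕ := fun e => (Finset.range L).filter fun b => 0 ≤ e + d * b ∧ e + d * b < n
  let T : Finset ℤ := Finset.Ico (-(L * d : ℕ) : ℤ) n
  have hcardT : (T.card : ℝ) = n + L * d := by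
    simp only [T, Int.card_Ico]
    rw [show ((n : ℤ) - -((L * d : ℕ) : ℤ)) = ((n + L * d : ℕ) : ℤ) by push_cast; ring,
      Int.toNat_natCast]
    push_cast; ring
  have hdb : ∀ b ∈ Finset.range L, d * b ≤ L * d := fun b hb => by
    rw [mul_comm]; exact Nat.mul_le_mul_right _ (Finset.mem_range.1 hb).le
  have hamp : ∀ e ∈ T, 2 / Real.pi * (B e).card ≤ ‖∑ b ∈ Finset.range L,
      phase (b * p.2 / L) * ∑ a ∈ Finset.range n,
        phase (a * p.1 / 2 ^ (ℓ + m)) *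
          (if g ^ e = g ^ ((a : ℤ) - d * b) then 1 else 0)‖ := by
    intro e he
    rw [Finset.mem_Ico] at he
    have hterm : ∀ b ∈ Finset.range L, phase (b * p.2 / L) *
        ∑ a ∈ Finset.range n, phase (a * p.1 / 2 ^ (ℓ + m)) *
          (if g ^ e = g ^ ((a : ℤ) - d * b) then 1 else 0) =
        if 0 ≤ e + d * b ∧ e + d * b < n then phase (e * p.1 / n) * phase (b * t) else 0 := by
      intro b hb
      have hdb' := hdb b hb
      have hiff : ∀ a ∈ Finset.range n, g ^ e = g ^ ((a : ℤ) - d * b) ↔ e = (a : ℤ) - d * b := by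
        intro a ha
        rw [Finset.mem_range] at ha
        refine ⟨zpow_injOn_of_lt hg ?_, fun h => by rw [h]⟩
        have h1 : ((n + L * d : ℕ) : ℤ) ≤ Fintype.card G := by exact_mod_cast hcard
        push_cast at h1 he
        have h2 : ((d * b : ℕ) : ℤ) ≤ ((L * d : ℕ) : ℤ) := by exact_mod_cast hdb'
        have h3 : (0 : ℤ) ≤ (d : ℤ) * b := by positivity
        push_cast at h2
        rw [abs_lt]
        constructor <;> omega
      split_ifs with hcond
      · obtain ⟨a, ha⟩ := Int.eq_ofNat_of_zero_le hcond.1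
        have han : a ∈ Finset.range n := by
          rw [Finset.mem_range]; have := hcond.2; rw [ha] at this; exact_mod_cast this
        rw [Finset.sum_eq_single_of_mem a han, if_pos ((hiff a han).2 (by omega)), mul_one,
          ← phase_add, ← phase_add, ← phase_add_intCast (e * p.1 / n + b * t) (b * z)]
        · congr 1
          have haR : (a : ℝ) = e + d * b := by exact_mod_cast ha.symm
          have hDR : (D : ℝ) = d * p.1 + 2 ^ m * p.2 - z * (L * 2 ^ m) := by
            rw [hD]; push_cast; rw [pow_add, hL]; push_cast; ring
          have hpow : (2 : ℝ) ^ (ℓ + m) = L * 2 ^ m := by rw [hL, pow_add]; push_cast; ring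
          rw [haR, ht, hDR, hnL, hpow]
          push_cast
          field_simp
          ring
        · intro a' ha' hne
          rw [if_neg, mul_zero]
          rw [hiff a' ha']
          intro h; apply hne; omega
      · rw [Finset.sum_eq_zero, mul_zero]
        intro a ha
        rw [if_neg, mul_zero]
        rw [hiff a ha]
        rw [Finset.mem_range] at ha
        intro h; apply hcond; constructor <;> omega
    rw [Finset.sum_congr rfl hterm, ← Finset.sum_filter, ← Finset.mul_sum, norm_mul, norm_phase,
      one_mul]
    refine le_norm_sum_phase_of_ordConnected (B e) (Finset.filter_subset _ _) ?_ t htL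
    intro a ha b hb i hai hib
    simp only [B, Finset.mem_filter, Finset.mem_range] at ha hb ⊢
    have h1 : (d : ℤ) * a ≤ d * i := by exact_mod_cast Nat.mul_le_mul_left d hai
    have h2 : (d : ℤ) * i ≤ d * b := by exact_mod_cast Nat.mul_le_mul_left d hib
    exact ⟨by omega, by omega, by omega⟩
  have hsum : ∑ e ∈ T, ((B e).card : ℝ) = n * L := by
    have h1 : ∀ e, ((B e).card : ℝ) = ∑ b ∈ Finset.range L,
        if 0 ≤ e + d * b ∧ e + d * b < n then (1 : ℝ) else 0 := fun e => by
      rw [Finset.sum_boole]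
    simp only [h1]
    rw [Finset.sum_comm, Finset.sum_congr rfl (g := fun _ => (n : ℝ))]
    · simp [mul_comm]
    · intro b hb
      rw [Finset.sum_boole]
      have h2 : T.filter (fun e : ℤ => 0 ≤ e + d * b ∧ e + d * b < n) =
          Finset.Ico (-(d * b : ℤ)) (n - d * b) := by
        ext e
        have h3 : ((d * b : ℕ) : ℤ) ≤ ((L * d : ℕ) : ℤ) := by exact_mod_cast hdb b hb
        have h4 : (0 : ℤ) ≤ (d : ℤ) * b := by positivity
        push_cast at h3
        simp only [T, Finset.mem_filter, Finset.mem_Ico]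
        push_cast
        constructor
        · intro h; constructor <;> omega
        · intro h; refine ⟨⟨?_, ?_⟩, ?_, ?_⟩ <;> omega
      rw [h2, Int.card_Ico]
      simp
  -- The sizes of the sets `B e` add up to n L, and there are n + L d ≤ 2 n values e. So by
  -- Cauchy-Schwarz the squares of the sizes add up to at least n L² / 2.
  have hCS := sq_sum_le_card_mul_sum_sq (s := T) (f := fun e => ((B e).card : ℝ))
  rw [hsum, hcardT] at hCS
  have hinj : Set.InjOn (fun e : ℤ => g ^ e) T := by
    intro e he e' he' h
    simp only [T, Finset.coe_Ico, Set.mem_Ico] at he he'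
    refine zpow_injOn_of_lt hg ?_ h
    have h1 : ((n + L * d : ℕ) : ℤ) ≤ Fintype.card G := by exact_mod_cast hcard
    push_cast at h1 he he'
    rw [abs_lt]
    constructor <;> omega
  have hmain : ∑ e ∈ T, (1 / (n * L : ℝ)) ^ 2 * (2 / Real.pi * (B e).card) ^ 2 ≤
      pairProb ℓ m d g p := by
    have hle : ∑ y ∈ T.image (fun e : ℤ => g ^ e), ‖(1 / 2 ^ (ℓ + m + ℓ) : ℂ) *
        ∑ b ∈ Finset.range L, phase (b * p.2 / L) * ∑ a ∈ Finset.range n,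
          phase (a * p.1 / 2 ^ (ℓ + m)) *
            (if y = g ^ ((a : ℤ) - d * b) then 1 else 0)‖ ^ 2 ≤ pairProb ℓ m d g p :=
      Finset.sum_le_sum_of_subset_of_nonneg (Finset.subset_univ _) fun _ _ _ => sq_nonneg _
    rw [Finset.sum_image hinj] at hle
    refine le_trans (Finset.sum_le_sum fun e he => ?_) hle
    have hnorm : ‖(1 / 2 ^ (ℓ + m + ℓ) : ℂ)‖ = 1 / (n * L : ℝ) := by
      simp [hn, hL, pow_add]
    rw [norm_mul, hnorm, mul_pow _ ‖_‖]
    exact mul_le_mul_of_nonneg_left (pow_le_pow_left₀ (by positivity) (hamp e he) 2)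
      (sq_nonneg _)
  refine le_trans ?_ hmain
  simp only [mul_pow]
  rw [← Finset.mul_sum, ← Finset.mul_sum]
  set S := ∑ e ∈ T, ((B e).card : ℝ) ^ 2
  have hLd : (L : ℝ) * d ≤ n := by
    rw [hnL]
    exact mul_le_mul_of_nonneg_left (by exact_mod_cast hd.le) hLpos.le
  have hS0 : 0 ≤ S := Finset.sum_nonneg fun _ _ => by positivity
  have hS : n * (L : ℝ) ^ 2 ≤ 2 * S := by
    have h1 : (n * L : ℝ) ^ 2 ≤ (2 * n) * S :=
      hCS.trans (mul_le_mul_of_nonneg_right (by linarith) hS0)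
    have h2 : n * (n * (L : ℝ) ^ 2) ≤ n * (2 * S) := by linarith
    exact le_of_mul_le_mul_left h2 hnpos
  have hcast : (2 : ℝ) ^ (ℓ + m) = n := by rw [hn]; push_cast; rfl
  rw [hcast]
  exact one_fifth_div_le hnpos hLpos hS

theorem sum_circuit_prob (hg : ∀ y : G, y ∈ Subgroup.zpowers g)
    (hcard : 2 ^ (ℓ + m) ≤ Fintype.card G) (F : ℕ → ℝ) :
    ∑ w : Outcome ℓ m, F w.pair.1 * (circuit ℓ m).prob g (g ^ d) w =
      (∑ j ∈ Finset.range (2 ^ (ℓ + m)), F j) / 2 ^ (ℓ + m) := by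
  simp only [circuit_prob]
  rw [sum_outcome fun p => F p.1 * pairProb ℓ m d g p, Finset.sum_div]
  refine Finset.sum_congr rfl fun j _ => ?_
  dsimp only
  rw [← Finset.mul_sum, sum_pairProb hg hcard, mul_one_div]

theorem sum_circuit_prob_eq_one (hg : ∀ y : G, y ∈ Subgroup.zpowers g)
    (hcard : 2 ^ (ℓ + m) ≤ Fintype.card G) :
    ∑ w : Outcome ℓ m, (circuit ℓ m).prob g (g ^ d) w = 1 := by
  have h := sum_circuit_prob (d := d) hg hcard fun _ => 1
  simpa using h

theorem circuit_prob_nonneg (w : Outcome ℓ m) : 0 ≤ (circuit ℓ m).prob g (g ^ d) w := by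
  rw [circuit_prob]; exact pairProb_nonneg _

open Classical in
theorem sum_circuit_prob_goodPair (hg : ∀ y : G, y ∈ Subgroup.zpowers g) (hd : d < 2 ^ m)
    (hcard : 2 ^ (ℓ + m) + 2 ^ ℓ * d ≤ Fintype.card G) :
    1 / 5 ≤ ∑ w : Outcome ℓ m, if GoodPair ℓ m d w.pair then
      (circuit ℓ m).prob g (g ^ d) w else 0 := by
  simp only [circuit_prob]
  rw [sum_outcome fun p => if GoodPair ℓ m d p then pairProb ℓ m d g p else 0]
  have h : ∀ j ∈ Finset.range (2 ^ (ℓ + m)), 1 / 5 / (2 : ℝ) ^ (ℓ + m) ≤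
      ∑ k ∈ Finset.range (2 ^ ℓ),
        if GoodPair ℓ m d (j, k) then pairProb ℓ m d g (j, k) else 0 := by
    intro j _
    obtain ⟨k, hk, hgood⟩ := exists_goodPair ℓ m d j
    have h1 := Finset.single_le_sum (f := fun k =>
      if GoodPair ℓ m d (j, k) then pairProb ℓ m d g (j, k) else 0) (fun k _ => by
        split_ifs; exacts [pairProb_nonneg _, le_rfl]) (Finset.mem_range.2 hk)
    rw [if_pos hgood] at h1
    exact (pairProb_ge hg hd hcard _ hgood).trans h1
  refine le_trans ?_ (Finset.sum_le_sum h)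
  rw [Finset.sum_const, Finset.card_range, nsmul_eq_mul]
  push_cast
  rw [mul_div_cancel₀ _ (by positivity)]

end Distribution


/-! ### Independent runs -/

section Runs

variable {Ω : Type*} [Fintype Ω] {μ : Ω → ℝ}

theorem probOfRuns_le_of_forall {t : ℕ} {E : (Fin t → Ω) → Prop}
    {F : (Fin t → Ω) → ℝ} (hF : ∀ ω, 0 ≤ F ω) (h : ∀ ω, E ω → ∏ i, μ (ω i) ≤ F ω) :
    probOfRuns μ t E ≤ ∑ ω, F ω := by
  classical
  refine Finset.sum_le_sum fun ω _ => ?_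
  split_ifs with hE
  exacts [h ω hE, hF ω]

theorem probOfRuns_mono {t : ℕ} (hμ : ∀ w, 0 ≤ μ w) {E F : (Fin t → Ω) → Prop}
    (h : ∀ ω, E ω → F ω) : probOfRuns μ t E ≤ probOfRuns μ t F := by
  classical
  refine probOfRuns_le_of_forall (fun ω => ?_) fun ω hE => by rw [if_pos (h ω hE)]
  split_ifs
  exacts [Finset.prod_nonneg fun i _ => hμ _, le_rfl]

theorem probOfRuns_or_le {t : ℕ} (hμ : ∀ w, 0 ≤ μ w) (E F : (Fin t → Ω) → Prop) :
    probOfRuns μ t (fun ω => E ω ∨ F ω) ≤ probOfRuns μ t E + probOfRuns μ t F := by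
  classical
  have hp : ∀ ω : Fin t → Ω, 0 ≤ ∏ i, μ (ω i) := fun ω => Finset.prod_nonneg fun i _ => hμ _
  rw [probOfRuns, probOfRuns, probOfRuns, ← Finset.sum_add_distrib]
  refine Finset.sum_le_sum fun ω _ => ?_
  have := hp ω
  by_cases hE : E ω <;> by_cases hF : F ω <;> simp [hE, hF, this]

theorem probOfRuns_exists_le {t : ℕ} {ι : Type*} (hμ : ∀ w, 0 ≤ μ w) (A : Finset ι)
    (E : ι → (Fin t → Ω) → Prop) :
    probOfRuns μ t (fun ω => ∃ i ∈ A, E i ω) ≤ ∑ i ∈ A, probOfRuns μ t (E i) := by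
  classical
  induction A using Finset.induction_on with
  | empty => simp [probOfRuns]
  | insert i A hi ih =>
    rw [Finset.sum_insert hi]
    refine le_trans (probOfRuns_mono hμ (F := fun ω => E i ω ∨ ∃ i ∈ A, E i ω) ?_)
      ((probOfRuns_or_le hμ _ _).trans (by gcongr))
    rintro ω ⟨i', hi', h⟩
    rcases Finset.mem_insert.1 hi' with rfl | h'
    exacts [Or.inl h, Or.inr ⟨i', h', h⟩]

theorem sum_prod_runs (t : ℕ) (F : Fin t → Ω → ℝ) :
    ∑ ω : Fin t → Ω, ∏ i, F i (ω i) = ∏ i, ∑ w, F i w := by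
  classical
  rw [Finset.prod_univ_sum, Fintype.piFinset_univ]

theorem probOfRuns_true (t : ℕ) (h1 : ∑ w, μ w = 1) : probOfRuns μ t (fun _ => True) = 1 := by
  simp [probOfRuns, sum_prod_runs t fun _ => μ, h1]

-- Independence: runs outside `I` contribute the total mass 1, the others one factor each.
open Classical in
theorem probOfRuns_forall_mem {t : ℕ} (h1 : ∑ w, μ w = 1) (I : Finset (Fin t)) (S : Ω → Prop) :
    probOfRuns μ t (fun ω => ∀ i ∈ I, S (ω i)) = (∑ w, if S w then μ w else 0) ^ I.card := by
  have h : ∀ ω : Fin t → Ω, (if ∀ i ∈ I, S (ω i) then ∏ i, μ (ω i) else 0) =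
      ∏ i, if i ∈ I then (if S (ω i) then μ (ω i) else 0) else μ (ω i) := by
    intro ω
    split_ifs with hS
    · refine Finset.prod_congr rfl fun i _ => ?_
      split_ifs with hi hi'
      exacts [rfl, absurd (hS i hi) hi', rfl]
    · push Not at hS
      obtain ⟨i, hi, hi'⟩ := hS
      exact (Finset.prod_eq_zero (Finset.mem_univ i) (by rw [if_pos hi, if_neg hi'])).symm
  have h2 : ∑ ω : Fin t → Ω, (if ∀ i ∈ I, S (ω i) then ∏ i, μ (ω i) else 0) =
      ∏ i, ∑ w, if i ∈ I then (if S w then μ w else 0) else μ w := by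
    rw [Finset.sum_congr rfl fun ω _ => h ω]
    exact sum_prod_runs t fun i w => if i ∈ I then (if S w then μ w else 0) else μ w
  have h3 : ∀ i : Fin t, (∑ w, if i ∈ I then (if S w then μ w else 0) else μ w) =
      if i ∈ I then ∑ w, (if S w then μ w else 0) else 1 := fun i => by
    split_ifs
    exacts [rfl, h1]
  rw [Finset.prod_congr rfl fun i _ => h3 i, Finset.prod_ite_mem, Finset.univ_inter,
    Finset.prod_const] at h2
  rw [← h2, probOfRuns]
  exact Finset.sum_congr rfl fun ω _ => by congr

open Classical in
/-- A lower tail bound for the number of successes. -/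
theorem probOfRuns_card_lt {C s : ℕ} (hμ : ∀ w, 0 ≤ μ w) (h1 : ∑ w, μ w = 1) (S : Ω → Prop)
    (hS : 1 / 5 ≤ ∑ w, if S w then μ w else 0) :
    probOfRuns μ (C * s) (fun ω => (Finset.univ.filter fun i => S (ω i)).card < s) ≤
      (2 * (9 / 10) ^ C) ^ s := by
  have hw : ∀ w, 0 ≤ μ w * (if S w then 1 / 2 else 1) := fun w =>
    mul_nonneg (hμ w) (by split_ifs <;> norm_num)
  -- Chernoff's method with the weight 1/2 for each success: if there are X < s successes, then 2^s
  -- (1/2)^X ≥ 1. The mean weight of a run is at most 1 - 1/2 · 1/5 = 9/10.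
  have hbound : probOfRuns μ (C * s) (fun ω => (Finset.univ.filter fun i => S (ω i)).card < s) ≤
      ∑ ω : Fin (C * s) → Ω, 2 ^ s * ∏ i, (μ (ω i) * (if S (ω i) then 1 / 2 else 1)) := by
    refine probOfRuns_le_of_forall
      (fun ω => mul_nonneg (by positivity) (Finset.prod_nonneg fun i _ => hw _)) fun ω hlt => ?_
    rw [Finset.prod_mul_distrib, Finset.prod_ite, Finset.prod_const_one, mul_one,
      Finset.prod_const]
    set X := (Finset.univ.filter fun i => S (ω i)).card
    have h2 : (1 : ℝ) ≤ 2 ^ s * (1 / 2) ^ X := by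
      rw [one_div, inv_pow, ← div_eq_mul_inv, one_le_div (by positivity)]
      exact pow_le_pow_right₀ (by norm_num) hlt.le
    have h3 : 0 ≤ ∏ i, μ (ω i) := Finset.prod_nonneg fun i _ => hμ _
    nlinarith
  refine hbound.trans ?_
  rw [← Finset.mul_sum, sum_prod_runs (C * s) fun _ w => μ w * (if S w then 1 / 2 else 1),
    Finset.prod_const, Finset.card_univ, Fintype.card_fin, mul_pow, ← pow_mul]
  have h4 : ∑ w, μ w * (if S w then 1 / 2 else 1) ≤ 9 / 10 := by
    have h5 : ∀ w, μ w * (if S w then 1 / 2 else 1) = μ w - 1 / 2 * (if S w then μ w else 0) :=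
      fun w => by split_ifs <;> ring
    rw [Finset.sum_congr rfl fun w _ => h5 w, Finset.sum_sub_distrib, ← Finset.mul_sum, h1]
    linarith
  gcongr
  exact Finset.sum_nonneg fun w _ => hw w

end Runs

/-! ### Balanced tuples -/

/-- The multiple `a * j` is near to a multiple of `N`, up to `N / q`. -/
def NearMultiple (N q : ℕ) (a : ℤ) (j : ℕ) : Prop := ∃ b : ℤ, q * |a * j - b * N| < N

theorem card_le_of_abs_sub_lt (S : Finset ℕ) (Y : ℝ) (hY : 0 ≤ Y)
    (h : ∀ j ∈ S, ∀ j' ∈ S, |(j : ℝ) - j'| ≤ Y) : (S.card : ℝ) ≤ Y + 1 := by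
  rcases S.eq_empty_or_nonempty with rfl | hne
  · simp; linarith
  have hsub : S ⊆ Finset.Icc (S.min' hne) (S.max' hne) := fun j hj =>
    Finset.mem_Icc.2 ⟨S.min'_le j hj, S.le_max' j hj⟩
  have h1 := Finset.card_le_card hsub
  rw [Nat.card_Icc] at h1
  have h2 := h _ (S.max'_mem hne) _ (S.min'_mem hne)
  have h3 : S.min' hne ≤ S.max' hne := S.min'_le _ (S.max'_mem hne)
  have h4 : (S.card : ℝ) ≤ S.max' hne + 1 - S.min' hne := by
    have : (S.card : ℝ) + S.min' hne ≤ S.max' hne + 1 := by exact_mod_cast (by omega)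
    linarith
  have h5 := le_abs_self ((S.max' hne : ℝ) - S.min' hne)
  linarith

-- Only the a + 1 multiples b N with 0 ≤ b ≤ a can be near to a j. For each of them, j lies in an
-- interval of length at most 2 N/(q a). The product (a + 1)(2 N/(q a) + 1) is at most 4 N/q + 2 a.
open Classical in
theorem card_nearMultiple_le_of_pos {N q : ℕ} (hN : 0 < N) (hq : 0 < q) {a : ℤ} (ha : 0 < a) :
    (((Finset.range N).filter (NearMultiple N q a)).card : ℝ) ≤ 4 * (N / q) + 2 * a := by
  have hN' : (0 : ℝ) < N := by exact_mod_cast hN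
  have hq' : (0 : ℝ) < q := by exact_mod_cast hq
  have ha' : (1 : ℝ) ≤ a := by exact_mod_cast ha
  let T : ℤ → Finset ℕ := fun b =>
    (Finset.range N).filter fun j : ℕ => (q : ℤ) * |a * (j : ℤ) - b * N| < N
  have hsub : (Finset.range N).filter (NearMultiple N q a) ⊆
      (Finset.Icc (0 : ℤ) a).biUnion T := by
    intro j hj
    rw [Finset.mem_filter] at hj
    obtain ⟨hj, b, hb⟩ := hj
    have hjN : (j : ℤ) < N := by exact_mod_cast Finset.mem_range.1 hj
    have h1 : |a * (j : ℤ) - b * N| < N := lt_of_le_of_lt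
      (le_mul_of_one_le_left (abs_nonneg _) (by exact_mod_cast hq)) hb
    rw [abs_lt] at h1
    have hNz : (0 : ℤ) < N := by exact_mod_cast hN
    refine Finset.mem_biUnion.2 ⟨b, Finset.mem_Icc.2 ⟨?_, ?_⟩, Finset.mem_filter.2 ⟨hj, hb⟩⟩
    · by_contra hb0
      have : b * N ≤ (-1) * N := mul_le_mul_of_nonneg_right (by omega) hNz.le
      have : 0 ≤ a * (j : ℤ) := by positivity
      linarith
    · by_contra hba
      have h2 : (a + 1) * N ≤ b * N := mul_le_mul_of_nonneg_right (by omega) hNz.le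
      have h3 : a * (j : ℤ) ≤ a * N := mul_le_mul_of_nonneg_left hjN.le ha.le
      linarith
  have hT : ∀ b, ((T b).card : ℝ) ≤ 2 * (N / q) / a + 1 := by
    intro b
    refine card_le_of_abs_sub_lt _ _ (by positivity) fun j hj j' hj' => ?_
    simp only [T, Finset.mem_filter] at hj hj'
    have h1 : (q : ℝ) * |a * (j : ℝ) - b * N| < N := by exact_mod_cast hj.2
    have h2 : (q : ℝ) * |a * (j' : ℝ) - b * N| < N := by exact_mod_cast hj'.2
    have h3 : |a * ((j : ℝ) - j')| ≤ |a * (j : ℝ) - b * N| + |a * (j' : ℝ) - b * N| := by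
      rw [show a * ((j : ℝ) - j') = (a * (j : ℝ) - b * N) - (a * (j' : ℝ) - b * N) by ring]
      exact abs_sub _ _
    rw [abs_mul, abs_of_pos (by linarith : (0 : ℝ) < a)] at h3
    rw [le_div_iff₀ (by linarith), ← mul_div_assoc, le_div_iff₀ hq']
    nlinarith
  have h1 : (((Finset.range N).filter (NearMultiple N q a)).card : ℝ) ≤
      ∑ b ∈ Finset.Icc (0 : ℤ) a, ((T b).card : ℝ) := by
    exact_mod_cast (Finset.card_le_card hsub).trans Finset.card_biUnion_le
  refine h1.trans ((Finset.sum_le_sum fun b _ => hT b).trans ?_)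
  rw [Finset.sum_const, Int.card_Icc, nsmul_eq_mul]
  have h2 : (((a + 1 - 0).toNat : ℕ) : ℝ) = a + 1 := by
    have : (((a + 1 - 0).toNat : ℕ) : ℤ) = a + 1 := by rw [Int.toNat_of_nonneg] <;> omega
    exact_mod_cast this
  rw [h2]
  have hX : 0 ≤ (N : ℝ) / q := by positivity
  have h3 : 2 * ((N : ℝ) / q) / a ≤ 2 * (N / q) := div_le_self (by positivity) ha'
  have h4 : (a : ℝ) * (2 * (N / q) / a) = 2 * (N / q) := by field_simp
  nlinarith

theorem nearMultiple_neg {N q : ℕ} {a : ℤ} {j : ℕ} (h : NearMultiple N q a j) :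
    NearMultiple N q (-a) j := by
  obtain ⟨b, hb⟩ := h
  refine ⟨-b, ?_⟩
  rw [show -a * (j : ℤ) - -b * N = -(a * j - b * N) by ring, abs_neg]
  exact hb

open Classical in
theorem card_nearMultiple_le {N q : ℕ} (hN : 0 < N) (hq : 0 < q) {a : ℤ} (ha : a ≠ 0) :
    (((Finset.range N).filter (NearMultiple N q a)).card : ℝ) ≤ 4 * (N / q) + 2 * |(a : ℝ)| := by
  rcases lt_or_gt_of_ne ha with h | h
  · have h1 := card_nearMultiple_le_of_pos hN hq (neg_pos.2 h)
    rw [abs_of_neg (by exact_mod_cast h)]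
    refine le_trans ?_ (h1.trans_eq (by push_cast; ring))
    exact_mod_cast Finset.card_le_card fun j hj => by
      rw [Finset.mem_filter] at hj ⊢
      exact ⟨hj.1, nearMultiple_neg hj.2⟩
  · rw [abs_of_pos (by exact_mod_cast h)]
    exact card_nearMultiple_le_of_pos hN hq h

/-- No lattice at a level `h ≤ ℓ` belonging to the tuple `j` has a very short vector. -/
def Balanced {s : ℕ} (ℓ N κ : ℕ) (j : Fin s → ℕ) : Prop :=
  ∀ h ≤ ℓ, ∀ a : ℤ, a ≠ 0 → κ * |a| < 2 ^ (s * h) → ¬ ∀ i, NearMultiple N (κ * 2 ^ h) a (j i)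

theorem le_of_abs_sub_div_le {s ℓ m c : ℕ} (hs : 1 ≤ s)
    (h : |(ℓ : ℝ) - (m : ℝ) / (s : ℝ)| ≤ (c : ℝ)) : s * ℓ ≤ m + s * c ∧ m ≤ s * ℓ + s * c := by
  have hs' : (0 : ℝ) < s := by exact_mod_cast hs
  rw [abs_le] at h
  have h1 : (s : ℝ) * (m / s) = m := by field_simp
  constructor
  · have : (s : ℝ) * ℓ ≤ m + s * c := by nlinarith [h.2]
    exact_mod_cast this
  · have : (m : ℝ) ≤ s * ℓ + s * c := by nlinarith [h.1]
    exact_mod_cast this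

/-- The nonzero integers `a` with `κ |a| < B`. -/
noncomputable def smallMultipliers (κ B : ℕ) : Finset ℤ :=
  (Finset.Icc (-(B / κ : ℕ) : ℤ) (B / κ : ℕ)).erase 0

theorem mem_smallMultipliers {κ B : ℕ} (hκ : 0 < κ) {a : ℤ} (ha : a ≠ 0) (h : κ * |a| < B) :
    a ∈ smallMultipliers κ B := by
  rw [smallMultipliers, Finset.mem_erase, Finset.mem_Icc, ← abs_le]
  refine ⟨ha, ?_⟩
  rw [Int.abs_eq_natAbs] at h ⊢
  have h' : κ * a.natAbs < B := by exact_mod_cast h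
  exact_mod_cast (Nat.le_div_iff_mul_le hκ).2 (by rw [mul_comm]; exact h'.le)

theorem card_smallMultipliers_le (κ B : ℕ) :
    ((smallMultipliers κ B).card : ℝ) ≤ 2 * (B / κ) := by
  have h : (smallMultipliers κ B).card = 2 * (B / κ) := by
    rw [smallMultipliers]
    generalize B / κ = v
    rw [Finset.card_erase_of_mem (by rw [Finset.mem_Icc]; omega), Int.card_Icc]
    omega
  rw [h]
  push_cast
  gcongr
  exact Nat.cast_div_le

theorem abs_le_of_mem_smallMultipliers {κ B : ℕ} {a : ℤ} (h : a ∈ smallMultipliers κ B) :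
    |(a : ℝ)| ≤ B / κ := by
  rw [smallMultipliers, Finset.mem_erase, Finset.mem_Icc, ← abs_le] at h
  have h2 : |(a : ℝ)| ≤ ((B / κ : ℕ) : ℝ) := by
    have h3 : ((|a| : ℤ) : ℝ) ≤ (((B / κ : ℕ) : ℤ) : ℝ) := Int.cast_le.2 h.2
    rwa [Int.cast_abs, Int.cast_natCast] at h3
  exact h2.trans Nat.cast_div_le

/-! ### Unbalanced tuples are unlikely -/

section Success

variable {ℓ m d : ℕ} {G : Type*} [Group G] [Fintype G] {g : G}

/-- The uniform distribution of j turns the count of `card_nearMultiple_le` into a probability. Its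
term 2 |a| is of the same order as the other one because |a| ≤ 2^(s h)/κ and (s + 1) h ≤ ℓ + m + s
c. -/
theorem probOfRuns_nearMultiple_le {s c t κ h : ℕ} (hg : ∀ y : G, y ∈ Subgroup.zpowers g)
    (hcard : 2 ^ (ℓ + m) ≤ Fintype.card G) (hℓ : s * ℓ ≤ m + s * c) (hκ : 0 < κ) (hh : h ≤ ℓ)
    {a : ℤ} (ha : a ∈ smallMultipliers κ (2 ^ (s * h))) {I : Finset (Fin t)} (hI : I.card = s) :
    probOfRuns ((circuit ℓ m).prob g (g ^ d)) t
      (fun ω => ∀ i ∈ I, NearMultiple (2 ^ (ℓ + m)) (κ * 2 ^ h) a (ω i).pair.1) ≤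
      ((4 + 2 * 2 ^ (s * c)) / (κ * 2 ^ h)) ^ s := by
  classical
  rw [probOfRuns_forall_mem (sum_circuit_prob_eq_one hg hcard) I
    fun w => NearMultiple (2 ^ (ℓ + m)) (κ * 2 ^ h) a w.pair.1, hI]
  have h1 := sum_circuit_prob (d := d) hg hcard fun j =>
    if NearMultiple (2 ^ (ℓ + m)) (κ * 2 ^ h) a j then 1 else 0
  simp only [ite_mul, one_mul, zero_mul] at h1
  rw [h1, Finset.sum_boole]
  have ha0 : a ≠ 0 := (Finset.mem_erase.1 ha).1
  have hκ' : (0 : ℝ) < κ := by exact_mod_cast hκ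
  have h2 := card_nearMultiple_le (N := 2 ^ (ℓ + m)) (q := κ * 2 ^ h) (by positivity)
    (by positivity) ha0
  have h3 := abs_le_of_mem_smallMultipliers ha
  push_cast at h2 h3
  refine pow_le_pow_left₀ (by positivity) ?_ s
  rw [div_le_div_iff₀ (by positivity) (by positivity)]
  have h4 : (2 : ℝ) ^ (s * h) * 2 ^ h ≤ 2 ^ (s * c) * 2 ^ (ℓ + m) := by
    rw [← pow_add, ← pow_add]
    refine pow_le_pow_right₀ (by norm_num) ?_
    have := Nat.mul_le_mul_left s hh
    omega
  have h5 : |(a : ℝ)| * (κ * 2 ^ h) ≤ 2 ^ (s * c) * 2 ^ (ℓ + m) := by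
    refine le_trans ?_ h4
    rw [le_div_iff₀ hκ'] at h3
    rw [← mul_assoc]
    gcongr
  have h6 : (2 : ℝ) ^ (ℓ + m) / (κ * 2 ^ h) * (κ * 2 ^ h) = 2 ^ (ℓ + m) := by field_simp
  calc _ ≤ (4 * ((2 : ℝ) ^ (ℓ + m) / (κ * 2 ^ h)) + 2 * |(a : ℝ)|) * (κ * 2 ^ h) := by gcongr
    _ = 4 * ((2 : ℝ) ^ (ℓ + m) / (κ * 2 ^ h) * (κ * 2 ^ h)) + 2 * (|(a : ℝ)| * (κ * 2 ^ h)) := by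
        ring
    _ ≤ _ := by rw [h6]; linarith

/-- Union bound over the selections of runs, the levels and the multipliers. At level h there are at
most 2 · 2^(s h)/κ multipliers, each with probability at most K/(κ 2^h)^s. The powers of 2 cancel,
so all levels have the same bound 2 K/κ^(s+1), which is weakened to 2 K/κ² by s ≥ 1. -/
theorem probOfRuns_unbalanced_le {s c t κ : ℕ} (hs : 1 ≤ s)
    (hg : ∀ y : G, y ∈ Subgroup.zpowers g)
    (hcard : 2 ^ (ℓ + m) ≤ Fintype.card G) (hℓ : s * ℓ ≤ m + s * c) (hκ : 0 < κ) :
    probOfRuns ((circuit ℓ m).prob g (g ^ d)) t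
      (fun ω => ∃ I ∈ Finset.univ.filter (fun I : Finset (Fin t) => I.card = s),
        ∃ h ∈ Finset.range (ℓ + 1), ∃ a ∈ smallMultipliers κ (2 ^ (s * h)),
          ∀ i ∈ I, NearMultiple (2 ^ (ℓ + m)) (κ * 2 ^ h) a (ω i).pair.1) ≤
      2 ^ t * ((ℓ + 1) * (2 * (4 + 2 * 2 ^ (s * c)) ^ s / κ ^ 2)) := by
  have hμ : ∀ w, 0 ≤ (circuit ℓ m).prob g (g ^ d) w := circuit_prob_nonneg
  have hκ' : (1 : ℝ) ≤ κ := by exact_mod_cast hκ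
  set K : ℝ := (4 + 2 * 2 ^ (s * c)) ^ s with hK
  have hlevel : ∀ I ∈ Finset.univ.filter (fun I : Finset (Fin t) => I.card = s),
      ∀ h ∈ Finset.range (ℓ + 1), probOfRuns ((circuit ℓ m).prob g (g ^ d)) t
        (fun ω => ∃ a ∈ smallMultipliers κ (2 ^ (s * h)),
          ∀ i ∈ I, NearMultiple (2 ^ (ℓ + m)) (κ * 2 ^ h) a (ω i).pair.1) ≤ 2 * K / κ ^ 2 := by
    intro I hI h hh
    have h1 := probOfRuns_exists_le hμ (smallMultipliers κ (2 ^ (s * h)))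
      fun (a : ℤ) (ω : Fin t → Outcome ℓ m) =>
        ∀ i ∈ I, NearMultiple (2 ^ (ℓ + m)) (κ * 2 ^ h) a (ω i).pair.1
    refine h1.trans ((Finset.sum_le_sum fun a ha => probOfRuns_nearMultiple_le hg hcard hℓ hκ
      (Nat.lt_succ_iff.1 (Finset.mem_range.1 hh)) ha (Finset.mem_filter.1 hI).2).trans ?_)
    rw [Finset.sum_const, nsmul_eq_mul]
    have h2 := card_smallMultipliers_le κ (2 ^ (s * h))
    push_cast at h2
    calc _ ≤ 2 * ((2 : ℝ) ^ (s * h) / κ) * ((4 + 2 * 2 ^ (s * c)) / (κ * 2 ^ h)) ^ s := by gcongr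
      _ = 2 * K / κ ^ (s + 1) := by
        rw [div_pow, mul_pow, ← pow_mul, mul_comm h s, pow_succ, ← hK]
        field_simp
      _ ≤ 2 * K / κ ^ 2 := by
        gcongr 2 * K / ?_
        exact pow_le_pow_right₀ hκ' (by omega)
  refine (probOfRuns_exists_le hμ _ _).trans ?_
  refine (Finset.sum_le_sum fun I hI => (probOfRuns_exists_le hμ _ _).trans
    (Finset.sum_le_sum fun h hh => hlevel I hI h hh)).trans ?_
  rw [Finset.sum_const, Finset.sum_const, Finset.card_range, nsmul_eq_mul, nsmul_eq_mul]
  have h3 : ((Finset.univ.filter (fun I : Finset (Fin t) => I.card = s)).card : ℝ) ≤ 2 ^ t := by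
    have := Finset.card_filter_le Finset.univ (fun I : Finset (Fin t) => I.card = s)
    rw [Finset.card_univ, Fintype.card_finset, Fintype.card_fin] at this
    exact_mod_cast this
  push_cast
  gcongr

end Success

/-- With high probability some `s` of the runs yield good pairs that form a balanced tuple. -/
theorem exists_runs_constant (δ : ℝ) (hδ : 0 < δ) : ∃ C : ℕ, ∀ s : ℕ, 1 ≤ s → ∀ c : ℕ,
    ∃ κ₀ : ℕ, 0 < κ₀ ∧ ∀ (m ℓ d : ℕ), d < 2 ^ m → |(ℓ : ℝ) - (m : ℝ) / (s : ℝ)| ≤ (c : ℝ) →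
      ∀ (G : Type*) [Group G] [Fintype G] (g : G), (∀ y : G, y ∈ Subgroup.zpowers g) →
        2 ^ (ℓ + m) + 2 ^ ℓ * d ≤ Fintype.card G →
        1 - δ ≤ probOfRuns ((circuit ℓ m).prob g (g ^ d)) (C * s) fun ω =>
          ∃ I : Finset (Fin (C * s)), I.card = s ∧ ∀ e : Fin s ≃ I,
            (∀ i, GoodPair ℓ m d (ω (e i)).pair) ∧
              Balanced ℓ (2 ^ (ℓ + m)) (κ₀ * (m + 1)) fun i => (ω (e i)).pair.1 := by
  -- This makes 2 (9/10)^C at most min(1, δ/2). Hence its s-th power is at most δ/2 for every s ≥ 1,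
  -- and `C` depends on δ only.
  obtain ⟨C, hC⟩ := exists_pow_lt_of_lt_one (show 0 < min 1 (δ / 2) / 2 by positivity)
    (show (9 / 10 : ℝ) < 1 by norm_num)
  refine ⟨C, fun s hs c => ?_⟩
  set K : ℝ := (4 + 2 * 2 ^ (s * c)) ^ s with hK
  have hKpos : 0 < K := by positivity
  -- `κ₀` compensates the number of selections and the constants; the factor m + 1 of κ compensates
  -- the number ℓ + 1 ≤ (c + 1)(m + 1) of levels.
  obtain ⟨κ₀, hκ₀⟩ := exists_nat_gt (2 ^ (C * s) * ((c + 1) * (2 * K)) / (δ / 2))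
  have hκpos : 0 < κ₀ := by
    have h : (0 : ℝ) < κ₀ := lt_trans (by positivity) hκ₀
    exact_mod_cast h
  refine ⟨κ₀, hκpos, fun m ℓ d hd hℓ G _ _ g hg hcard => ?_⟩
  classical
  have hcard' : 2 ^ (ℓ + m) ≤ Fintype.card G := le_trans (Nat.le_add_right _ _) hcard
  have hsℓ := (le_of_abs_sub_div_le hs hℓ).1
  set κ := κ₀ * (m + 1) with hκ
  have hκp : 0 < κ := by positivity
  have hμ : ∀ w, 0 ≤ (circuit ℓ m).prob g (g ^ d) w := circuit_prob_nonneg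
  have h1 := sum_circuit_prob_eq_one (d := d) hg hcard'
  have hfew := probOfRuns_card_lt (C := C) (s := s) hμ h1 (fun w => GoodPair ℓ m d w.pair)
    (sum_circuit_prob_goodPair hg hd hcard)
  have hunb := probOfRuns_unbalanced_le (d := d) (t := C * s) hs hg hcard' hsℓ hκp
  rw [← hK] at hunb
  have hfew' : (2 * (9 / 10 : ℝ) ^ C) ^ s ≤ δ / 2 := by
    have h2 : 2 * (9 / 10 : ℝ) ^ C ≤ min 1 (δ / 2) := by linarith
    calc (2 * (9 / 10 : ℝ) ^ C) ^ s ≤ 2 * (9 / 10 : ℝ) ^ C :=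
          pow_le_of_le_one (by positivity) (h2.trans (min_le_left _ _)) (by omega)
      _ ≤ δ / 2 := h2.trans (min_le_right _ _)
  have hunb' : (2 : ℝ) ^ (C * s) * ((ℓ + 1) * (2 * K / κ ^ 2)) ≤ δ / 2 := by
    have hℓc : (ℓ : ℝ) + 1 ≤ (c + 1) * (m + 1) := by
      have h2 : ℓ ≤ m + c := by
        by_contra hlt
        push Not at hlt
        have h3 : s * (m + c + 1) ≤ s * ℓ := Nat.mul_le_mul_left s hlt
        have h4 : m ≤ s * m := Nat.le_mul_of_pos_left m hs
        nlinarith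
      have h3 : (ℓ : ℝ) ≤ m + c := by exact_mod_cast h2
      have h4 : (0 : ℝ) ≤ c * m := by positivity
      linarith
    have hκ₀' : (1 : ℝ) ≤ κ₀ := by exact_mod_cast hκpos
    have h5 : (2 : ℝ) ^ (C * s) * ((c + 1) * (2 * K)) ≤ δ / 2 * κ₀ := by
      rw [div_lt_iff₀ (by positivity)] at hκ₀
      linarith
    calc (2 : ℝ) ^ (C * s) * ((ℓ + 1) * (2 * K / κ ^ 2))
        ≤ (2 : ℝ) ^ (C * s) * (((c + 1) * (m + 1)) * (2 * K / κ ^ 2)) := by gcongr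
      _ = (2 : ℝ) ^ (C * s) * ((c + 1) * (2 * K)) * ((m + 1) / κ ^ 2) := by ring
      _ ≤ δ / 2 * κ₀ * ((m + 1) / κ ^ 2) := by gcongr
      _ = δ / 2 / (κ₀ * (m + 1)) := by rw [hκ]; push_cast; field_simp
      _ ≤ δ / 2 := div_le_self (by positivity) (by
          have : (0 : ℝ) ≤ m := by positivity
          nlinarith)
  rw [← probOfRuns_true (C * s) h1, sub_le_iff_le_add]
  have hcover := (probOfRuns_mono hμ (E := fun _ => True) (F := fun ω =>
    (∃ I : Finset (Fin (C * s)), I.card = s ∧ ∀ e : Fin s ≃ I,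
      (∀ i, GoodPair ℓ m d (ω (e i)).pair) ∧
        Balanced ℓ (2 ^ (ℓ + m)) κ fun i => (ω (e i)).pair.1) ∨
    ((Finset.univ.filter fun i => GoodPair ℓ m d (ω i).pair).card < s ∨
      ∃ I ∈ Finset.univ.filter (fun I : Finset (Fin (C * s)) => I.card = s),
        ∃ h ∈ Finset.range (ℓ + 1), ∃ a ∈ smallMultipliers κ (2 ^ (s * h)),
          ∀ i ∈ I, NearMultiple (2 ^ (ℓ + m)) (κ * 2 ^ h) a (ω i).pair.1)) ?_)
  · refine hcover.trans ((probOfRuns_or_le hμ _ _).trans ?_)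
    have h6 := probOfRuns_or_le (t := C * s) hμ
      (fun ω => (Finset.univ.filter fun i => GoodPair ℓ m d (ω i).pair).card < s)
      (fun ω => ∃ I ∈ Finset.univ.filter (fun I : Finset (Fin (C * s)) => I.card = s),
        ∃ h ∈ Finset.range (ℓ + 1), ∃ a ∈ smallMultipliers κ (2 ^ (s * h)),
          ∀ i ∈ I, NearMultiple (2 ^ (ℓ + m)) (κ * 2 ^ h) a (ω i).pair.1)
    linarith
  · intro ω _
    -- Outside of both bad events any s of the good runs serve: unbalancedness was excluded for all
    -- selections at once, and it does not depend on the order of the tuple.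
    by_cases hA : (Finset.univ.filter fun i => GoodPair ℓ m d (ω i).pair).card < s
    · exact Or.inr (Or.inl hA)
    by_cases hB : ∃ I ∈ Finset.univ.filter (fun I : Finset (Fin (C * s)) => I.card = s),
        ∃ h ∈ Finset.range (ℓ + 1), ∃ a ∈ smallMultipliers κ (2 ^ (s * h)),
          ∀ i ∈ I, NearMultiple (2 ^ (ℓ + m)) (κ * 2 ^ h) a (ω i).pair.1
    · exact Or.inr (Or.inr hB)
    left
    obtain ⟨I, hIsub, hI⟩ := Finset.exists_subset_card_eq (not_lt.1 hA)
    refine ⟨I, hI, fun e => ⟨fun i => (Finset.mem_filter.1 (hIsub (e i).2)).2, ?_⟩⟩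
    intro h hh a ha0 ha hall
    refine hB ⟨I, Finset.mem_filter.2 ⟨Finset.mem_univ _, hI⟩, h,
      Finset.mem_range.2 (Nat.lt_succ_of_le hh), a,
      mem_smallMultipliers hκp ha0 (by exact_mod_cast ha), fun i hi => ?_⟩
    have h7 := hall (e.symm ⟨i, hi⟩)
    dsimp only at h7
    rwa [e.apply_symm_apply] at h7


/-! ### Geometry of numbers -/

section Lattice

variable {ι : Type*} [Fintype ι]

/-- Extract a basis from `S` and round the coordinates of `p`. Each of the basis vectors contributes
an error of at most `R`. -/
theorem exists_mem_addSubgroup_near (L : AddSubgroup (ι → ℝ)) (R : ℝ) (S : Set (ι → ℝ))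
    (hSL : ∀ v ∈ S, v ∈ L) (hSR : ∀ v ∈ S, ∀ k, |v k| ≤ R) (hspan : Submodule.span ℝ S = ⊤)
    (p : ι → ℝ) : ∃ v ∈ L, ∀ k, |v k - p k| ≤ Fintype.card ι * R := by
  classical
  obtain ⟨b, hbS, hb, hli⟩ := exists_linearIndependent ℝ S
  let B : Module.Basis b ℝ (ι → ℝ) := Module.Basis.mk hli (by
    rw [Subtype.range_coe_subtype, Set.ofPred_mem_eq, hb, hspan])
  have : Finite b := Module.Finite.finite_basis B
  have := Fintype.ofFinite b
  have hBv : ∀ v : b, B v = v := fun v => by simp [B]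
  have hcard : Fintype.card b = Fintype.card ι := by
    rw [← Module.finrank_eq_card_basis B, Module.finrank_pi]
  refine ⟨∑ v : b, (round (B.repr p v)) • (v : ι → ℝ),
    L.sum_mem fun v _ => L.zsmul_mem (hSL v (hbS v.2)) _, fun k => ?_⟩
  have hp : p = ∑ v : b, B.repr p v • (v : ι → ℝ) := by
    conv_lhs => rw [← B.sum_repr p]
    simp only [hBv]
  have hpk : p k = ∑ v : b, B.repr p v * (v : ι → ℝ) k := by
    conv_lhs => rw [hp]
    simp
  rw [hpk, Finset.sum_apply, ← Finset.sum_sub_distrib]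
  refine (Finset.abs_sum_le_sum_abs _ _).trans ?_
  rw [← hcard, ← nsmul_eq_mul, ← Finset.card_univ]
  refine Finset.sum_le_card_nsmul _ _ _ fun v _ => ?_
  have h1 : |(round (B.repr p v) : ℝ) - B.repr p v| ≤ 1 := by
    rw [abs_sub_comm]; exact (abs_sub_round _).trans (by norm_num)
  have h2 := hSR v (hbS v.2) k
  simp only [Pi.smul_apply, zsmul_eq_mul]
  rw [← sub_mul, abs_mul]
  calc _ ≤ 1 * R := mul_le_mul h1 h2 (abs_nonneg _) zero_le_one
    _ = R := one_mul R

/-- Points with mutual distance at least 1/κ that lie in a hyperplane and in a cube of size `R` are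
few: their number is of order R^(D-1), not R^D. A larger set therefore spans. -/
theorem span_eq_top_of_card_lt [DecidableEq ι] [Nonempty ι] (L : AddSubgroup (ι → ℝ)) {κ R : ℕ}
    (hκ : 0 < κ) (hsep : ∀ v ∈ L, (∀ k, κ * |v k| < 1) → v = 0) (S : Finset (ι → ℝ))
    (hSL : ∀ v ∈ S, v ∈ L) (hSR : ∀ v ∈ S, ∀ k, |v k| ≤ R)
    (hcard : (2 * (R * (Fintype.card ι * κ)) + 1) ^ (Fintype.card ι - 1) < S.card) :
    Submodule.span ℝ (S : Set (ι → ℝ)) = ⊤ := by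
  by_contra hne
  obtain ⟨f, hf0, hf⟩ := Submodule.exists_le_ker_of_lt_top _ (lt_top_iff_ne_top.2 hne)
  set D := Fintype.card ι with hD
  have hDpos : 0 < D := Fintype.card_pos
  set F : ι → ℝ := fun k => f (Pi.single k 1) with hF
  have hfx : ∀ x : ι → ℝ, f x = ∑ k, x k * F k := fun x => by
    rw [LinearMap.pi_apply_eq_sum_univ f x]
    refine Finset.sum_congr rfl fun k _ => ?_
    rw [smul_eq_mul, hF]
    congr 2
    funext k'
    simp [Pi.single_apply, eq_comm]
  -- In the equation of the hyperplane the coefficient of the k-th coordinate is the largest, so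
  -- this coordinate is bounded by the sum of the absolute values of the others.
  obtain ⟨k, hk⟩ := Finite.exists_max fun k => |F k|
  have hFk : 0 < |F k| := by
    by_contra h0
    apply hf0
    refine LinearMap.ext fun x => ?_
    rw [hfx, LinearMap.zero_apply]
    refine Finset.sum_eq_zero fun k' _ => ?_
    have : |F k'| = 0 := le_antisymm ((hk k').trans (not_lt.1 h0)) (abs_nonneg _)
    rw [abs_eq_zero.1 this, mul_zero]
  have hQ : (0 : ℝ) < D * κ := by positivity
  -- Two points in one cell differ by less than 1/(D κ) in all coordinates but the k-th, hence by at
  -- most (D - 1)/(D κ) < 1/κ in the k-th, and so they coincide.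
  let cell : (ι → ℝ) → ({k' // k' ≠ k} → ℤ) := fun v k' => ⌊v k' * (D * κ)⌋
  let cells : Finset ({k' // k' ≠ k} → ℤ) := Fintype.piFinset fun _ =>
    Finset.Icc (-(R * (D * κ) : ℕ) : ℤ) (R * (D * κ) : ℕ)
  have hcells : cells.card = (2 * (R * (D * κ)) + 1) ^ (D - 1) := by
    simp only [cells]
    rw [Fintype.card_piFinset, Finset.prod_const, Int.card_Icc, Finset.card_univ,
      Fintype.card_subtype_compl,
      Fintype.card_subtype_eq, ← hD]
    congr 1
    generalize R * (D * κ) = X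
    omega
  have hmaps : ∀ v ∈ S, cell v ∈ cells := by
    intro v hv
    rw [Fintype.mem_piFinset]
    intro k'
    have h1 := abs_le.1 (hSR v hv k')
    rw [Finset.mem_Icc]
    constructor
    · rw [Int.le_floor]
      push_cast
      nlinarith
    · have h2 : ((⌊v k' * (D * κ)⌋ : ℤ) : ℝ) ≤ ((R * (D * κ) : ℕ) : ℤ) := by
        refine (Int.floor_le _).trans ?_
        push_cast
        nlinarith
      exact Int.cast_le.1 h2
  obtain ⟨u, hu, v, hv, huv, hcell⟩ :=
    Finset.exists_ne_map_eq_of_card_lt_of_maps_to (by rw [hcells]; exact hcard) hmaps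
  set x := u - v with hx
  have hother : ∀ k', k' ≠ k → |x k'| < 1 / (D * κ) := by
    intro k' hk'
    have h1 : ⌊u k' * (D * κ)⌋ = ⌊v k' * (D * κ)⌋ := congrFun hcell ⟨k', hk'⟩
    have h2 := Int.abs_sub_lt_one_of_floor_eq_floor h1
    rw [← sub_mul, abs_mul, abs_of_pos hQ] at h2
    rw [lt_div_iff₀ hQ]
    exact h2
  have hxL : x ∈ L := L.sub_mem (hSL u hu) (hSL v hv)
  have hfz : f x = 0 := by
    have h1 := hf (Submodule.subset_span hu)
    have h2 := hf (Submodule.subset_span hv)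
    rw [LinearMap.mem_ker] at h1 h2
    rw [hx, map_sub, h1, h2, sub_zero]
  have hxk : |x k| ≤ ∑ k' ∈ Finset.univ.erase k, |x k'| := by
    rw [hfx, ← Finset.add_sum_erase _ _ (Finset.mem_univ k)] at hfz
    have h1 : |x k| * |F k| ≤ (∑ k' ∈ Finset.univ.erase k, |x k'|) * |F k| := by
      rw [← abs_mul, eq_neg_of_add_eq_zero_left hfz, abs_neg, Finset.sum_mul]
      refine (Finset.abs_sum_le_sum_abs _ _).trans (Finset.sum_le_sum fun k' _ => ?_)
      rw [abs_mul]
      exact mul_le_mul_of_nonneg_left (hk k') (abs_nonneg _)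
    exact le_of_mul_le_mul_right h1 hFk
  have hxk' : |x k| ≤ (D - 1 : ℕ) * (1 / (D * κ)) := by
    refine hxk.trans ?_
    have h1 := Finset.sum_le_card_nsmul (Finset.univ.erase k) (fun k' => |x k'|)
      (1 / (D * κ : ℝ)) fun k' hk' => (hother k' (Finset.ne_of_mem_erase hk')).le
    rwa [nsmul_eq_mul, Finset.card_erase_of_mem (Finset.mem_univ k), Finset.card_univ] at h1
  have hκ' : (0 : ℝ) < κ := by exact_mod_cast hκ
  have hD' : (1 : ℝ) ≤ D := by exact_mod_cast hDpos
  have hxz : x = 0 := by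
    refine hsep x hxL fun k' => ?_
    by_cases hk' : k' = k
    · subst hk'
      rw [Nat.cast_sub hDpos, mul_one_div, le_div_iff₀ hQ] at hxk'
      push_cast at hxk'
      by_contra hge
      push Not at hge
      nlinarith [abs_nonneg (x k')]
    · have h1 := hother k' hk'
      rw [lt_div_iff₀ hQ] at h1
      have h2 : |x k'| * κ ≤ |x k'| * (D * κ) := by
        apply mul_le_mul_of_nonneg_left _ (abs_nonneg _)
        nlinarith
      linarith
  exact huv (sub_eq_zero.1 hxz)

end Lattice

/-- The lattice at level `h` belonging to the tuple `j`. -/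
noncomputable def levelHom {s : ℕ} (N h : ℕ) (j : Fin s → ℕ) :
    ℤ × (Fin s → ℤ) →+ (Option (Fin s) → ℝ) where
  toFun v := fun k => match k with
    | none => (v.1 : ℝ) / 2 ^ (s * h)
    | some i => 2 ^ h * (v.1 * j i / N - v.2 i)
  map_zero' := by funext k; cases k <;> simp
  map_add' u v := by
    funext k
    cases k <;> simp <;> ring

/-- The covering radius of a balanced lattice, in the units of its level. -/
def coveringBound (s κ : ℕ) : ℕ := (s + 1) * (2 * (3 * ((s + 1) * κ)) ^ s)

theorem abs_sub_lt_of_ediv_eq {x y n : ℤ} (hn : 0 < n) (h : x / n = y / n) :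
    |x - y| < n := by
  have h1 := Int.mul_ediv_add_emod x n
  have h2 := Int.mul_ediv_add_emod y n
  have h3 := Int.emod_nonneg x hn.ne'
  have h4 := Int.emod_nonneg y hn.ne'
  have h5 := Int.emod_lt_of_pos x hn
  have h6 := Int.emod_lt_of_pos y hn
  rw [h] at h1
  rw [abs_lt]
  constructor <;> linarith

/-! ### Short vectors and covering radius at one level -/

section Level

variable {s N κ h : ℕ} {j : Fin s → ℕ}

/-- Balance at level h says that no lattice vector with a ≠ 0 is shorter than 1/κ. If a = 0, the
other coordinates are integer multiples of 2^h, so a short vector vanishes. -/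
theorem levelHom_eq_zero (hN : 0 < N) (hκ : 0 < κ)
    (hbal : ∀ a : ℤ, a ≠ 0 → κ * |a| < 2 ^ (s * h) → ¬ ∀ i, NearMultiple N (κ * 2 ^ h) a (j i))
    (v : ℤ × (Fin s → ℤ)) (hv : ∀ k, κ * |levelHom N h j v k| < 1) : levelHom N h j v = 0 := by
  have hN' : (0 : ℝ) < N := by exact_mod_cast hN
  have hκ' : (1 : ℝ) ≤ κ := by exact_mod_cast hκ
  have ha : v.1 = 0 := by
    by_contra hne
    refine hbal v.1 hne ?_ fun i => ⟨v.2 i, ?_⟩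
    · have h1 := hv none
      simp only [levelHom, AddMonoidHom.coe_mk, ZeroHom.coe_mk] at h1
      rw [abs_div, abs_of_pos (by positivity : (0 : ℝ) < 2 ^ (s * h)), ← mul_div_assoc,
        div_lt_one (by positivity)] at h1
      exact_mod_cast h1
    · have h1 := hv (some i)
      simp only [levelHom, AddMonoidHom.coe_mk, ZeroHom.coe_mk] at h1
      have h2 : (2 : ℝ) ^ h * (v.1 * j i / N - v.2 i) = 2 ^ h * (v.1 * j i - v.2 i * N) / N := by
        field_simp
      rw [h2, abs_div, abs_mul, abs_of_pos (by positivity : (0 : ℝ) < 2 ^ h), abs_of_pos hN',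
        ← mul_div_assoc, div_lt_one hN', ← mul_assoc] at h1
      exact_mod_cast h1
  have hb : ∀ i, v.2 i = 0 := by
    intro i
    by_contra hne
    have h1 := hv (some i)
    simp only [levelHom, AddMonoidHom.coe_mk, ZeroHom.coe_mk, ha] at h1
    have h2 : (1 : ℝ) ≤ |(v.2 i : ℝ)| := by exact_mod_cast Int.one_le_abs hne
    have h3 : (1 : ℝ) ≤ 2 ^ h := one_le_pow₀ (by norm_num)
    simp only [Int.cast_zero, zero_mul, zero_div, zero_sub, abs_mul, abs_neg, abs_pow,
      abs_two] at h1
    have h4 : (1 : ℝ) ≤ 2 ^ h * |(v.2 i : ℝ)| := one_le_mul_of_one_le_of_one_le h3 h2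
    have h5 := one_le_mul_of_one_le_of_one_le hκ' h4
    linarith
  have : v = 0 := Prod.ext ha (funext hb)
  rw [this, map_zero]

/-- Dirichlet's pigeonhole argument. The 2^(u + s h) multipliers a are sorted by the residues of a
j_i, each to a precision of N/2^(h-u). There are 2^(s(h-u)) cells, so one of them receives at least
2^(u(s+1)) multipliers; their differences from one of them give the short vectors. -/
theorem exists_many_short_vectors {u : ℕ} (hN : 0 < N) (hu : u ≤ h) :
    ∃ S : Finset (Option (Fin s) → ℝ), (∀ v ∈ S, v ∈ (levelHom N h j).range) ∧
      (∀ v ∈ S, ∀ k, |v k| ≤ (2 ^ u : ℕ)) ∧ 2 ^ (u * (s + 1)) ≤ S.card := by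
  classical
  have hN' : (0 : ℝ) < N := by exact_mod_cast hN
  let cell : ℕ → (Fin s → ℕ) := fun a i => (a * j i % N) * 2 ^ (h - u) / N
  let cells : Finset (Fin s → ℕ) := Fintype.piFinset fun _ => Finset.range (2 ^ (h - u))
  have hmaps : ∀ a ∈ Finset.range (2 ^ (u + s * h)), cell a ∈ cells := by
    intro a _
    rw [Fintype.mem_piFinset]
    intro i
    rw [Finset.mem_range, Nat.div_lt_iff_lt_mul hN, mul_comm]
    exact Nat.mul_lt_mul_of_pos_left (Nat.mod_lt _ hN) (by positivity)
  have hne : cells.Nonempty := ⟨cell 0, hmaps 0 (by simp)⟩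
  obtain ⟨y, -, hy⟩ := Finset.exists_le_card_fiber_of_mul_le_card_of_maps_to
    (n := 2 ^ (u * (s + 1))) hmaps hne (by
      rw [Fintype.card_piFinset_const, Finset.card_range, Finset.card_range,
        ← pow_mul, ← pow_add]
      apply Nat.pow_le_pow_right (by norm_num)
      obtain ⟨v, rfl⟩ := Nat.exists_eq_add_of_le hu
      rw [Nat.add_sub_cancel_left]
      apply le_of_eq
      ring)
  set T := (Finset.range (2 ^ (u + s * h))).filter fun a => cell a = y with hT
  have hTne : T.Nonempty := Finset.card_pos.1 (lt_of_lt_of_le (by positivity) hy)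
  obtain ⟨a₀, ha₀⟩ := hTne
  rw [hT, Finset.mem_filter, Finset.mem_range] at ha₀
  let vec : ℕ → (Option (Fin s) → ℝ) := fun a =>
    levelHom N h j ((a : ℤ) - a₀, fun i => ((a * j i / N : ℕ) : ℤ) - (a₀ * j i / N : ℕ))
  have hinj : Set.InjOn vec T := by
    intro a _ a' _ heq
    have h1 := congrFun heq none
    simp only [vec, levelHom, AddMonoidHom.coe_mk, ZeroHom.coe_mk] at h1
    rw [div_left_inj' (by positivity)] at h1
    push_cast at h1
    have h2 : (a : ℝ) = a' := by linarith
    exact_mod_cast h2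
  refine ⟨T.image vec, ?_, ?_, ?_⟩
  · intro v hv
    obtain ⟨a, _, rfl⟩ := Finset.mem_image.1 hv
    exact ⟨_, rfl⟩
  · intro v hv k
    obtain ⟨a, ha, rfl⟩ := Finset.mem_image.1 hv
    rw [hT, Finset.mem_filter, Finset.mem_range] at ha
    simp only [vec, levelHom, AddMonoidHom.coe_mk, ZeroHom.coe_mk]
    cases k with
    | none =>
      dsimp only
      rw [abs_div, abs_of_pos (by positivity : (0 : ℝ) < 2 ^ (s * h)),
        div_le_iff₀ (by positivity)]
      have h1 : |(a : ℤ) - a₀| ≤ 2 ^ (u + s * h) := by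
        have h2 : ((a : ℕ) : ℤ) < ((2 ^ (u + s * h) : ℕ) : ℤ) := by exact_mod_cast ha.1
        have h3 : ((a₀ : ℕ) : ℤ) < ((2 ^ (u + s * h) : ℕ) : ℤ) := by exact_mod_cast ha₀.1
        push_cast at h2 h3
        rw [abs_le]
        constructor <;> linarith [Int.natCast_nonneg a, Int.natCast_nonneg a₀]
      rw [pow_add] at h1
      push_cast
      exact_mod_cast h1
    | some i =>
      dsimp only
      have hcell : cell a i = cell a₀ i := by rw [ha.2, ha₀.2]
      set r := a * j i % N with hr
      set r₀ := a₀ * j i % N with hr₀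
      have h1 : |((r * 2 ^ (h - u) : ℕ) : ℤ) - ((r₀ * 2 ^ (h - u) : ℕ) : ℤ)| < N := by
        apply abs_sub_lt_of_ediv_eq (by exact_mod_cast hN)
        exact_mod_cast hcell
      have h2 : |(r : ℝ) - r₀| * 2 ^ (h - u) < N := by
        have h3 : |((r : ℝ) - r₀) * 2 ^ (h - u)| < N := by
          rw [sub_mul]; exact_mod_cast h1
        rwa [abs_mul, abs_of_pos (by positivity : (0 : ℝ) < 2 ^ (h - u))] at h3
      have h4 : (N : ℝ) * (a * j i / N : ℕ) + r = a * j i := by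
        exact_mod_cast Nat.div_add_mod (a * j i) N
      have h5 : (N : ℝ) * (a₀ * j i / N : ℕ) + r₀ = a₀ * j i := by
        exact_mod_cast Nat.div_add_mod (a₀ * j i) N
      have h6 : (((a : ℤ) - a₀ : ℤ) : ℝ) * j i / N -
          ((((a * j i / N : ℕ) : ℤ) - (a₀ * j i / N : ℕ) : ℤ) : ℝ) = (r - r₀) / N := by
        rw [eq_div_iff hN'.ne', sub_mul, div_mul_cancel₀ _ hN'.ne']
        rw [Int.cast_sub, Int.cast_sub, Int.cast_natCast, Int.cast_natCast, Int.cast_natCast,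
          Int.cast_natCast]
        linarith
      rw [h6, abs_mul, abs_div, abs_of_pos hN', abs_of_pos (by positivity : (0 : ℝ) < 2 ^ h),
        ← mul_div_assoc, div_le_iff₀ hN']
      have h7 : (2 : ℝ) ^ h = 2 ^ u * 2 ^ (h - u) := by
        rw [← pow_add, Nat.add_sub_cancel' hu]
      rw [h7]
      push_cast
      nlinarith [show (0 : ℝ) < 2 ^ u by positivity]
  · rw [Finset.card_image_of_injOn hinj]
    exact hy

/-- A cube of size 2^u contains 2^(u(s+1)) lattice vectors, while a hyperplane could hold at most
(2^u · 3(s+1)κ)^s of them. So they span as soon as 2^u > Q, and rounding with respect to them has an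
error of at most (s+1) 2^u, where 2^u ≤ 2 Q. -/
theorem exists_near_of_balanced (hN : 0 < N) (hκ : 0 < κ)
    (hbal : ∀ a : ℤ, a ≠ 0 → κ * |a| < 2 ^ (s * h) → ¬ ∀ i, NearMultiple N (κ * 2 ^ h) a (j i))
    (α : ℝ) (β : Fin s → ℝ) : ∃ (a : ℤ) (b : Fin s → ℤ),
      |(a : ℝ) - α| ≤ coveringBound s κ * 2 ^ (s * h) ∧
      ∀ i, 2 ^ h * |(a : ℝ) * j i / N - b i - β i| ≤ coveringBound s κ := by
  set Q := (3 * ((s + 1) * κ)) ^ s with hQ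
  have hQpos : 0 < Q := by positivity
  set u := Nat.log 2 Q + 1 with hu
  have hu1 : Q < 2 ^ u := Nat.lt_pow_succ_log_self (by norm_num) Q
  have hu2 : 2 ^ u ≤ 2 * Q := by
    rw [hu, pow_succ, mul_comm]
    exact Nat.mul_le_mul_left 2 (Nat.pow_log_le_self 2 hQpos.ne')
  have hμ : (s + 1) * 2 ^ u ≤ coveringBound s κ := Nat.mul_le_mul_left _ hu2
  have hμ' : ((s : ℝ) + 1) * 2 ^ u ≤ coveringBound s κ := by exact_mod_cast hμ
  -- At levels below u the scaling factor 2^h is itself bounded by the covering bound, and rounding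
  -- α and then each coordinate is good enough.
  rcases lt_or_ge h u with hhu | hhu
  · have h1 : (2 : ℝ) ^ h ≤ coveringBound s κ := by
      calc (2 : ℝ) ^ h ≤ 2 ^ u := pow_le_pow_right₀ (by norm_num) hhu.le
        _ ≤ (s + 1) * 2 ^ u := le_mul_of_one_le_left (by positivity) (by simp)
        _ ≤ _ := hμ'
    have h2 : (1 : ℝ) ≤ 2 ^ h := one_le_pow₀ (by norm_num)
    have h3 : (1 : ℝ) ≤ 2 ^ (s * h) := one_le_pow₀ (by norm_num)
    refine ⟨round α, fun i => round ((round α : ℝ) * j i / N - β i), ?_, fun i => ?_⟩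
    · rw [abs_sub_comm]
      refine (abs_sub_round α).trans ?_
      nlinarith
    · have h4 := abs_sub_round ((round α : ℝ) * j i / N - β i)
      rw [show (round α : ℝ) * j i / N - round ((round α : ℝ) * j i / N - β i) - β i =
        (round α : ℝ) * j i / N - β i - round ((round α : ℝ) * j i / N - β i) by ring]
      nlinarith
  · obtain ⟨S, hSL, hSR, hScard⟩ := exists_many_short_vectors (j := j) hN hhu
    have hspan : Submodule.span ℝ (S : Set (Option (Fin s) → ℝ)) = ⊤ := by
      refine span_eq_top_of_card_lt (levelHom N h j).range hκ ?_ S hSL hSR ?_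
      · rintro _ ⟨v, rfl⟩ hv
        exact levelHom_eq_zero hN hκ hbal v hv
      · refine lt_of_lt_of_le ?_ hScard
        rw [Fintype.card_option, Fintype.card_fin, Nat.add_sub_cancel, pow_mul, pow_succ]
        have h1 : 1 ≤ 2 ^ u * ((s + 1) * κ) := Nat.mul_pos (by positivity) (by positivity)
        calc (2 * (2 ^ u * ((s + 1) * κ)) + 1) ^ s
            ≤ (2 ^ u * (3 * ((s + 1) * κ))) ^ s := Nat.pow_le_pow_left (by nlinarith) s
          _ = (2 ^ u) ^ s * Q := mul_pow _ _ _
          _ < (2 ^ u) ^ s * 2 ^ u := Nat.mul_lt_mul_of_pos_left hu1 (by positivity)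
    obtain ⟨_, ⟨v, rfl⟩, hv⟩ := exists_mem_addSubgroup_near (levelHom N h j).range
      ((2 ^ u : ℕ) : ℝ) S hSL hSR hspan
      (fun k => match k with
        | none => α / 2 ^ (s * h)
        | some i => 2 ^ h * β i)
    rw [Fintype.card_option, Fintype.card_fin] at hv
    push_cast at hv
    refine ⟨v.1, v.2, ?_, fun i => ?_⟩
    · have h1 := (hv none).trans hμ'
      simp only [levelHom, AddMonoidHom.coe_mk, ZeroHom.coe_mk] at h1
      rw [← sub_div, abs_div, abs_of_pos (by positivity : (0 : ℝ) < 2 ^ (s * h)),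
        div_le_iff₀ (by positivity)] at h1
      exact h1
    · have h1 := (hv (some i)).trans hμ'
      simp only [levelHom, AddMonoidHom.coe_mk, ZeroHom.coe_mk] at h1
      rw [← mul_sub, abs_mul, abs_of_pos (by positivity : (0 : ℝ) < 2 ^ h)] at h1
      exact h1

end Level

/-! ### Boxes -/

/-- The integers `8 a + q` with `|q| ≤ 1`, `|a| ≤ A` and all `a j + q 2^m k` within `E` of a
multiple of `N`. -/
def InBox {s : ℕ} (m N : ℕ) (f : Fin s → ℕ × ℕ) (A E w : ℤ) : Prop :=
  ∃ a q : ℤ, w = 8 * a + q ∧ |q| ≤ 1 ∧ |a| ≤ A ∧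
    ∀ i, ∃ b : ℤ, |a * (f i).1 + q * (2 ^ m * (f i).2) - b * N| ≤ E

section Box

variable {s m N κ h : ℕ} {f : Fin s → ℕ × ℕ}

/-- Take a lattice translate point with multiplier a₁ near to the half of the given point, with an
error of at most a quarter of the box size. Both a₁ and a - a₁ then fit into the box. The first
summand keeps q, and the second one is a pure lattice point with q = 0. -/
theorem InBox.exists_add {M' : ℕ} {A E w : ℤ} (hN : 0 < N) (hκ : 0 < κ)
    (hbal : ∀ a : ℤ, a ≠ 0 → κ * |a| < 2 ^ (s * h) →
      ¬ ∀ i, NearMultiple N (κ * 2 ^ h) a (f i).1)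
    (hM : coveringBound s κ ≤ M') (hA : 4 * M' * 2 ^ (s * h) ≤ A) (hE : E * 2 ^ h = 4 * M' * N)
    (hw : InBox m N f (A + M' * 2 ^ (s * h)) E w) :
    ∃ u v, InBox m N f A E u ∧ InBox m N f A E v ∧ w = u + v := by
  obtain ⟨a, q, rfl, hq, ha, hb⟩ := hw
  choose b hb using hb
  have hN' : (0 : ℝ) < N := by exact_mod_cast hN
  have hM' : (coveringBound s κ : ℝ) ≤ M' := by exact_mod_cast hM
  set X : Fin s → ℝ := fun i => a * (f i).1 + q * (2 ^ m * (f i).2) - b i * N with hX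
  have hXE : ∀ i, |X i| ≤ E := fun i => by
    have := hb i
    simp only [hX]
    exact_mod_cast this
  -- The target is chosen such that a₁ j + q 2^m k - b₁ N approximates X/2; the inhomogeneous term q
  -- 2^m k is moved to the right-hand side.
  obtain ⟨a₁, b₁, ha₁, hb₁⟩ := exists_near_of_balanced (j := fun i => (f i).1) hN hκ hbal
    ((a : ℝ) / 2) (fun i => X i / (2 * N) - q * (2 ^ m * (f i).2) / N)
  have hE' : (E : ℝ) * 2 ^ h = 4 * M' * N := by exact_mod_cast hE
  have hA' : 4 * (M' : ℝ) * 2 ^ (s * h) ≤ A := by exact_mod_cast hA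
  have haR : |(a : ℝ)| ≤ A + M' * 2 ^ (s * h) := by exact_mod_cast ha
  have h2s : (0 : ℝ) < 2 ^ (s * h) := by positivity
  have h2h : (0 : ℝ) < 2 ^ h := by positivity
  have ha₁' : |(a₁ : ℝ) - a / 2| ≤ M' * 2 ^ (s * h) :=
    ha₁.trans (mul_le_mul_of_nonneg_right hM' h2s.le)
  have hdev : ∀ i, |((a₁ : ℝ) * (f i).1 + q * (2 ^ m * (f i).2) - b₁ i * N) - X i / 2| ≤ E / 4 := by
    intro i
    have h1 := (hb₁ i).trans hM'
    have h2 : ((a₁ : ℝ) * (f i).1 + q * (2 ^ m * (f i).2) - b₁ i * N) - X i / 2 =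
        N * ((a₁ : ℝ) * (f i).1 / N - b₁ i - (X i / (2 * N) - q * (2 ^ m * (f i).2) / N)) := by
      field_simp
      ring
    rw [h2, abs_mul, abs_of_pos hN']
    set Y := |(a₁ : ℝ) * (f i).1 / N - b₁ i - (X i / (2 * N) - q * (2 ^ m * (f i).2) / N)|
    have h3 : (N * Y) * 2 ^ h ≤ (E / 4) * 2 ^ h := by nlinarith
    exact le_of_mul_le_mul_right h3 h2h
  rw [abs_le] at haR ha₁'
  refine ⟨8 * a₁ + q, 8 * (a - a₁) + 0, ⟨a₁, q, rfl, hq, ?_, fun i => ⟨b₁ i, ?_⟩⟩,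
    ⟨a - a₁, 0, rfl, by simp, ?_, fun i => ⟨b i - b₁ i, ?_⟩⟩, by ring⟩
  · have : |(a₁ : ℝ)| ≤ A := by rw [abs_le]; constructor <;> linarith
    exact_mod_cast this
  · have h1 := abs_le.1 (hdev i)
    have h2 := abs_le.1 (hXE i)
    have : |(a₁ : ℝ) * (f i).1 + q * (2 ^ m * (f i).2) - b₁ i * N| ≤ E := by
      rw [abs_le]; constructor <;> linarith
    exact_mod_cast this
  · have : |(a : ℝ) - a₁| ≤ A := by rw [abs_le]; constructor <;> linarith
    exact_mod_cast this
  · have h1 := abs_le.1 (hdev i)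
    have h2 := abs_le.1 (hXE i)
    have h3 : ((a : ℝ) - a₁) * (f i).1 + 0 * (2 ^ m * (f i).2) - (b i - b₁ i) * N =
        X i - ((a₁ : ℝ) * (f i).1 + q * (2 ^ m * (f i).2) - b₁ i * N) := by
      simp only [hX]; ring
    have : |((a : ℝ) - a₁) * (f i).1 + 0 * (2 ^ m * (f i).2) - (b i - b₁ i) * N| ≤ E := by
      rw [h3, abs_le]; constructor <;> linarith
    exact_mod_cast this

/-- A bound for the number of points in a box. -/
def boxBound (s κ M : ℕ) : ℕ := 3 * (2 * (κ * (M * 2 ^ s)) + 1) * (2 * (κ * M) + 1) ^ s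

theorem ediv_mem_Icc {x n : ℤ} {B : ℕ} (hn : 0 < n) (h : |x| ≤ B * n) :
    x / n ∈ Finset.Icc (-(B : ℤ)) B := by
  rw [abs_le] at h
  rw [Finset.mem_Icc]
  constructor
  · rw [Int.le_ediv_iff_mul_le hn]; linarith
  · have h1 := Int.ediv_mul_le x hn.ne'
    by_contra hlt
    push Not at hlt
    nlinarith

/-- Cut the box into cells of size 1/κ in the units of the level, separately for each q. Two points
in one cell with the same q differ by a lattice vector that balance forbids unless its multiplier is
zero. -/
theorem card_le_boxBound {M : ℕ} {A E : ℤ} (hN : 0 < N)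
    (hbal : ∀ a : ℤ, a ≠ 0 → κ * |a| < 2 ^ (s * h) →
      ¬ ∀ i, NearMultiple N (κ * 2 ^ h) a (f i).1)
    (hA : A ≤ M * 2 ^ s * 2 ^ (s * h)) (hE : E * 2 ^ h = M * N) (W : Finset ℤ)
    (hW : ∀ w ∈ W, InBox m N f A E w) : W.card ≤ boxBound s κ M := by
  have hN' : (0 : ℤ) < N := by exact_mod_cast hN
  choose! a q hw hq ha b hb using hW
  let X : ℤ → Fin s → ℤ := fun w i =>
    a w * (f i).1 + q w * (2 ^ m * (f i).2) - b w i * N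
  let cell : ℤ → ℤ × ℤ × (Fin s → ℤ) := fun w =>
    (q w, κ * a w / 2 ^ (s * h), fun i => κ * 2 ^ h * X w i / N)
  let cells : Finset (ℤ × ℤ × (Fin s → ℤ)) :=
    Finset.Icc (-1) 1 ×ˢ Finset.Icc (-((κ * (M * 2 ^ s) : ℕ) : ℤ)) ((κ * (M * 2 ^ s) : ℕ) : ℤ) ×ˢ
      Fintype.piFinset fun _ => Finset.Icc (-((κ * M : ℕ) : ℤ)) ((κ * M : ℕ) : ℤ)
  have hIcc : ∀ B : ℕ, (Finset.Icc (-(B : ℤ)) B).card = 2 * B + 1 := fun B => by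
    rw [Int.card_Icc]; omega
  have hcells : cells.card = boxBound s κ M := by
    rw [Finset.card_product, Finset.card_product, Fintype.card_piFinset_const, hIcc, hIcc,
      boxBound, mul_assoc]
    rfl
  rw [← hcells]
  refine Finset.card_le_card_of_injOn cell ?_ ?_
  · intro w hwW
    rw [Finset.mem_coe, Finset.mem_product, Finset.mem_product, Fintype.mem_piFinset]
    refine ⟨?_, ?_, fun i => ?_⟩
    · rw [Finset.mem_Icc, ← abs_le]; exact hq w hwW
    · refine ediv_mem_Icc (by positivity) ?_
      rw [abs_mul, Nat.abs_cast]
      push_cast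
      have := (ha w hwW).trans hA
      calc (κ : ℤ) * |a w| ≤ κ * (M * 2 ^ s * 2 ^ (s * h)) := by gcongr
        _ = _ := by ring
    · refine ediv_mem_Icc hN' ?_
      rw [abs_mul, abs_mul, Nat.abs_cast, abs_of_pos (by positivity : (0 : ℤ) < 2 ^ h)]
      push_cast
      have := hb w hwW i
      calc (κ : ℤ) * 2 ^ h * |X w i| ≤ κ * 2 ^ h * E := by gcongr
        _ = κ * (E * 2 ^ h) := by ring
        _ = _ := by rw [hE]; ring
  · intro w hwW w' hwW' heq
    simp only [cell, Prod.mk.injEq] at heq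
    obtain ⟨hqq, haa, hXX⟩ := heq
    have h1 := abs_sub_lt_of_ediv_eq (by positivity) haa
    have haeq : a w - a w' = 0 := by
      by_contra hne
      refine hbal _ hne ?_ fun i => ⟨b w i - b w' i, ?_⟩
      · rw [← mul_sub, abs_mul, Nat.abs_cast] at h1
        exact h1
      · have h2 := abs_sub_lt_of_ediv_eq hN' (congrFun hXX i)
        rw [← mul_sub, abs_mul, abs_mul, Nat.abs_cast,
          abs_of_pos (by positivity : (0 : ℤ) < 2 ^ h)] at h2
        have h3 : (a w - a w') * ((f i).1 : ℤ) - (b w i - b w' i) * N = X w i - X w' i := by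
          simp only [X]; rw [hqq]; ring
        rw [h3]
        push_cast
        exact h2
    rw [hw w hwW, hw w' hwW', hqq]
    omega

end Box


/-! ### Running times of programs -/

theorem size_add_le (a b : ℕ) : (a + b).size ≤ max a.size b.size + 1 := by
  rw [Nat.size_le, pow_succ, mul_two]
  exact add_lt_add (lt_of_lt_of_le (Nat.lt_size_self a)
    (Nat.pow_le_pow_right (by norm_num) (le_max_left _ _)))
    (lt_of_lt_of_le (Nat.lt_size_self b) (Nat.pow_le_pow_right (by norm_num) (le_max_right _ _)))

theorem size_mul_le (a b : ℕ) : (a * b).size ≤ a.size + b.size := by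
  rw [Nat.size_le, pow_add]
  exact Nat.mul_lt_mul'' (Nat.lt_size_self a) (Nat.lt_size_self b)

theorem bitCost_mono {a b : ℤ} (h : a.natAbs ≤ b.natAbs) : bitCost a ≤ bitCost b :=
  Nat.succ_le_succ (Nat.size_le_size h)

theorem bitCost_add_le (a b : ℤ) : bitCost (a + b) ≤ bitCost a + bitCost b := by
  have h1 := Nat.size_le_size (Int.natAbs_add_le a b)
  have h2 := size_add_le a.natAbs b.natAbs
  simp only [bitCost]
  omega

theorem bitCost_sub_le (a b : ℤ) : bitCost (a - b) ≤ bitCost a + bitCost b := by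
  have h := bitCost_add_le a (-b)
  rwa [← sub_eq_add_neg, show bitCost (-b) = bitCost b by simp [bitCost]] at h

theorem bitCost_mul_le (a b : ℤ) : bitCost (a * b) ≤ bitCost a + bitCost b := by
  have h := size_mul_le a.natAbs b.natAbs
  simp only [bitCost, Int.natAbs_mul]
  omega

theorem bitCost_ediv_le (a b : ℤ) : bitCost (a / b) ≤ bitCost a + bitCost b :=
  (bitCost_mono (Int.natAbs_ediv_le_natAbs a b)).trans (Nat.le_add_right _ _)

theorem bitCost_emod_le (a b : ℤ) : bitCost (a % b) ≤ bitCost a + bitCost b := by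
  by_cases hb : b = 0
  · subst hb; simp
  · refine (bitCost_mono (b := b) ?_).trans (Nat.le_add_left _ _)
    have h1 := Int.emod_nonneg a hb
    have h2 := Int.emod_lt_abs a hb
    rw [Int.abs_eq_natAbs] at h2
    omega

/-- A measure of the size of an expression. -/
def Expr.weight : Expr → ℕ
  | .const z => bitCost z
  | .reg _ => 1
  | .add e₁ e₂ | .sub e₁ e₂ | .mul e₁ e₂ | .div e₁ e₂ | .mod e₁ e₂ => e₁.weight + e₂.weight

def Test.weight : Test → ℕ
  | .lt e₁ e₂ | .eq e₁ e₂ => e₁.weight + e₂.weight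
  | .groupEq _ _ => 1
  | .not c => c.weight + 1
  | .and c₁ c₂ => c₁.weight + c₂.weight + 1

def Program.weight : Program → ℕ
  | .skip => 1
  | .assign _ e => e.weight + 1
  | .groupMul _ _ _ => 1
  | .groupInv _ _ => 1
  | .seq P₁ P₂ => P₁.weight + P₂.weight
  | .ite c P₁ P₂ => c.weight + 1 + (P₁.weight + P₂.weight)
  | .while c P => c.weight + 1 + P.weight

/-- All integer registers hold integers of at most `W` bits. -/
def Store.Bdd {G : Type*} (W : ℕ) (σ : Store G) : Prop := ∀ i, |σ.int i| < 2 ^ W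

theorem bitCost_le_of_abs_lt {z : ℤ} {W : ℕ} (h : |z| < 2 ^ W) : bitCost z ≤ W + 1 := by
  refine Nat.succ_le_succ (Nat.size_le.2 ?_)
  rw [Int.abs_eq_natAbs] at h
  exact_mod_cast h

theorem Expr.bitCost_eval_le {σ : ℕ → ℤ} {W : ℕ} (h : ∀ i, |σ i| < 2 ^ W) (e : Expr) :
    bitCost (e.eval σ) ≤ e.weight * (W + 1) := by
  induction e with
  | const z => exact Nat.le_mul_of_pos_right _ (Nat.succ_pos W)
  | reg i => rw [Expr.weight, one_mul]; exact bitCost_le_of_abs_lt (h i)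
  | add e₁ e₂ h₁ h₂ =>
    rw [Expr.weight, add_mul]
    exact (bitCost_add_le _ _).trans (add_le_add h₁ h₂)
  | sub e₁ e₂ h₁ h₂ =>
    rw [Expr.weight, add_mul]
    exact (bitCost_sub_le _ _).trans (add_le_add h₁ h₂)
  | mul e₁ e₂ h₁ h₂ =>
    rw [Expr.weight, add_mul]
    exact (bitCost_mul_le _ _).trans (add_le_add h₁ h₂)
  | div e₁ e₂ h₁ h₂ =>
    rw [Expr.weight, add_mul]
    exact (bitCost_ediv_le _ _).trans (add_le_add h₁ h₂)
  | mod e₁ e₂ h₁ h₂ =>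
    rw [Expr.weight, add_mul]
    exact (bitCost_emod_le _ _).trans (add_le_add h₁ h₂)

/-- The product of the bit costs of the operands is absorbed by the mixed term of the square of a
sum; hence costs are bounded by squares of weights. -/
theorem cost_step_le {c₁ c₂ b₁ b₂ w₁ w₂ W : ℕ} (h₁ : c₁ ≤ (w₁ * (W + 1)) ^ 2)
    (h₂ : c₂ ≤ (w₂ * (W + 1)) ^ 2) (h₃ : b₁ ≤ w₁ * (W + 1)) (h₄ : b₂ ≤ w₂ * (W + 1)) :
    c₁ + c₂ + b₁ * b₂ ≤ ((w₁ + w₂) * (W + 1)) ^ 2 := by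
  have h₅ := Nat.mul_le_mul h₃ h₄
  rw [add_mul]
  nlinarith

theorem cost_succ_le {c w v W : ℕ} (h : c ≤ (w * (W + 1)) ^ 2) (hv : w + 1 ≤ v) :
    c + 1 ≤ (v * (W + 1)) ^ 2 := by
  have h1 : w * (W + 1) + 1 ≤ v * (W + 1) := by
    have := Nat.mul_le_mul_right (W + 1) hv
    rw [add_mul, one_mul] at this
    omega
  have h2 := Nat.pow_le_pow_left h1 2
  have h3 : (w * (W + 1) + 1) ^ 2 = (w * (W + 1)) ^ 2 + 2 * (w * (W + 1)) + 1 := by ring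
  omega

theorem Expr.cost_le {σ : ℕ → ℤ} {W : ℕ} (h : ∀ i, |σ i| < 2 ^ W) (e : Expr) :
    e.cost σ ≤ (e.weight * (W + 1)) ^ 2 := by
  induction e with
  | const z => exact (Expr.bitCost_eval_le h (.const z)).trans (Nat.le_self_pow (by norm_num) _)
  | reg i => exact (Expr.bitCost_eval_le h (.reg i)).trans (Nat.le_self_pow (by norm_num) _)
  | add e₁ e₂ h₁ h₂ => exact cost_step_le h₁ h₂ (e₁.bitCost_eval_le h) (e₂.bitCost_eval_le h)
  | sub e₁ e₂ h₁ h₂ => exact cost_step_le h₁ h₂ (e₁.bitCost_eval_le h) (e₂.bitCost_eval_le h)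
  | mul e₁ e₂ h₁ h₂ => exact cost_step_le h₁ h₂ (e₁.bitCost_eval_le h) (e₂.bitCost_eval_le h)
  | div e₁ e₂ h₁ h₂ => exact cost_step_le h₁ h₂ (e₁.bitCost_eval_le h) (e₂.bitCost_eval_le h)
  | mod e₁ e₂ h₁ h₂ => exact cost_step_le h₁ h₂ (e₁.bitCost_eval_le h) (e₂.bitCost_eval_le h)

theorem Test.cost_le {G : Type*} {σ : Store G} {W : ℕ} (h : σ.Bdd W) (c : Test) :
    c.cost σ ≤ (c.weight * (W + 1)) ^ 2 := by
  induction c with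
  | lt e₁ e₂ =>
    exact cost_step_le (e₁.cost_le h) (e₂.cost_le h) (e₁.bitCost_eval_le h) (e₂.bitCost_eval_le h)
  | eq e₁ e₂ =>
    exact cost_step_le (e₁.cost_le h) (e₂.cost_le h) (e₁.bitCost_eval_le h) (e₂.bitCost_eval_le h)
  | groupEq i i' => exact cost_succ_le (w := 0) (Nat.zero_le _) le_rfl
  | not c ih => exact cost_succ_le ih le_rfl
  | and c₁ c₂ h₁ h₂ =>
    refine cost_succ_le (w := c₁.weight + c₂.weight) ?_ le_rfl
    exact (Nat.le_add_right _ (0 * 0)).trans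
      (cost_step_le h₁ h₂ (Nat.zero_le _) (Nat.zero_le _))

/-- The store in which integer register `i` has been overwritten. -/
def Store.set {G : Type*} (σ : Store G) (i : ℕ) (z : ℤ) : Store G :=
  { σ with int := Function.update σ.int i z }

/-- The store in which group register `i` has been overwritten. -/
def Store.setGrp {G : Type*} (σ : Store G) (i : ℕ) (y : G) : Store G :=
  { σ with grp := Function.update σ.grp i y }

section Store

variable {G : Type*}

@[simp] theorem Store.set_int (σ : Store G) (i : ℕ) (z : ℤ) (k : ℕ) :
    (σ.set i z).int k = if k = i then z else σ.int k := Function.update_apply _ _ _ _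

@[simp] theorem Store.set_grp (σ : Store G) (i : ℕ) (z : ℤ) : (σ.set i z).grp = σ.grp := rfl

@[simp] theorem Store.setGrp_grp (σ : Store G) (i : ℕ) (y : G) (k : ℕ) :
    (σ.setGrp i y).grp k = if k = i then y else σ.grp k := Function.update_apply _ _ _ _

@[simp] theorem Store.setGrp_int (σ : Store G) (i : ℕ) (y : G) : (σ.setGrp i y).int = σ.int := rfl

theorem Store.Bdd.set {W : ℕ} {σ : Store G} (h : σ.Bdd W) {i : ℕ} {z : ℤ} (hz : |z| < 2 ^ W) :
    (σ.set i z).Bdd W := by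
  intro k
  rw [Store.set_int]
  split_ifs
  exacts [hz, h k]

/-- The stores `σ` and `σ'` agree except possibly in the integer registers of `S`. -/
def Store.Agree (S : List ℕ) (σ σ' : Store G) : Prop :=
  (∀ i, i ∉ S → σ'.int i = σ.int i) ∧ σ'.grp = σ.grp

theorem Store.Agree.refl (S : List ℕ) (σ : Store G) : σ.Agree S σ := ⟨fun _ _ => rfl, rfl⟩

theorem Store.Agree.set {S : List ℕ} {σ σ' : Store G} (h : σ.Agree S σ') {i : ℕ} (hi : i ∈ S)
    (z : ℤ) : σ.Agree S (σ'.set i z) := by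
  refine ⟨fun k hk => ?_, h.2⟩
  rw [Store.set_int, if_neg (by rintro rfl; exact hk hi)]
  exact h.1 k hk

theorem Store.Agree.trans {S S' : List ℕ} {σ σ' σ'' : Store G} (h : σ.Agree S σ')
    (h' : σ'.Agree S' σ'') (hS : S' ⊆ S) : σ.Agree S σ'' :=
  ⟨fun i hi => (h'.1 i fun hi' => hi (hS hi')).trans (h.1 i hi), h'.2.trans h.2⟩

end Store

/-! ### Rules for counting the steps of programs -/

section Runs

variable {G : Type*} [Group G] {W : ℕ}

/-- Started in `σ`, the program halts in a store satisfying `Q`, after a time that is at most `n`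
times the time for an elementary step of the program on integers of `W` bits. -/
def Program.Runs (W : ℕ) (P : Program) (σ : Store G) (n : ℕ) (Q : Store G → Prop) : Prop :=
  ∃ (σ' : Store G) (T : ℕ), Exec P σ σ' T ∧ T ≤ n * (P.weight * (W + 1)) ^ 2 ∧ Q σ'

theorem Program.Runs.mono {P : Program} {σ : Store G} {n n' : ℕ} {Q Q' : Store G → Prop}
    (h : P.Runs W σ n Q) (hn : n ≤ n') (hQ : ∀ σ', Q σ' → Q' σ') : P.Runs W σ n' Q' := by
  obtain ⟨σ', T, hex, hT, hq⟩ := h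
  exact ⟨σ', T, hex, hT.trans (Nat.mul_le_mul_right _ hn), hQ σ' hq⟩

theorem Program.Runs.skip {σ : Store G} {Q : Store G → Prop} (h : Q σ) :
    Program.skip.Runs W σ 1 Q :=
  ⟨σ, 1, .skip σ, by rw [one_mul]; exact cost_succ_le (w := 0) (Nat.zero_le _) le_rfl, h⟩

theorem Program.Runs.assign {σ : Store G} {i : ℕ} {e : Expr} {Q : Store G → Prop}
    (hσ : σ.Bdd W) (h : Q (σ.set i (e.eval σ.int))) : (Program.assign i e).Runs W σ 1 Q := by
  refine ⟨_, _, .assign i e σ, ?_, h⟩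
  rw [one_mul]
  exact cost_succ_le (e.cost_le hσ) le_rfl

theorem Program.Runs.assign_eq {σ : Store G} {i : ℕ} {e : Expr} {z : ℤ} {Q : Store G → Prop}
    (hσ : σ.Bdd W) (he : e.eval σ.int = z) (h : Q (σ.set i z)) :
    (Program.assign i e).Runs W σ 1 Q := .assign hσ (he ▸ h)

theorem Program.Runs.groupMul {σ : Store G} {i a b : ℕ} {Q : Store G → Prop}
    (h : Q (σ.setGrp i (σ.grp a * σ.grp b))) : (Program.groupMul i a b).Runs W σ 1 Q :=
  ⟨_, _, .groupMul i a b σ,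
    by rw [one_mul]; exact cost_succ_le (w := 0) (Nat.zero_le _) le_rfl, h⟩

/-- The unit of time grows with the weight of the program, so both parts may be measured in the unit
of the whole, and the step counts add up. -/
theorem Program.Runs.seq {P₁ P₂ : Program} {σ : Store G} {n₁ n₂ : ℕ} {Q : Store G → Prop}
    (h : P₁.Runs W σ n₁ fun σ' => P₂.Runs W σ' n₂ Q) :
    (Program.seq P₁ P₂).Runs W σ (n₁ + n₂) Q := by
  obtain ⟨σ', T, hex, hT, σ'', T', hex', hT', hQ⟩ := h
  refine ⟨σ'', T + T', .seq hex hex', ?_, hQ⟩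
  rw [add_mul]
  refine add_le_add (hT.trans ?_) (hT'.trans ?_) <;> simp only [Program.weight] <;> gcongr <;> omega

theorem Program.Runs.assign_seq {P : Program} {σ : Store G} {i : ℕ} {e : Expr} {z : ℤ} {n : ℕ}
    {Q : Store G → Prop} (hσ : σ.Bdd W) (he : e.eval σ.int = z) (hz : |z| < 2 ^ W)
    (h : (σ.set i z).Bdd W → P.Runs W (σ.set i z) n Q) :
    (Program.seq (.assign i e) P).Runs W σ (1 + n) Q :=
  .seq (.assign_eq hσ he (h (hσ.set hz)))

theorem Program.Runs.ite {c : Test} {P₁ P₂ : Program} {σ : Store G} {n : ℕ} {Q : Store G → Prop}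
    (hσ : σ.Bdd W) (h₁ : c.Holds σ → P₁.Runs W σ n Q) (h₂ : ¬ c.Holds σ → P₂.Runs W σ n Q) :
    (Program.ite c P₁ P₂).Runs W σ (n + 1) Q := by
  have hc := c.cost_le hσ
  have hsq : ∀ {T w : ℕ}, T ≤ n * (w * (W + 1)) ^ 2 → w ≤ P₁.weight + P₂.weight →
      c.cost σ + T + 1 ≤ (n + 1) * ((c.weight + 1 + (P₁.weight + P₂.weight)) * (W + 1)) ^ 2 := by
    intro T w hT hw
    have h3 : n * (w * (W + 1)) ^ 2 ≤
        n * ((c.weight + 1 + (P₁.weight + P₂.weight)) * (W + 1)) ^ 2 := by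
      gcongr
      omega
    have h4 : c.cost σ + 1 ≤ ((c.weight + 1 + (P₁.weight + P₂.weight)) * (W + 1)) ^ 2 :=
      cost_succ_le hc (by omega)
    rw [add_mul, one_mul]
    omega
  by_cases hc' : c.Holds σ
  · obtain ⟨σ', T, hex, hT, hQ⟩ := h₁ hc'
    exact ⟨σ', _, .ite_true hc' hex, hsq hT (Nat.le_add_right _ _), hQ⟩
  · obtain ⟨σ', T, hex, hT, hQ⟩ := h₂ hc'
    exact ⟨σ', _, .ite_false hc' hex, hsq hT (Nat.le_add_left _ _), hQ⟩

theorem Program.Runs.while_false {c : Test} {P : Program} {σ : Store G} {Q : Store G → Prop}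
    (hσ : σ.Bdd W) (hc : ¬ c.Holds σ) (hQ : Q σ) : (Program.while c P).Runs W σ 1 Q := by
  refine ⟨σ, _, .while_false hc, ?_, hQ⟩
  rw [one_mul]
  exact cost_succ_le (c.cost_le hσ) (Nat.le_add_right _ _)

theorem Program.Runs.while_true {c : Test} {P : Program} {σ : Store G} {n n' : ℕ}
    {Q : Store G → Prop} (hσ : σ.Bdd W) (hc : c.Holds σ)
    (h : P.Runs W σ n fun σ' => (Program.while c P).Runs W σ' n' Q) :
    (Program.while c P).Runs W σ (n + 1 + n') Q := by
  obtain ⟨σ', T, hex, hT, σ'', T', hex', hT', hQ⟩ := h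
  refine ⟨σ'', _, .while_true hc hex hex', ?_, hQ⟩
  have h3 : c.cost σ + 1 ≤ ((c.weight + 1 + P.weight) * (W + 1)) ^ 2 :=
    cost_succ_le (c.cost_le hσ) (Nat.le_add_right _ _)
  have h4 : T ≤ n * ((c.weight + 1 + P.weight) * (W + 1)) ^ 2 := hT.trans (by gcongr; omega)
  simp only [Program.weight] at hT' ⊢
  rw [add_mul, add_mul, one_mul]
  omega

/-- A loop whose remaining iterations are counted by `k`. -/
theorem Program.Runs.while_nat {c : Test} {P : Program} {n : ℕ} (I : ℕ → Store G → Prop)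
    (hB : ∀ k σ, I k σ → σ.Bdd W) (h0 : ∀ σ, I 0 σ → ¬ c.Holds σ)
    (hs : ∀ k σ, I (k + 1) σ → c.Holds σ ∧ P.Runs W σ n (I k)) (k : ℕ) (σ : Store G)
    (h : I k σ) : (Program.while c P).Runs W σ (k * (n + 1) + 1) (I 0) := by
  induction k generalizing σ with
  | zero => rw [zero_mul, zero_add]; exact .while_false (hB 0 σ h) (h0 σ h) h
  | succ k ih =>
    obtain ⟨hc, hr⟩ := hs k σ h
    have h1 := Program.Runs.while_true (hB _ σ h) hc (hr.mono le_rfl fun σ' hσ' => ih σ' hσ')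
    exact h1.mono (by rw [add_mul]; omega) fun _ h => h

/-- A loop that consumes a list. -/
theorem Program.Runs.while_list {α : Type*} {c : Test} {P : Program} {n : ℕ}
    (I : List α → Store G → Prop)
    (hB : ∀ l σ, I l σ → σ.Bdd W) (h0 : ∀ σ, I [] σ → ¬ c.Holds σ)
    (hs : ∀ w l σ, I (w :: l) σ → c.Holds σ ∧ P.Runs W σ n (I l)) (l : List α) (σ : Store G)
    (h : I l σ) : (Program.while c P).Runs W σ (l.length * (n + 1) + 1) (I []) := by
  induction l generalizing σ with
  | nil => rw [List.length_nil, zero_mul, zero_add]; exact .while_false (hB [] σ h) (h0 σ h) h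
  | cons w l ih =>
    obtain ⟨hc, hr⟩ := hs w l σ h
    have h1 := Program.Runs.while_true (hB _ σ h) hc (hr.mono le_rfl fun σ' hσ' => ih σ' hσ')
    exact h1.mono (by rw [List.length_cons, add_mul]; omega) fun _ h => h

end Runs


/-! ### Lists in registers -/

/-- A list of integers of absolute value less than `O`, encoded as an integer. -/
def encode (O : ℤ) : List ℤ → ℤ
  | [] => 0
  | w :: l => (w + O) + 2 * O * encode O l

/-- All entries are small enough for the encoding. -/
def Fits (O : ℤ) (l : List ℤ) : Prop := ∀ w ∈ l, |w| < O

theorem Fits.cons {O w : ℤ} {l : List ℤ} (hw : |w| < O) (h : Fits O l) : Fits O (w :: l) :=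
  List.forall_mem_cons.2 ⟨hw, h⟩

theorem Fits.head {O w : ℤ} {l : List ℤ} (h : Fits O (w :: l)) : |w| < O :=
  (List.forall_mem_cons.1 h).1

theorem Fits.tail {O w : ℤ} {l : List ℤ} (h : Fits O (w :: l)) : Fits O l :=
  (List.forall_mem_cons.1 h).2

theorem encode_nonneg {O : ℤ} {l : List ℤ} (h : Fits O l) : 0 ≤ encode O l := by
  induction l with
  | nil => exact le_rfl
  | cons w l ih =>
    have h1 := ih h.tail
    have h2 := abs_lt.1 h.head
    have h3 : 0 ≤ O * encode O l := mul_nonneg (by linarith) h1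
    rw [encode]
    linarith

/-- The digit w + O is never zero, so a list is nonempty exactly if its code is positive. All loops
over lists use this as their test. -/
theorem encode_cons_pos {O w : ℤ} {l : List ℤ} (h : Fits O (w :: l)) : 0 < encode O (w :: l) := by
  have h1 := encode_nonneg h.tail
  have h2 := abs_lt.1 h.head
  have h3 : 0 ≤ O * encode O l := mul_nonneg (by linarith) h1
  rw [encode]
  linarith

theorem encode_cons_emod {O w : ℤ} {l : List ℤ} (h : Fits O (w :: l)) :
    encode O (w :: l) % (2 * O) = w + O := by
  have h2 := abs_lt.1 h.head
  rw [encode, Int.add_mul_emod_self_left, Int.emod_eq_of_lt] <;> linarith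

theorem encode_cons_ediv {O w : ℤ} {l : List ℤ} (h : Fits O (w :: l)) :
    encode O (w :: l) / (2 * O) = encode O l := by
  have h2 := abs_lt.1 h.head
  rw [encode, Int.add_mul_ediv_left _ _ (by linarith), Int.ediv_eq_zero_of_lt, zero_add] <;>
    linarith

theorem encode_tail_le {O w : ℤ} {l : List ℤ} (h : Fits O (w :: l)) :
    encode O l ≤ encode O (w :: l) := by
  have h1 := encode_nonneg h.tail
  have h2 := abs_lt.1 h.head
  rw [encode]
  nlinarith

theorem encode_lt {O : ℤ} {l : List ℤ} (h : Fits O l) : encode O l < (2 * O) ^ l.length := by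
  induction l with
  | nil => simp [encode]
  | cons w l ih =>
    have h1 := ih h.tail
    have h2 := abs_lt.1 h.head
    rw [encode, List.length_cons, pow_succ]
    nlinarith

open Classical in
/-- Insert `w` in front of a list, if `w` satisfies `p` and is new and the list is not too long. -/
noncomputable def tryPush (p : ℤ → Prop) (n : ℕ) (l : List ℤ) (w : ℤ) : List ℤ :=
  if p w ∧ w ∉ l ∧ l.length < n then w :: l else l

/-- A list of distinct integers satisfying `p`, of length at most `n`. -/
structure ListOf (p : ℤ → Prop) (n : ℕ) (l : List ℤ) : Prop where
  holds : ∀ w ∈ l, p w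
  nodup : l.Nodup
  length_le : l.length ≤ n

theorem ListOf.nil (p : ℤ → Prop) (n : ℕ) : ListOf p n [] := ⟨by simp, by simp, by simp⟩

theorem ListOf.tryPush {p : ℤ → Prop} {n : ℕ} {l : List ℤ} (h : ListOf p n l) (w : ℤ) :
    ListOf p n (tryPush p n l w) := by
  rw [ShortDLog.tryPush]
  split_ifs with hw
  · exact ⟨List.forall_mem_cons.2 ⟨hw.1, h.holds⟩, List.nodup_cons.2 ⟨hw.2.1, h.nodup⟩, hw.2.2⟩
  · exact h

theorem mem_tryPush_of_mem {p : ℤ → Prop} {n : ℕ} {l : List ℤ} {w v : ℤ} (hv : v ∈ l) :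
    v ∈ tryPush p n l w := by
  rw [tryPush]
  split_ifs
  exacts [List.mem_cons_of_mem _ hv, hv]

/-- If no set of integers satisfying `p` has more than `n` elements, the cut-off at length `n` never
loses a candidate: a full list together with a new entry would be too large a set. -/
theorem ListOf.mem_tryPush {p : ℤ → Prop} {n : ℕ} {l : List ℤ} (h : ListOf p n l)
    (hn : ∀ S : Finset ℤ, (∀ w ∈ S, p w) → S.card ≤ n) {w : ℤ} (hw : p w) :
    w ∈ ShortDLog.tryPush p n l w := by
  classical
  rw [ShortDLog.tryPush]
  split_ifs with hc
  · exact List.mem_cons_self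
  · by_contra hnot
    apply hc
    refine ⟨hw, hnot, ?_⟩
    have h1 := hn (w :: l).toFinset (by
      intro v hv
      rw [List.mem_toFinset, List.mem_cons] at hv
      rcases hv with rfl | hv
      exacts [hw, h.holds v hv])
    rw [List.toFinset_card_of_nodup (List.nodup_cons.2 ⟨hnot, h.nodup⟩), List.length_cons] at h1
    exact h1

/-- Insert a list of candidates one after another. -/
noncomputable def pushAll (p : ℤ → Prop) (n : ℕ) (c l : List ℤ) : List ℤ := c.foldl (tryPush p n) l

theorem ListOf.pushAll {p : ℤ → Prop} {n : ℕ} (c : List ℤ) {l : List ℤ} (h : ListOf p n l) :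
    ListOf p n (pushAll p n c l) := by
  induction c generalizing l with
  | nil => exact h
  | cons w c ih => exact ih (h.tryPush w)

theorem mem_pushAll_of_mem {p : ℤ → Prop} {n : ℕ} (c : List ℤ) {l : List ℤ} {v : ℤ} (hv : v ∈ l) :
    v ∈ pushAll p n c l := by
  induction c generalizing l with
  | nil => exact hv
  | cons w c ih => exact ih (mem_tryPush_of_mem hv)

theorem ListOf.mem_pushAll {p : ℤ → Prop} {n : ℕ} {c l : List ℤ} (h : ListOf p n l)
    (hn : ∀ S : Finset ℤ, (∀ w ∈ S, p w) → S.card ≤ n) {w : ℤ} (hw : p w) (hc : w ∈ c) :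
    w ∈ ShortDLog.pushAll p n c l := by
  induction c generalizing l with
  | nil => simp at hc
  | cons v c ih =>
    rcases List.mem_cons.1 hc with rfl | hc
    · exact mem_pushAll_of_mem c (h.mem_tryPush hn hw)
    · exact ih (h.tryPush v) hc

/-! ### Registers -/

/-- The work registers, behind those that hold the input. -/
def workReg (s k : ℕ) : ℕ := 2 * s + 2 + k

@[simp] theorem workReg_inj (s k k' : ℕ) : workReg s k = workReg s k' ↔ k = k' := by
  simp [workReg]

theorem lt_workReg {s i : ℕ} (h : i < 2 * s + 2) (k : ℕ) : i ≠ workReg s k := by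
  rw [workReg]; omega

/-- `2 ^ (ℓ + m)` -/
abbrev rN (s : ℕ) := workReg s 0
/-- `2 ^ m` -/
abbrev rPow (s : ℕ) := workReg s 1
/-- the offset of the encoding of lists -/
abbrev rOff (s : ℕ) := workReg s 2
/-- the maximal length of lists -/
abbrev rMax (s : ℕ) := workReg s 3
/-- the box bound `A` -/
abbrev rA (s : ℕ) := workReg s 4
/-- the box bound `E` -/
abbrev rE (s : ℕ) := workReg s 5
/-- the increment of `A` -/
abbrev rInc (s : ℕ) := workReg s 6
/-- the current list -/
abbrev rList (s : ℕ) := workReg s 7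
/-- the list under construction -/
abbrev rNew (s : ℕ) := workReg s 8
/-- the length of the list under construction -/
abbrev rLen (s : ℕ) := workReg s 9
/-- the candidate to be inserted -/
abbrev rCand (s : ℕ) := workReg s 10
/-- whether the candidate was found in the list -/
abbrev rFound (s : ℕ) := workReg s 11
/-- the rest of the list to be searched -/
abbrev rScan (s : ℕ) := workReg s 12
/-- the rest of the list in an outer loop -/
abbrev rRest (s : ℕ) := workReg s 13
/-- the current entry in an outer loop -/
abbrev rEntry (s : ℕ) := workReg s 14
/-- the rest of the list in an inner loop -/
abbrev rRest' (s : ℕ) := workReg s 15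
/-- the current entry in an inner loop -/
abbrev rEntry' (s : ℕ) := workReg s 16
/-- the levels that are left -/
abbrev rLevels (s : ℕ) := workReg s 17
/-- a counter -/
abbrev rCount (s : ℕ) := workReg s 18
/-- the result -/
abbrev rOut (s : ℕ) := workReg s 19

/-- The base of the encoding of lists. -/
def baseExpr (s : ℕ) : Expr := .mul (.const 2) (.reg (rOff s))

/-- The candidate is `8 a + q`; this is `a`. -/
def quotExpr (s : ℕ) : Expr := .div (.add (.reg (rCand s)) (.const 1)) (.const 8)

/-- The candidate is `8 a + q`; this is `q + 1`. -/
def remExpr (s : ℕ) : Expr := .mod (.add (.reg (rCand s)) (.const 1)) (.const 8)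

/-- The test of the first `n` residues of the candidate. -/
def residueTest (s : ℕ) : ℕ → Test
  | 0 => .eq (.const 0) (.const 0)
  | n + 1 => .and (residueTest s n)
      (.lt (.mod (.add (.add (.mul (quotExpr s) (.reg (2 * n + 2)))
          (.mul (.sub (remExpr s) (.const 1)) (.mul (.reg (rPow s)) (.reg (2 * n + 3)))))
            (.reg (rE s))) (.reg (rN s)))
        (.add (.mul (.const 2) (.reg (rE s))) (.const 1)))

/-- The test whether the candidate is in the box. -/
def boxTest (s : ℕ) : Test :=
  .and (.lt (remExpr s) (.const 3))
    (.and (.lt (.sub (.const (-1)) (.reg (rA s))) (quotExpr s))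
      (.and (.lt (quotExpr s) (.add (.reg (rA s)) (.const 1))) (residueTest s s)))

/-- The contents of the registers that do not change during the computation. -/
structure Ctx {G : Type*} {s : ℕ} (ℓ m N n : ℕ) (O : ℤ) (f : Fin s → ℕ × ℕ) (σ : Store G) :
    Prop where
  levels : σ.int 0 = ℓ
  length : σ.int 1 = m
  fst : ∀ i : Fin s, σ.int (2 * i.val + 2) = (f i).1
  snd : ∀ i : Fin s, σ.int (2 * i.val + 3) = (f i).2
  modulus : σ.int (rN s) = N
  pow : σ.int (rPow s) = 2 ^ m
  off : σ.int (rOff s) = O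
  max : σ.int (rMax s) = n

section Ctx

variable {G : Type*} {s ℓ m N n : ℕ} {O : ℤ} {f : Fin s → ℕ × ℕ} {σ σ' : Store G}

theorem Ctx.of_agree (h : Ctx ℓ m N n O f σ) {S : List ℕ} (hS : ∀ r ∈ S, 2 * s + 6 ≤ r)
    (ha : σ.Agree S σ') : Ctx ℓ m N n O f σ' := by
  have key : ∀ i, i < 2 * s + 6 → σ'.int i = σ.int i := fun i hi =>
    ha.1 i fun hmem => absurd (hS i hmem) (by omega)
  refine ⟨?_, ?_, fun i => ?_, fun i => ?_, ?_, ?_, ?_, ?_⟩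
  · rw [key _ (by omega), h.levels]
  · rw [key _ (by omega), h.length]
  · rw [key _ (by omega), h.fst]
  · rw [key _ (by omega), h.snd]
  · rw [key _ (by simp [workReg]), h.modulus]
  · rw [key _ (by simp [workReg]), h.pow]
  · rw [key _ (by simp [workReg]), h.off]
  · rw [key _ (by simp [workReg]), h.max]

/-- Shifting by `E` turns the two-sided condition into a condition on one remainder. This remains
correct when 2 E + 1 exceeds `N`, where both sides are always true. -/
theorem emod_add_le_iff {X E N : ℤ} (hN : 0 < N) :
    (X + E) % N < 2 * E + 1 ↔ ∃ b : ℤ, |X - b * N| ≤ E := by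
  have h1 := Int.mul_ediv_add_emod (X + E) N
  have h2 := Int.emod_nonneg (X + E) hN.ne'
  constructor
  · intro h
    refine ⟨(X + E) / N, ?_⟩
    rw [abs_le]
    constructor <;> linarith
  · rintro ⟨b, hb⟩
    rw [abs_le] at hb
    have h3 : b ≤ (X + E) / N := by
      rw [Int.le_ediv_iff_mul_le hN]
      linarith
    have h4 : b * N ≤ (X + E) / N * N := mul_le_mul_of_nonneg_right h3 hN.le
    linarith

theorem residueTest_holds (hN : 0 < N) (h : Ctx ℓ m N n O f σ) {E a q : ℤ}
    (hE : σ.int (rE s) = E) (ha : (quotExpr s).eval σ.int = a)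
    (hq : (remExpr s).eval σ.int = q + 1) (k : ℕ) (hk : k ≤ s) :
    (residueTest s k).Holds σ ↔ ∀ i : Fin s, i.val < k →
      ∃ b : ℤ, |a * (f i).1 + q * (2 ^ m * (f i).2) - b * N| ≤ E := by
  induction k with
  | zero => simp [residueTest, Test.Holds]
  | succ k ih =>
    have h1 := h.fst ⟨k, hk⟩
    have h2 := h.snd ⟨k, hk⟩
    dsimp only at h1 h2
    have h3 : ∀ X : ℤ, (X + E) % N < 2 * E + 1 ↔ ∃ b : ℤ, |X - b * N| ≤ E := fun X =>
      emod_add_le_iff (by exact_mod_cast hN)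
    rw [residueTest, Test.Holds, ih (by omega)]
    simp only [Test.Holds, Expr.eval, ha, hq, h1, h2, hE, h.pow, h.modulus]
    rw [add_sub_cancel_right, h3]
    constructor
    · rintro ⟨h4, h5⟩ i hi
      rcases Nat.lt_succ_iff_lt_or_eq.1 hi with hi | hi
      · exact h4 i hi
      · have : i = ⟨k, hk⟩ := Fin.ext hi
        rw [this]; exact h5
    · intro h4
      exact ⟨fun i hi => h4 i (by omega), h4 ⟨k, hk⟩ (Nat.lt_succ_self k)⟩

/-- As |q| ≤ 1, division of w + 1 = 8 a + (q + 1) by 8 recovers a and q, and q is admissible exactly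
if the remainder is below 3. -/
theorem boxTest_holds (hN : 0 < N) (h : Ctx ℓ m N n O f σ) {A E w : ℤ}
    (hA : σ.int (rA s) = A) (hE : σ.int (rE s) = E) (hw : σ.int (rCand s) = w) :
    (boxTest s).Holds σ ↔ InBox m N f A E w := by
  have ha : (quotExpr s).eval σ.int = (w + 1) / 8 := by simp [quotExpr, Expr.eval, hw]
  have hq : (remExpr s).eval σ.int = ((w + 1) % 8 - 1) + 1 := by
    simp [remExpr, Expr.eval, hw]
  rw [boxTest]
  simp only [Test.Holds]
  rw [residueTest_holds hN h hE ha hq s le_rfl]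
  simp only [Expr.eval, ha, hq, hA]
  constructor
  · rintro ⟨h1, h2, h3, h4⟩
    refine ⟨(w + 1) / 8, (w + 1) % 8 - 1, by omega, ?_, ?_, fun i => h4 i i.2⟩
    · rw [abs_le]; constructor <;> omega
    · rw [abs_le]; constructor <;> omega
  · rintro ⟨a, q, rfl, h1, h2, h3⟩
    rw [abs_le] at h1 h2
    have h4 : (8 * a + q + 1) / 8 = a := by omega
    have h5 : (8 * a + q + 1) % 8 - 1 = q := by omega
    rw [h4, h5]
    exact ⟨by omega, by omega, by omega, fun i _ => h3 i⟩

end Ctx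

theorem InBox.abs_lt {s m N : ℕ} {f : Fin s → ℕ × ℕ} {A E w O : ℤ} (h : InBox m N f A E w)
    (hO : 8 * A + 1 < O) : |w| < O := by
  obtain ⟨a, q, rfl, hq, ha, -⟩ := h
  rw [abs_le] at hq ha
  rw [_root_.abs_lt]
  constructor <;> linarith


/-! ### Inserting candidates -/

/-- Search the candidate in the list under construction. -/
def scanProg (s : ℕ) : Program :=
  .seq (.assign (rFound s) (.const 0)) <|
  .seq (.assign (rScan s) (.reg (rNew s))) <|
  .while (.lt (.const 0) (.reg (rScan s))) <|
    .seq (.ite (.eq (.mod (.reg (rScan s)) (baseExpr s)) (.add (.reg (rCand s)) (.reg (rOff s))))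
      (.assign (rFound s) (.const 1)) .skip) <|
    .assign (rScan s) (.div (.reg (rScan s)) (baseExpr s))

/-- Insert the candidate, if it is in the box and new and the list is not too long. -/
def insertProg (s : ℕ) : Program :=
  .seq (scanProg s) <|
  .ite (.and (boxTest s) (.and (.eq (.reg (rFound s)) (.const 0))
      (.lt (.reg (rLen s)) (.reg (rMax s)))))
    (.seq (.assign (rNew s) (.add (.add (.reg (rCand s)) (.reg (rOff s)))
        (.mul (baseExpr s) (.reg (rNew s)))))
      (.assign (rLen s) (.add (.reg (rLen s)) (.const 1))))
    .skip

/-- Replace the list by the list of all sums of two entries that are in the box. -/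
def sumProg (s : ℕ) : Program :=
  .seq (.assign (rNew s) (.const 0)) <|
  .seq (.assign (rLen s) (.const 0)) <|
  .seq (.assign (rRest s) (.reg (rList s))) <|
  .seq (.while (.lt (.const 0) (.reg (rRest s))) <|
    .seq (.assign (rEntry s) (.sub (.mod (.reg (rRest s)) (baseExpr s)) (.reg (rOff s)))) <|
    .seq (.assign (rRest s) (.div (.reg (rRest s)) (baseExpr s))) <|
    .seq (.assign (rRest' s) (.reg (rList s))) <|
    .while (.lt (.const 0) (.reg (rRest' s))) <|
      .seq (.assign (rEntry' s) (.sub (.mod (.reg (rRest' s)) (baseExpr s)) (.reg (rOff s)))) <|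
      .seq (.assign (rRest' s) (.div (.reg (rRest' s)) (baseExpr s))) <|
      .seq (.assign (rCand s) (.add (.reg (rEntry s)) (.reg (rEntry' s)))) <|
      insertProg s) <|
  .assign (rList s) (.reg (rNew s))

/-- The registers that `insertProg` modifies. -/
def insertRegs (s : ℕ) : List ℕ := [rFound s, rScan s, rNew s, rLen s]

/-- The registers that `sumProg` modifies. -/
def sumRegs (s : ℕ) : List ℕ :=
  [rFound s, rScan s, rNew s, rLen s, rRest s, rEntry s, rRest' s, rEntry' s, rCand s, rList s]

section Insert

variable {G : Type*} [Group G] {W s ℓ m N n : ℕ} {O : ℤ} {f : Fin s → ℕ × ℕ}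

theorem scanProg_runs {σ : Store G} (hσ : σ.Bdd W) (hW : 0 < W) (h : Ctx ℓ m N n O f σ)
    {l : List ℤ} (hl : Fits O l) (hnew : σ.int (rNew s) = encode O l) :
    (scanProg s).Runs W σ (4 * l.length + 3) fun σ' =>
      σ'.Bdd W ∧ σ.Agree [rFound s, rScan s] σ' ∧
        (σ'.int (rFound s) = 0 ↔ σ.int (rCand s) ∉ l) := by
  have h2W : (1 : ℤ) < 2 ^ W := one_lt_pow₀ (by norm_num) hW.ne'
  have hS : ∀ r ∈ [rFound s, rScan s], 2 * s + 6 ≤ r := by simp [workReg]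
  refine Program.Runs.mono (n := 1 + (1 + (l.length * (3 + 1) + 1))) ?_ (by omega) fun _ h => h
  refine .assign_seq hσ (z := 0) rfl (by simp) fun hσ₁ => ?_
  refine .assign_seq hσ₁ (z := encode O l) (by simp [Expr.eval, hnew])
    (hnew ▸ hσ (rNew s)) fun hσ₂ => ?_
  -- Invariant: either nothing was found and the candidate is in the list exactly if it is in the
  -- unread rest, or it was found and is in the list.
  refine Program.Runs.mono (Program.Runs.while_list (n := 3) (fun (l' : List ℤ) (σ' : Store G) =>
    σ'.Bdd W ∧ σ.Agree [rFound s, rScan s] σ' ∧ σ'.int (rScan s) = encode O l' ∧ Fits O l' ∧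
      ((σ'.int (rFound s) = 0 ∧ (σ.int (rCand s) ∈ l ↔ σ.int (rCand s) ∈ l')) ∨
        (σ'.int (rFound s) = 1 ∧ σ.int (rCand s) ∈ l)))
    (fun l' σ' hI => hI.1) ?_ ?_ l _ ?_) le_rfl ?_
  · rintro σ' ⟨-, -, h1, -⟩
    simp [Test.Holds, Expr.eval, h1, encode]
  · rintro w l' σ' ⟨hB, hA, hscan, hfit, hfound⟩
    have hc := h.of_agree hS hA
    have hcand : σ'.int (rCand s) = σ.int (rCand s) := hA.1 _ (by simp)
    refine ⟨by simpa [Test.Holds, Expr.eval, hscan] using encode_cons_pos hfit, ?_⟩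
    have hlast : ∀ σ₁ : Store G, σ₁.Bdd W → σ.Agree [rFound s, rScan s] σ₁ →
        σ₁.int (rScan s) = encode O (w :: l') →
        ((σ₁.int (rFound s) = 0 ∧ (σ.int (rCand s) ∈ l ↔ σ.int (rCand s) ∈ l')) ∨
          (σ₁.int (rFound s) = 1 ∧ σ.int (rCand s) ∈ l)) →
        (Program.assign (rScan s) (.div (.reg (rScan s)) (baseExpr s))).Runs W σ₁ 1
          fun σ' => σ'.Bdd W ∧ σ.Agree [rFound s, rScan s] σ' ∧ σ'.int (rScan s) = encode O l' ∧
            Fits O l' ∧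
            ((σ'.int (rFound s) = 0 ∧ (σ.int (rCand s) ∈ l ↔ σ.int (rCand s) ∈ l')) ∨
              (σ'.int (rFound s) = 1 ∧ σ.int (rCand s) ∈ l)) := by
      intro σ₁ hB₁ hA₁ hscan₁ hfound₁
      refine .assign_eq hB₁ (z := encode O l') ?_ ?_
      · have := (h.of_agree hS hA₁).off
        simp [Expr.eval, baseExpr, hscan₁, this, encode_cons_ediv hfit]
      · refine ⟨hB₁.set ?_, hA₁.set (by simp) _, by simp, hfit.tail, by simpa using hfound₁⟩
        have h1 := hB₁ (rScan s)
        rw [hscan₁, abs_of_nonneg (encode_nonneg hfit)] at h1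
        rw [abs_of_nonneg (encode_nonneg hfit.tail)]
        exact (encode_tail_le hfit).trans_lt h1
    refine .seq (n₁ := 2) (n₂ := 1) (.ite hB (fun ht => ?_) fun ht => ?_)
    · refine .assign_eq hB (z := 1) rfl (hlast _ (hB.set (by simpa using h2W))
        (hA.set (by simp) _) (by simpa using hscan) ?_)
      have hw : w = σ.int (rCand s) := by
        simp only [Test.Holds, Expr.eval, baseExpr, hscan, hc.off, encode_cons_emod hfit,
          hcand] at ht
        linarith
      right
      refine ⟨by simp, ?_⟩
      rcases hfound with ⟨-, hiff⟩ | ⟨-, hmem⟩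
      · rw [hiff, hw]; exact List.mem_cons_self
      · exact hmem
    · refine .skip (hlast _ hB hA hscan ?_)
      have hw : σ.int (rCand s) ≠ w := by
        intro hw
        apply ht
        simp [Test.Holds, Expr.eval, baseExpr, hscan, hc.off, encode_cons_emod hfit, hcand, hw]
      rcases hfound with ⟨h0, hiff⟩ | h1
      · exact Or.inl ⟨h0, by rw [hiff, List.mem_cons, or_iff_right hw]⟩
      · exact Or.inr h1
  · refine ⟨hσ₂, ((Store.Agree.refl _ σ).set (by simp) _).set (by simp) _, by simp, hl, ?_⟩
    left
    exact ⟨by simp, Iff.rfl⟩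
  · rintro σ' ⟨hB, hA, -, -, hfound⟩
    refine ⟨hB, hA, ?_⟩
    rcases hfound with ⟨h0, hiff⟩ | ⟨h1, hmem⟩
    · simp [h0, hiff]
    · simp [h1, hmem]

theorem insertProg_runs {σ : Store G} (hσ : σ.Bdd W) (hN : 0 < N) (hn : 0 < n)
    (h : Ctx ℓ m N n O f σ) (hW : (2 * O) ^ n < 2 ^ W) (hWn : (n : ℤ) < 2 ^ W) {A E : ℤ}
    (hA : σ.int (rA s) = A) (hE : σ.int (rE s) = E) (hAO : 8 * A + 1 < O) {l : List ℤ}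
    (hl : ListOf (InBox m N f A E) n l)
    (hnew : σ.int (rNew s) = encode O l) (hlen : σ.int (rLen s) = l.length) :
    (insertProg s).Runs W σ (4 * n + 6) fun σ' =>
      σ'.Bdd W ∧ σ.Agree (insertRegs s) σ' ∧
        σ'.int (rNew s) = encode O (tryPush (InBox m N f A E) n l (σ.int (rCand s))) ∧
        σ'.int (rLen s) = (tryPush (InBox m N f A E) n l (σ.int (rCand s))).length := by
  have hfit : Fits O l := fun w hw => (hl.holds w hw).abs_lt hAO
  have hWpos : 0 < W := by
    rcases Nat.eq_zero_or_pos W with h0 | h0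
    · rw [h0, pow_zero] at hWn
      omega
    · exact h0
  have hll := hl.length_le
  refine Program.Runs.mono (n := (4 * l.length + 3) + 3) ?_ (by omega) fun _ h => h
  refine .seq (Program.Runs.mono (scanProg_runs hσ hWpos h hfit hnew) le_rfl ?_)
  rintro σ₁ ⟨hB, hAg, hfound⟩
  have hc : Ctx ℓ m N n O f σ₁ := h.of_agree (by simp [workReg]) hAg
  have hAg' : σ.Agree (insertRegs s) σ₁ :=
    (Store.Agree.refl _ _).trans hAg (by simp [insertRegs])
  have e1 : σ₁.int (rCand s) = σ.int (rCand s) := hAg.1 _ (by simp)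
  have e2 : σ₁.int (rNew s) = encode O l := (hAg.1 _ (by simp)).trans hnew
  have e3 : σ₁.int (rLen s) = l.length := (hAg.1 _ (by simp)).trans hlen
  have e4 : σ₁.int (rA s) = A := (hAg.1 _ (by simp)).trans hA
  have e5 : σ₁.int (rE s) = E := (hAg.1 _ (by simp)).trans hE
  set w := σ.int (rCand s) with hw
  have htest : (Test.and (boxTest s) (.and (.eq (.reg (rFound s)) (.const 0))
      (.lt (.reg (rLen s)) (.reg (rMax s))))).Holds σ₁ ↔
      (InBox m N f A E w ∧ w ∉ l ∧ l.length < n) := by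
    simp only [Test.Holds, Expr.eval, boxTest_holds hN hc e4 e5 e1, hfound, e3, hc.max,
      Nat.cast_lt]
  refine .ite (n := 2) hB (fun ht => ?_) fun ht => ?_
  · have hcond := htest.1 ht
    have hpush : tryPush (InBox m N f A E) n l w = w :: l := if_pos hcond
    have hfit' : Fits O (w :: l) := hfit.cons (hcond.1.abs_lt hAO)
    have hlt : |encode O (w :: l)| < 2 ^ W := by
      rw [abs_of_nonneg (encode_nonneg hfit')]
      refine (encode_lt hfit').trans_le (le_trans ?_ hW.le)
      have hO : 0 < O := (abs_nonneg w).trans_lt hfit'.head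
      -- The cut-off keeps the list at length at most n, so its code stays below (2 O)^n < 2^W.
      exact pow_le_pow_right₀ (by omega) hcond.2.2
    rw [hpush]
    refine .assign_seq (n := 1) hB (z := encode O (w :: l)) ?_ hlt fun hB₂ => ?_
    · simp [Expr.eval, baseExpr, e1, e2, hc.off, encode]
    · refine .assign_eq hB₂ (z := ((w :: l).length : ℤ)) ?_ ⟨hB₂.set ?_, ?_, ?_, ?_⟩
      · simp [Expr.eval, e3]
      · rw [abs_of_nonneg (by positivity)]
        exact lt_of_le_of_lt (by exact_mod_cast hcond.2.2) hWn
      · exact (hAg'.set (by simp [insertRegs]) _).set (by simp [insertRegs]) _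
      · simp
      · simp
  · have hpush : tryPush (InBox m N f A E) n l w = l := if_neg fun hc => ht (htest.2 hc)
    rw [hpush]
    exact (Program.Runs.skip (W := W) ⟨hB, hAg', e2, e3⟩).mono (by norm_num) fun _ h => h

/-- All sums of two entries, in the order in which `sumProg` treats them. -/
def sums (l l' : List ℤ) : List ℤ := l.flatMap fun u => l'.map fun v => u + v

/-- There are at most n² sums, and the insertion of each takes a number of steps linear in n; hence
the cubic bound. Both loops share the invariant that inserting the remaining sums into the list
under construction leads to the same final list. -/
theorem sumProg_runs {σ : Store G} (hσ : σ.Bdd W) (hN : 0 < N) (hn : 0 < n)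
    (h : Ctx ℓ m N n O f σ) (hW : (2 * O) ^ n < 2 ^ W) (hWn : (n : ℤ) < 2 ^ W) (hO : 0 < O)
    {A E : ℤ} (hA : σ.int (rA s) = A) (hE : σ.int (rE s) = E) (hAO : 8 * A + 1 < O) {Z : List ℤ}
    (hZ : Fits O Z) (hZn : Z.length ≤ n) (hlist : σ.int (rList s) = encode O Z) :
    (sumProg s).Runs W σ (20 * (n + 1) ^ 3) fun σ' =>
      σ'.Bdd W ∧ σ.Agree (sumRegs s) σ' ∧
        σ'.int (rList s) = encode O (pushAll (InBox m N f A E) n (sums Z Z) []) := by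
  have h2O : 2 * O < 2 ^ W := lt_of_le_of_lt (le_self_pow₀ (by linarith) hn.ne') hW
  have hS : ∀ r ∈ sumRegs s, 2 * s + 6 ≤ r := by simp [sumRegs, workReg]
  set p := InBox m N f A E with hp
  set target := pushAll p n (sums Z Z) [] with htarget
  -- the invariant of both loops: `acc` is the list under construction, `c` the candidates left
  let J : List ℤ → List ℤ → Store G → Prop := fun c acc σ' =>
    σ'.Bdd W ∧ σ.Agree (sumRegs s) σ' ∧ ListOf p n acc ∧ σ'.int (rNew s) = encode O acc ∧
      σ'.int (rLen s) = acc.length ∧ σ'.int (rList s) = encode O Z ∧ pushAll p n c acc = target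
  have hzero : |(0 : ℤ)| < 2 ^ W := by simp
  have hencZ : |encode O Z| < 2 ^ W := hlist ▸ hσ (rList s)
  have hJset : ∀ {c acc σ'} {r : ℕ} {z : ℤ}, J c acc σ' → r ∈ sumRegs s → r ≠ rNew s →
      r ≠ rLen s → r ≠ rList s → |z| < 2 ^ W → J c acc (σ'.set r z) := by
    rintro c acc σ' r z ⟨j1, j2, j3, j4, j5, j6, j7⟩ hr h1 h2 h3 hz
    refine ⟨j1.set hz, j2.set hr z, j3, ?_, ?_, ?_, j7⟩
    · rw [Store.set_int, if_neg h1.symm, j4]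
    · rw [Store.set_int, if_neg h2.symm, j5]
    · rw [Store.set_int, if_neg h3.symm, j6]
  have hpop : ∀ {v : ℤ} {l : List ℤ}, Fits O (v :: l) → |encode O (v :: l)| < 2 ^ W →
      |v| < 2 ^ W ∧ |encode O l| < 2 ^ W := by
    intro v l hfit hb
    rw [abs_of_nonneg (encode_nonneg hfit)] at hb
    rw [abs_of_nonneg (encode_nonneg hfit.tail)]
    exact ⟨hfit.head.trans (by linarith), (encode_tail_le hfit).trans_lt hb⟩
  have hinner : ∀ (u : ℤ) (l c : List ℤ) (σ' : Store G), |u| < O → Fits O l →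
      (∃ acc, J (l.map (fun v => u + v) ++ c) acc σ') → σ'.int (rEntry s) = u →
      σ'.int (rRest' s) = encode O l →
      (Program.while (.lt (.const 0) (.reg (rRest' s))) <|
        .seq (.assign (rEntry' s) (.sub (.mod (.reg (rRest' s)) (baseExpr s)) (.reg (rOff s)))) <|
        .seq (.assign (rRest' s) (.div (.reg (rRest' s)) (baseExpr s))) <|
        .seq (.assign (rCand s) (.add (.reg (rEntry s)) (.reg (rEntry' s)))) <|
        insertProg s).Runs W σ' (l.length * (4 * n + 9 + 1) + 1) fun σ'' =>
          (∃ acc, J c acc σ'') ∧ σ''.int (rRest s) = σ'.int (rRest s) := by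
    intro u l c σ' hu hfit hJ hent hrest
    refine Program.Runs.mono (Program.Runs.while_list (n := 4 * n + 9)
      (fun (l' : List ℤ) (σ'' : Store G) =>
        (∃ acc, J (l'.map (fun v => u + v) ++ c) acc σ'') ∧ Fits O l' ∧
        σ''.int (rEntry s) = u ∧ σ''.int (rRest' s) = encode O l' ∧
          σ''.int (rRest s) = σ'.int (rRest s))
      (fun l' σ'' hI => hI.1.choose_spec.1) ?_ ?_ l σ' ⟨hJ, hfit, hent, hrest, rfl⟩) le_rfl ?_
    · rintro σ'' ⟨-, -, -, h1, -⟩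
      simp [Test.Holds, Expr.eval, h1, encode]
    · rintro v l' σ'' ⟨⟨acc, hJ⟩, hfit', hent', hrest', hr⟩
      refine ⟨by simpa [Test.Holds, Expr.eval, hrest'] using encode_cons_pos hfit', ?_⟩
      have hB := hJ.1
      have hoff : σ''.int (rOff s) = O := (h.of_agree hS hJ.2.1).off
      obtain ⟨hb1, hb2⟩ := hpop hfit' (hrest' ▸ hB (rRest' s))
      refine Program.Runs.mono (n := 1 + (1 + (1 + (4 * n + 6)))) ?_ (by omega) fun _ h => h
      refine .assign_seq hB (z := v) ?_ hb1 fun hB₁ => ?_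
      · simp [Expr.eval, baseExpr, hrest', hoff, encode_cons_emod hfit']
      refine .assign_seq hB₁ (z := encode O l') ?_ hb2 fun hB₂ => ?_
      · simp [Expr.eval, baseExpr, hrest', hoff, encode_cons_ediv hfit']
      have hb3 : |u + v| < 2 ^ W := by
        have := abs_add_le u v
        have := hfit'.head
        linarith
      refine .assign_seq hB₂ (z := u + v) ?_ hb3 fun hB₃ => ?_
      · simp [Expr.eval, hent']
      have hJ₃ := hJset (hJset (hJset hJ (r := rEntry' s) (by simp [sumRegs]) (by simp) (by simp)
        (by simp) hb1) (r := rRest' s) (by simp [sumRegs]) (by simp) (by simp) (by simp) hb2)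
        (r := rCand s) (by simp [sumRegs]) (by simp) (by simp) (by simp) hb3
      set σ₃ := ((σ''.set (rEntry' s) v).set (rRest' s) (encode O l')).set (rCand s) (u + v)
        with hσ₃
      obtain ⟨-, hAg, hacc, hnew, hlen, hlist₃, hpush⟩ := hJ₃
      have hc₃ := h.of_agree hS hAg
      have eA : σ₃.int (rA s) = A := (hAg.1 _ (by simp [sumRegs])).trans hA
      have eE : σ₃.int (rE s) = E := (hAg.1 _ (by simp [sumRegs])).trans hE
      have hcand : σ₃.int (rCand s) = u + v := by simp [hσ₃]
      refine (insertProg_runs hB₃ hN hn hc₃ hW hWn eA eE hAO hacc hnew hlen).mono le_rfl ?_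
      rintro σ₄ ⟨hB₄, hAg₄, hnew₄, hlen₄⟩
      rw [hcand] at hnew₄ hlen₄
      refine ⟨⟨tryPush p n acc (u + v), hB₄, hAg.trans hAg₄ (by simp [insertRegs, sumRegs]),
        hacc.tryPush _, hnew₄, hlen₄, ?_, ?_⟩, hfit'.tail, ?_, ?_, ?_⟩
      · rw [hAg₄.1 _ (by simp [insertRegs]), hlist₃]
      · rw [← hpush]; rfl
      · rw [hAg₄.1 _ (by simp [insertRegs])]; simp [hσ₃, hent']
      · rw [hAg₄.1 _ (by simp [insertRegs])]; simp [hσ₃]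
      · rw [hAg₄.1 _ (by simp [insertRegs])]; simp [hσ₃, hr]
    · rintro σ'' ⟨h1, -, -, -, h2⟩
      exact ⟨by simpa using h1, h2⟩
  have hcount : 1 + (1 + (1 + ((Z.length * (1 + (1 + (1 + (Z.length * (4 * n + 9 + 1) + 1))) + 1) + 1)
      + 1))) ≤ 20 * (n + 1) ^ 3 := by
    have h1 : Z.length * (4 * n + 9 + 1) ≤ n * (4 * n + 10) := Nat.mul_le_mul_right _ hZn
    calc _ ≤ 1 + (1 + (1 + ((n * (1 + (1 + (1 + (n * (4 * n + 10) + 1))) + 1) + 1) + 1))) := by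
          gcongr
      _ ≤ _ := by nlinarith [sq_nonneg n, Nat.zero_le (n ^ 3)]
  refine Program.Runs.mono ?_ hcount fun _ h => h
  refine .assign_seq hσ (z := 0) rfl hzero fun hσ₁ => ?_
  refine .assign_seq hσ₁ (z := 0) rfl hzero fun hσ₂ => ?_
  refine .assign_seq hσ₂ (z := encode O Z) (by simp [Expr.eval, hlist]) hencZ fun hσ₃ => ?_
  refine .seq (Program.Runs.mono (Program.Runs.while_list
    (n := 1 + (1 + (1 + (Z.length * (4 * n + 9 + 1) + 1))))
    (fun (l : List ℤ) (σ' : Store G) => (∃ acc, J (sums l Z) acc σ') ∧ Fits O l ∧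
      σ'.int (rRest s) = encode O l) (fun l σ' hI => hI.1.choose_spec.1) ?_ ?_ Z _ ?_) le_rfl ?_)
  · rintro σ' ⟨-, -, h1⟩
    simp [Test.Holds, Expr.eval, h1, encode]
  · rintro u l σ' ⟨⟨acc, hJ⟩, hfit, hrest⟩
    refine ⟨by simpa [Test.Holds, Expr.eval, hrest] using encode_cons_pos hfit, ?_⟩
    have hB := hJ.1
    have hoff : σ'.int (rOff s) = O := (h.of_agree hS hJ.2.1).off
    have hlistJ : σ'.int (rList s) = encode O Z := hJ.2.2.2.2.2.1
    obtain ⟨hb1, hb2⟩ := hpop hfit (hrest ▸ hB (rRest s))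
    refine .assign_seq hB (z := u) ?_ hb1 fun hB₁ => ?_
    · simp [Expr.eval, baseExpr, hrest, hoff, encode_cons_emod hfit]
    refine .assign_seq hB₁ (z := encode O l) ?_ hb2 fun hB₂ => ?_
    · simp [Expr.eval, baseExpr, hrest, hoff, encode_cons_ediv hfit]
    refine .assign_seq hB₂ (z := encode O Z) ?_ hencZ fun hB₃ => ?_
    · simp [Expr.eval, hlistJ]
    refine (hinner u Z (sums l Z) _ hfit.head hZ ⟨acc, hJset (hJset (hJset hJ
      (r := rEntry s) (by simp [sumRegs]) (by simp) (by simp) (by simp) hb1)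
      (r := rRest s) (by simp [sumRegs]) (by simp) (by simp) (by simp) hb2)
      (r := rRest' s) (by simp [sumRegs]) (by simp) (by simp) (by simp) hencZ⟩
      (by simp) (by simp)).mono le_rfl ?_
    rintro σ'' ⟨h1, h2⟩
    exact ⟨h1, hfit.tail, by rw [h2]; simp⟩
  · refine ⟨⟨[], hσ₃, ?_, ListOf.nil _ _, by simp [encode], by simp, by simp [hlist], rfl⟩, hZ,
      by simp⟩
    exact (((Store.Agree.refl _ σ).set (by simp [sumRegs]) _).set (by simp [sumRegs]) _).set
      (by simp [sumRegs]) _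
  · rintro σ' ⟨⟨acc, hJ⟩, -, -⟩
    obtain ⟨hB, hAg, -, hnew, -, -, hpush⟩ := hJ
    have hacc : acc = target := hpush
    refine .assign_eq hB (z := encode O acc) (by simp [Expr.eval, hnew])
      ⟨hB.set (hnew ▸ hB (rNew s)), hAg.set (by simp [sumRegs]) _, by simp [hacc]⟩

end Insert


/-! ### The list at level zero -/

/-- The integers `L - k + 1, …, L`. -/
def intsUpTo (L : ℤ) : ℕ → List ℤ
  | 0 => []
  | k + 1 => (L - k) :: intsUpTo L k

theorem mem_intsUpTo {L w : ℤ} {k : ℕ} : w ∈ intsUpTo L k ↔ L - k < w ∧ w ≤ L := by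
  induction k with
  | zero => simp [intsUpTo]
  | succ k ih => rw [intsUpTo, List.mem_cons, ih]; push_cast; omega

/-- Make the list of all points of the box, by trying all integers `8 a + q` with `|a| ≤ A`. -/
def initProg (s : ℕ) : Program :=
  .seq (.assign (rNew s) (.const 0)) <|
  .seq (.assign (rLen s) (.const 0)) <|
  .seq (.assign (rCand s) (.sub (.const (-1)) (.mul (.const 8) (.reg (rA s))))) <|
  .seq (.while (.lt (.reg (rCand s)) (.add (.mul (.const 8) (.reg (rA s))) (.const 2))) <|
    .seq (insertProg s) <|
    .assign (rCand s) (.add (.reg (rCand s)) (.const 1))) <|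
  .assign (rList s) (.reg (rNew s))

/-- For each level, enlarge the box in one direction and then shrink it in the other ones. -/
def levelsProg (s : ℕ) : Program :=
  .seq (.assign (rLevels s) (.reg 0)) <|
  .while (.lt (.const 0) (.reg (rLevels s))) <|
    .seq (.assign (rInc s) (.div (.reg (rA s)) (.const 4))) <|
    .seq (.assign (rCount s) (.const ((4 * (2 ^ s - 1) : ℕ) : ℤ))) <|
    .seq (.while (.lt (.const 0) (.reg (rCount s))) <|
      .seq (.assign (rA s) (.add (.reg (rA s)) (.reg (rInc s)))) <|
      .seq (sumProg s) <|
      .assign (rCount s) (.sub (.reg (rCount s)) (.const 1))) <|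
    .seq (.assign (rE s) (.div (.reg (rE s)) (.const 2))) <|
    .assign (rLevels s) (.sub (.reg (rLevels s)) (.const 1))

/-- The registers that `initProg` and `levelsProg` modify. -/
def listRegs (s : ℕ) : List ℕ :=
  [rA s, rE s, rInc s, rLevels s, rCount s, rFound s, rScan s, rNew s, rLen s, rRest s, rEntry s,
    rRest' s, rEntry' s, rCand s, rList s]

theorem InBox.mono {s m N : ℕ} {f : Fin s → ℕ × ℕ} {A A' E E' w : ℤ} (h : InBox m N f A E w)
    (hA : A ≤ A') (hE : E ≤ E') : InBox m N f A' E' w := by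
  obtain ⟨a, q, hw, hq, ha, hb⟩ := h
  exact ⟨a, q, hw, hq, ha.trans hA, fun i => (hb i).imp fun b hb => hb.trans hE⟩

section Levels

variable {G : Type*} {W s ℓ m N n : ℕ} {O : ℤ} {f : Fin s → ℕ × ℕ}

/-- The register `rList` holds a list which, if the tuple is balanced, contains the whole box. -/
def HoldsBox (ℓ m N n : ℕ) (κ : ℕ) (O : ℤ) (f : Fin s → ℕ × ℕ) (A E : ℤ) (σ : Store G) : Prop :=
  ∃ Z : List ℤ, Fits O Z ∧ Z.length ≤ n ∧ σ.int (rList s) = encode O Z ∧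
    (Balanced ℓ N κ (fun i => (f i).1) → ∀ w, InBox m N f A E w → w ∈ Z)

theorem HoldsBox.congr {κ : ℕ} {A E : ℤ} {σ σ' : Store G} (h : HoldsBox ℓ m N n κ O f A E σ)
    (hσ : σ'.int (rList s) = σ.int (rList s)) : HoldsBox ℓ m N n κ O f A E σ' := by
  obtain ⟨Z, h1, h2, h3, h4⟩ := h
  exact ⟨Z, h1, h2, hσ.trans h3, h4⟩

/-- At level 0 the range of a is only polynomial, so all 16 M + 3 integers from -8 M - 1 to 8 M + 1
are tried. -/
theorem holdsBox_init {σ : Store G} {κ M : ℕ} (hN : 0 < N) (hn : n = boxBound s κ M)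
    (hAO : 8 * (M : ℤ) + 1 < O)
    (hlist : σ.int (rList s) = encode O (pushAll (InBox m N f M (M * N)) n
      (intsUpTo (8 * M + 1) (16 * M + 3)) [])) :
    HoldsBox ℓ m N n κ O f M (M * N) σ := by
  have hL := (ListOf.nil (InBox m N f M (M * N)) n).pushAll (intsUpTo (8 * M + 1) (16 * M + 3))
  refine ⟨_, fun w hw => (hL.holds w hw).abs_lt hAO, hL.length_le, hlist, fun hbal w hw => ?_⟩
  refine (ListOf.nil _ _).mem_pushAll (fun S hS => ?_) hw ?_
  · rw [hn]
    refine card_le_boxBound (h := 0) hN (fun a ha hκ => hbal 0 (Nat.zero_le _) a ha hκ) ?_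
      (by simp) S hS
    rw [mul_zero, pow_zero, mul_one]
    exact le_mul_of_one_le_right (by positivity) (one_le_pow₀ (by norm_num))
  · obtain ⟨a, q, rfl, hq, ha, -⟩ := hw
    rw [mem_intsUpTo]
    rw [abs_le] at hq ha
    push_cast
    constructor <;> linarith

/-- Completeness of the list is claimed under balance only, while its length and the size of its
entries are bounded in any case; this keeps the program fast on bad input. -/
theorem holdsBox_sum {σ' : Store G} {κ M' h : ℕ} {A E : ℤ} {Z : List ℤ} (hN : 0 < N)
    (hκ : 0 < κ) (hh : h ≤ ℓ) (hM : coveringBound s κ ≤ M') (hn : n = boxBound s κ (4 * M'))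
    (hA : 4 * M' * 2 ^ (s * h) ≤ A) (hE : E * 2 ^ h = 4 * M' * N)
    (hA' : A + M' * 2 ^ (s * h) ≤ 4 * M' * 2 ^ s * 2 ^ (s * h))
    (hAO : 8 * (A + M' * 2 ^ (s * h)) + 1 < O)
    (hbox : Balanced ℓ N κ (fun i => (f i).1) → ∀ w, InBox m N f A E w → w ∈ Z)
    (hlist : σ'.int (rList s) =
      encode O (pushAll (InBox m N f (A + M' * 2 ^ (s * h)) E) n (sums Z Z) [])) :
    HoldsBox ℓ m N n κ O f (A + M' * 2 ^ (s * h)) E σ' := by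
  set A' := A + M' * 2 ^ (s * h) with hA'def
  have hL := (ListOf.nil (InBox m N f A' E) n).pushAll (sums Z Z)
  refine ⟨_, fun w hw => (hL.holds w hw).abs_lt hAO, hL.length_le, hlist, fun hbal w hw => ?_⟩
  have hbal' : ∀ a : ℤ, a ≠ 0 → κ * |a| < 2 ^ (s * h) →
      ¬ ∀ i, NearMultiple N (κ * 2 ^ h) a (f i).1 := fun a ha hκ => hbal h hh a ha hκ
  refine (ListOf.nil _ _).mem_pushAll (fun S hS => ?_) hw ?_
  · rw [hn]
    refine card_le_boxBound (h := h) hN hbal' ?_ ?_ S hS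
    · push_cast; exact hA'
    · push_cast; exact hE
  · obtain ⟨u, v, hu, hv, rfl⟩ := hw.exists_add hN hκ hbal' hM hA hE
    exact List.mem_flatMap.2 ⟨u, hbox hbal u hu, List.mem_map.2 ⟨v, hbox hbal v hv, rfl⟩⟩

variable [Group G]

theorem initProg_runs {σ : Store G} (hσ : σ.Bdd W) (hN : 0 < N) (hn : 0 < n)
    (h : Ctx ℓ m N n O f σ) (hW : (2 * O) ^ n < 2 ^ W) (hWn : (n : ℤ) < 2 ^ W)
    {M : ℕ} {E : ℤ} (hA : σ.int (rA s) = M) (hE : σ.int (rE s) = E) (hAO : 8 * (M : ℤ) + 1 < O) :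
    (initProg s).Runs W σ ((16 * M + 3) * (4 * n + 8) + 5) fun σ' =>
      σ'.Bdd W ∧ σ.Agree (insertRegs s ++ [rCand s, rList s]) σ' ∧
        σ'.int (rList s) =
          encode O (pushAll (InBox m N f M E) n (intsUpTo (8 * M + 1) (16 * M + 3)) []) := by
  set S := insertRegs s ++ [rCand s, rList s] with hSdef
  have hS : ∀ r ∈ S, 2 * s + 6 ≤ r := by simp [S, insertRegs, workReg]
  have hO : 0 < O := by
    have : (0 : ℤ) ≤ M := by positivity
    linarith
  have hOW : O < 2 ^ W := by
    have := lt_of_le_of_lt (le_self_pow₀ (by linarith : (1 : ℤ) ≤ 2 * O) hn.ne') hW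
    linarith
  set p := InBox m N f M E with hp
  set target := pushAll p n (intsUpTo (8 * M + 1) (16 * M + 3)) [] with htarget
  have hzero : |(0 : ℤ)| < 2 ^ W := by simp
  refine Program.Runs.mono
    (n := 1 + (1 + (1 + (((16 * M + 3) * ((4 * n + 7) + 1) + 1) + 1)))) ?_
    (by rw [add_assoc (4 * n) 7 1]; omega) fun _ h => h
  refine .assign_seq hσ (z := 0) rfl hzero fun hσ₁ => ?_
  refine .assign_seq hσ₁ (z := 0) rfl hzero fun hσ₂ => ?_
  refine .assign_seq hσ₂ (z := -1 - 8 * (M : ℤ)) (by simp [Expr.eval, hA]) ?_ fun hσ₃ => ?_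
  · rw [abs_of_nonpos (by omega)]
    linarith
  refine .seq (Program.Runs.mono (Program.Runs.while_nat (n := 4 * n + 7)
    (fun (k : ℕ) (σ' : Store G) => σ'.Bdd W ∧ σ.Agree S σ' ∧
      σ'.int (rCand s) = 8 * M + 2 - k ∧ k ≤ 16 * M + 3 ∧ ∃ acc, ListOf p n acc ∧
        σ'.int (rNew s) = encode O acc ∧ σ'.int (rLen s) = acc.length ∧
          pushAll p n (intsUpTo (8 * M + 1) k) acc = target)
    (fun k σ' hI => hI.1) ?_ ?_ (16 * M + 3) _ ?_) le_rfl ?_)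
  · rintro σ' ⟨-, hAg, hc, -⟩
    have eA : σ'.int (rA s) = M := (hAg.1 _ (by simp [S, insertRegs])).trans hA
    simp [Test.Holds, Expr.eval, hc, eA]
  · rintro k σ' ⟨hB, hAg, hcand, hk, acc, hacc, hnew, hlen, hpush⟩
    have eA : σ'.int (rA s) = M := (hAg.1 _ (by simp [S, insertRegs])).trans hA
    have eE : σ'.int (rE s) = E := (hAg.1 _ (by simp [S, insertRegs])).trans hE
    push_cast at hcand
    refine ⟨by simp only [Test.Holds, Expr.eval, hcand, eA]; linarith, ?_⟩
    refine .seq (n₁ := 4 * n + 6) (n₂ := 1) ((insertProg_runs hB hN hn (h.of_agree hS hAg) hW hWn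
      eA eE hAO hacc hnew hlen).mono le_rfl ?_)
    rintro σ₁ ⟨hB₁, hAg₁, hnew₁, hlen₁⟩
    have hcand₁ : σ₁.int (rCand s) = 8 * M + 1 - k := by
      rw [hAg₁.1 _ (by simp [insertRegs]), hcand]; ring
    have hb : |(8 * M + 2 - k : ℤ)| < 2 ^ W := by
      rw [abs_lt]
      constructor <;> omega
    refine .assign_eq hB₁ (z := 8 * M + 2 - k) ?_ ⟨hB₁.set hb, ?_, by simp, by omega,
      tryPush p n acc (8 * M + 1 - k), hacc.tryPush _, ?_, ?_, hpush⟩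
    · simp only [Expr.eval, hcand₁]; ring
    · exact (hAg.trans hAg₁ (by simp [S])).set (by simp [S]) _
    · rw [hcand, show (8 * M + 2 - (k + 1) : ℤ) = 8 * M + 1 - k by ring] at hnew₁
      simpa using hnew₁
    · rw [hcand, show (8 * M + 2 - (k + 1) : ℤ) = 8 * M + 1 - k by ring] at hlen₁
      simpa using hlen₁
  · refine ⟨hσ₃, ?_, ?_, le_rfl, [], ListOf.nil _ _, by simp [encode], by simp, rfl⟩
    · exact (((Store.Agree.refl _ σ).set (by simp [S, insertRegs]) _).set
        (by simp [S, insertRegs]) _).set (by simp [S]) _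
    · simp only [Store.set_int, if_true]
      push_cast
      ring
  · rintro σ' ⟨hB, hAg, -, -, acc, hacc, hnew, -, hpush⟩
    have hacc' : acc = target := hpush
    exact .assign_eq hB (z := encode O acc) (by simp [Expr.eval, hnew])
      ⟨hB.set (hnew ▸ hB (rNew s)), hAg.set (by simp [S]) _, by simp [hacc']⟩

/-- With k levels left the current level is ℓ - k, and the list holds the box with A = 4 M'
2^(s(ℓ-k)) and E = 4 M' 2^(k+m). The relation between E and the level that `holdsBox_sum` requires
is preserved throughout. -/
theorem levelsProg_runs {σ : Store G} {κ M' : ℕ} (hσ : σ.Bdd W) (hn : 0 < n)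
    (h : Ctx ℓ m (2 ^ (ℓ + m)) n O f σ) (hW : (2 * O) ^ n < 2 ^ W) (hWn : (n : ℤ) < 2 ^ W)
    (hκ : 0 < κ) (hM : coveringBound s κ ≤ M') (hnb : n = boxBound s κ (4 * M'))
    (hAO : 8 * (4 * M' * 2 ^ s * 2 ^ (s * ℓ) : ℤ) + 1 < O) (hEO : (4 * M' * 2 ^ (ℓ + m) : ℤ) < O)
    (hsO : (4 * 2 ^ s : ℤ) < O) (hℓO : (ℓ : ℤ) < O)
    (hA : σ.int (rA s) = 4 * M') (hE : σ.int (rE s) = 4 * M' * 2 ^ (ℓ + m))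
    (hbox : HoldsBox ℓ m (2 ^ (ℓ + m)) n κ O f (4 * M') (4 * M' * 2 ^ (ℓ + m)) σ) :
    (levelsProg s).Runs W σ (ℓ * (4 * 2 ^ s * (20 * (n + 1) ^ 3 + 3) + 6) + 2) fun σ' =>
      σ'.Bdd W ∧ σ.Agree (listRegs s) σ' ∧
        HoldsBox ℓ m (2 ^ (ℓ + m)) n κ O f (4 * M' * 2 ^ (s * ℓ)) (4 * M' * 2 ^ m) σ' := by
  have hN : 0 < 2 ^ (ℓ + m) := by positivity
  have hO : 0 < O := by
    have : (0 : ℤ) ≤ ℓ := by positivity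
    linarith
  have hOW : O < 2 ^ W := by
    have := lt_of_le_of_lt (le_self_pow₀ (by linarith : (1 : ℤ) ≤ 2 * O) hn.ne') hW
    linarith
  have hM0 : (0 : ℤ) ≤ M' := by positivity
  -- Enlarging 4 M' U to 4 M' 2^s U in steps of M' U takes 4 (2^s - 1) rounds.
  set c := 4 * (2 ^ s - 1) with hc
  have hs1 : 1 ≤ 2 ^ s := Nat.one_le_two_pow
  have hcO : (c : ℤ) < O := by
    have : (c : ℤ) ≤ ((4 * 2 ^ s : ℕ) : ℤ) := by exact_mod_cast (by omega : c ≤ 4 * 2 ^ s)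
    push_cast at this
    linarith
  have hc4 : (c : ℤ) + 4 = 4 * 2 ^ s := by
    have : c + 4 = 4 * 2 ^ s := by omega
    exact_mod_cast this
  -- agreement of the registers outside of those that are modified is all that `Ctx` needs
  have hctx : ∀ σ' : Store G, σ.Agree (listRegs s) σ' → Ctx ℓ m (2 ^ (ℓ + m)) n O f σ' :=
    fun σ' hAg => h.of_agree (by simp [listRegs, workReg]) hAg
  have habs : ∀ {z : ℤ}, 0 ≤ z → z < O → |z| < 2 ^ W := fun h0 h1 => by
    rw [abs_of_nonneg h0]; exact h1.trans hOW
  -- one level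
  have hlevel : ∀ (k : ℕ) (σ' : Store G), k + 1 ≤ ℓ → σ'.Bdd W → σ.Agree (listRegs s) σ' →
      σ'.int (rLevels s) = (k + 1 : ℕ) → σ'.int (rA s) = 4 * M' * 2 ^ (s * (ℓ - (k + 1))) →
      σ'.int (rE s) = 4 * M' * 2 ^ (k + 1 + m) →
      HoldsBox ℓ m (2 ^ (ℓ + m)) n κ O f (4 * M' * 2 ^ (s * (ℓ - (k + 1))))
        (4 * M' * 2 ^ (k + 1 + m)) σ' →
      (Program.seq (.assign (rInc s) (.div (.reg (rA s)) (.const 4))) <|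
        .seq (.assign (rCount s) (.const ((4 * (2 ^ s - 1) : ℕ) : ℤ))) <|
        .seq (.while (.lt (.const 0) (.reg (rCount s))) <|
          .seq (.assign (rA s) (.add (.reg (rA s)) (.reg (rInc s)))) <|
          .seq (sumProg s) <|
          .assign (rCount s) (.sub (.reg (rCount s)) (.const 1))) <|
        .seq (.assign (rE s) (.div (.reg (rE s)) (.const 2))) <|
        .assign (rLevels s) (.sub (.reg (rLevels s)) (.const 1))).Runs W σ'
        (1 + (1 + ((c * ((1 + (20 * (n + 1) ^ 3 + 1)) + 1) + 1) + (1 + 1)))) fun σ'' =>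
          σ''.Bdd W ∧ σ.Agree (listRegs s) σ'' ∧ σ''.int (rLevels s) = k ∧
          σ''.int (rA s) = 4 * M' * 2 ^ (s * (ℓ - k)) ∧ σ''.int (rE s) = 4 * M' * 2 ^ (k + m) ∧
          HoldsBox ℓ m (2 ^ (ℓ + m)) n κ O f (4 * M' * 2 ^ (s * (ℓ - k)))
            (4 * M' * 2 ^ (k + m)) σ'' := by
    intro k σ' hk hB hAg hlev hA' hE' hbox'
    obtain ⟨lev, hlevk⟩ : ∃ lev, ℓ - (k + 1) = lev := ⟨_, rfl⟩
    have hlev1 : ℓ - k = lev + 1 := by omega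
    rw [hlevk] at hA' hbox'
    rw [hlev1]
    have hpow : (2 : ℤ) ^ (s * (lev + 1)) = 2 ^ s * 2 ^ (s * lev) := by
      rw [mul_add, mul_one, pow_add, mul_comm]
    have hpowle : (2 : ℤ) ^ (s * lev) ≤ 2 ^ (s * ℓ) :=
      pow_le_pow_right₀ (by norm_num) (Nat.mul_le_mul_left s (by omega))
    set U : ℤ := 2 ^ (s * lev) with hU
    have hU0 : 0 < U := by positivity
    have hMU : (0 : ℤ) ≤ M' * U := by positivity
    have hbig : 8 * (4 * M' * 2 ^ s * U) + 1 < O := by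
      have : (4 * M' * 2 ^ s * U : ℤ) ≤ 4 * M' * 2 ^ s * 2 ^ (s * ℓ) := by gcongr
      linarith
    have hcU : (4 * M' * 2 ^ s * U : ℤ) = 4 * M' * U + c * (M' * U) := by
      have : (4 * M' * 2 ^ s * U : ℤ) = (4 * 2 ^ s) * (M' * U) := by ring
      rw [this, ← hc4]; ring
    have hElt : (4 * M' * 2 ^ (k + 1 + m) : ℤ) < O := by
      refine lt_of_le_of_lt ?_ hEO
      have : (2 : ℤ) ^ (k + 1 + m) ≤ 2 ^ (ℓ + m) := pow_le_pow_right₀ (by norm_num) (by omega)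
      gcongr
    have hEscale : (4 * M' * 2 ^ (k + 1 + m) : ℤ) * 2 ^ lev = 4 * M' * ((2 ^ (ℓ + m) : ℕ) : ℤ) := by
      push_cast
      rw [mul_assoc, ← pow_add]
      congr 2
      omega
    refine .assign_seq hB (z := M' * U) ?_ (habs hMU ?_) fun hB₁ => ?_
    · simp only [Expr.eval, hA']
      rw [show (4 * M' * U : ℤ) = 4 * (M' * U) by ring]
      exact Int.mul_ediv_cancel_left _ (by norm_num)
    · have : (0 : ℤ) ≤ c * (M' * U) := by positivity
      linarith
    refine .assign_seq hB₁ (z := c) rfl (habs (by positivity) hcO) fun hB₂ => ?_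
    -- Here i counts the enlargements that are left, so c - i increments have been added to A.
    refine .seq (Program.Runs.mono (Program.Runs.while_nat (n := 1 + (20 * (n + 1) ^ 3 + 1))
      (fun (i : ℕ) (τ : Store G) => τ.Bdd W ∧ σ.Agree (listRegs s) τ ∧
        τ.int (rLevels s) = (k + 1 : ℕ) ∧ τ.int (rInc s) = M' * U ∧ i ≤ c ∧
        τ.int (rCount s) = i ∧ τ.int (rA s) = 4 * M' * U + (c - i) * (M' * U) ∧
        τ.int (rE s) = 4 * M' * 2 ^ (k + 1 + m) ∧
        HoldsBox ℓ m (2 ^ (ℓ + m)) n κ O f (4 * M' * U + (c - i) * (M' * U))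
          (4 * M' * 2 ^ (k + 1 + m)) τ)
      (fun i τ hI => hI.1) ?_ ?_ c _ ?_) le_rfl ?_)
    · rintro τ ⟨-, -, -, -, -, h1, -⟩
      simp [Test.Holds, Expr.eval, h1]
    · rintro i τ ⟨hBτ, hAgτ, hlevτ, hincτ, hic, hcountτ, hAτ, hEτ, hboxτ⟩
      push_cast at hcountτ hAτ hboxτ
      have hic' : (i : ℤ) + 1 ≤ c := by exact_mod_cast hic
      refine ⟨by simp only [Test.Holds, Expr.eval, hcountτ]; positivity, ?_⟩
      set A₀ : ℤ := 4 * M' * U + (c - (i + 1)) * (M' * U) with hA₀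
      have hA₁ : A₀ + M' * U = 4 * M' * U + (c - i) * (M' * U) := by rw [hA₀]; ring
      have hA₀ge : 4 * M' * U ≤ A₀ := by
        rw [hA₀]
        have : (0 : ℤ) ≤ (c - (i + 1)) * (M' * U) := mul_nonneg (by linarith) hMU
        linarith
      have hA₁le : A₀ + M' * U ≤ 4 * M' * 2 ^ s * U := by
        rw [hA₁, hcU]
        have : (0 : ℤ) ≤ i * (M' * U) := by positivity
        linarith
      have hA₁O : 8 * (A₀ + M' * U) + 1 < O := by linarith
      refine .assign_seq hBτ (z := A₀ + M' * U) ?_ (habs ?_ ?_) fun hB₃ => ?_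
      · simp [Expr.eval, hAτ, hincτ]
      · have : (0 : ℤ) ≤ 4 * M' * U := by positivity
        linarith
      · have : (0 : ℤ) ≤ 4 * M' * U := by positivity
        linarith
      obtain ⟨Z, hfit, hlen, henc, hmem⟩ := hboxτ
      have hAg₃ : σ.Agree (listRegs s) (τ.set (rA s) (A₀ + M' * U)) :=
        hAgτ.set (by simp [listRegs]) _
      refine .seq (Program.Runs.mono (sumProg_runs hB₃ hN hn (hctx _ hAg₃) hW hWn hO
        (A := A₀ + M' * U) (E := 4 * M' * 2 ^ (k + 1 + m)) (by simp) (by simpa using hEτ) hA₁O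
        hfit hlen (by simpa using henc)) le_rfl ?_)
      rintro τ₁ ⟨hBτ₁, hAgτ₁, hlistτ₁⟩
      have hbox₁ := holdsBox_sum (ℓ := ℓ) hN hκ (by omega : lev ≤ ℓ) hM hnb hA₀ge hEscale
        hA₁le hA₁O hmem hlistτ₁
      have hcount₁ : τ₁.int (rCount s) = i + 1 := by
        rw [hAgτ₁.1 _ (by simp [sumRegs])]; simpa using hcountτ
      refine .assign_eq hBτ₁ (z := i) (by simp [Expr.eval, hcount₁])
        ⟨hBτ₁.set (habs (by positivity) (by linarith)),
          (hAg₃.trans hAgτ₁ (by simp [sumRegs, listRegs])).set (by simp [listRegs]) _,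
          ?_, ?_, by omega, by simp, ?_, ?_, ?_⟩
      · rw [Store.set_int, if_neg (by simp), hAgτ₁.1 _ (by simp [sumRegs])]; simpa using hlevτ
      · rw [Store.set_int, if_neg (by simp), hAgτ₁.1 _ (by simp [sumRegs])]; simpa using hincτ
      · rw [Store.set_int, if_neg (by simp), hAgτ₁.1 _ (by simp [sumRegs]), ← hA₁]; simp
      · rw [Store.set_int, if_neg (by simp), hAgτ₁.1 _ (by simp [sumRegs])]; simpa using hEτ
      · rw [← hA₁]
        exact hbox₁.congr (by simp)
    · refine ⟨hB₂, (hAg.set (by simp [listRegs]) _).set (by simp [listRegs]) _, by simpa using hlev,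
        by simp, le_rfl, by simp, by simpa using hA', by simpa using hE', ?_⟩
      rw [sub_self, zero_mul, add_zero]
      exact hbox'.congr (by simp)
    · rintro τ ⟨hBτ, hAgτ, hlevτ, hincτ, -, hcountτ, hAτ, hEτ, hboxτ⟩
      have hAeq : (4 * M' * U + (c - (0 : ℕ)) * (M' * U) : ℤ) = 4 * M' * 2 ^ (s * (lev + 1)) := by
        rw [hpow, show (4 * M' * (2 ^ s * U) : ℤ) = 4 * M' * 2 ^ s * U by ring, hcU]; simp
      rw [hAeq] at hAτ hboxτ
      have hhalf : (4 * M' * 2 ^ (k + 1 + m) : ℤ) = 2 * (4 * M' * 2 ^ (k + m)) := by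
        rw [show k + 1 + m = (k + m) + 1 by ring, pow_succ]; ring
      have hE0 : (0 : ℤ) ≤ 4 * M' * 2 ^ (k + m) := by positivity
      refine .assign_seq hBτ (z := 4 * M' * 2 ^ (k + m)) ?_ (habs hE0 (by linarith)) fun hB₃ => ?_
      · simp only [Expr.eval, hEτ, hhalf]
        exact Int.mul_ediv_cancel_left _ (by norm_num)
      refine .assign_eq hB₃ (z := k) (by simp [Expr.eval, hlevτ])
        ⟨hB₃.set (habs (by positivity) ?_), (hAgτ.set (by simp [listRegs]) _).set
          (by simp [listRegs]) _, by simp, by simpa using hAτ, by simp, ?_⟩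
      · have : (k : ℤ) + 1 ≤ ℓ := by exact_mod_cast hk
        linarith
      -- Halving E only shrinks the box, so the list still covers it and need not be changed.
      · obtain ⟨Z, hfit, hlen, henc, hmem⟩ := hboxτ
        refine ⟨Z, hfit, hlen, by simpa using henc,
          fun hbal w hw => hmem hbal w (hw.mono le_rfl ?_)⟩
        rw [hhalf]
        linarith
  refine Program.Runs.mono (n := 1 +
    (ℓ * ((1 + (1 + ((c * ((1 + (20 * (n + 1) ^ 3 + 1)) + 1) + 1) + (1 + 1)))) + 1) + 1))
    ?_ ?_ fun _ h => h
  · refine .assign_seq hσ (z := ℓ) (by simp [Expr.eval, h.levels]) (habs (by positivity) hℓO)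
      fun hσ₁ => ?_
    refine Program.Runs.mono (Program.Runs.while_nat
      (n := 1 + (1 + ((c * ((1 + (20 * (n + 1) ^ 3 + 1)) + 1) + 1) + (1 + 1))))
      (fun (k : ℕ) (σ' : Store G) => k ≤ ℓ ∧ σ'.Bdd W ∧ σ.Agree (listRegs s) σ' ∧
        σ'.int (rLevels s) = k ∧ σ'.int (rA s) = 4 * M' * 2 ^ (s * (ℓ - k)) ∧
        σ'.int (rE s) = 4 * M' * 2 ^ (k + m) ∧
        HoldsBox ℓ m (2 ^ (ℓ + m)) n κ O f (4 * M' * 2 ^ (s * (ℓ - k)))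
          (4 * M' * 2 ^ (k + m)) σ')
      (fun k σ' hI => hI.2.1) ?_ ?_ ℓ _ ?_) le_rfl ?_
    · rintro σ' ⟨-, -, -, h1, -⟩
      simp [Test.Holds, Expr.eval, h1]
    · rintro k σ' ⟨hk, hB, hAg, hlev, hA', hE', hbox'⟩
      refine ⟨by simp only [Test.Holds, Expr.eval, hlev]; positivity, ?_⟩
      exact (hlevel k σ' hk hB hAg hlev hA' hE' hbox').mono le_rfl fun σ'' hQ => ⟨by omega, hQ⟩
    · refine ⟨le_rfl, hσ₁, (Store.Agree.refl _ σ).set (by simp [listRegs]) _, by simp, ?_, ?_, ?_⟩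
      · simpa using hA
      · simpa using hE
      · rw [Nat.sub_self, mul_zero, pow_zero, mul_one]
        exact hbox.congr (by simp)
    · rintro σ' ⟨-, hB, hAg, -, -, -, hbox'⟩
      refine ⟨hB, hAg, ?_⟩
      rwa [Nat.sub_zero, Nat.zero_add] at hbox'
  · have h1 : c * (1 + (20 * (n + 1) ^ 3 + 1) + 1) + 4 ≤ 4 * 2 ^ s * (20 * (n + 1) ^ 3 + 3) := by
      have : c + 4 = 4 * 2 ^ s := by omega
      rw [← this, add_mul]
      nlinarith [Nat.zero_le ((n + 1) ^ 3)]
    have h2 := Nat.mul_le_mul_left ℓ (show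
      1 + (1 + ((c * ((1 + (20 * (n + 1) ^ 3 + 1)) + 1) + 1) + (1 + 1))) + 1 ≤
        4 * 2 ^ s * (20 * (n + 1) ^ 3 + 3) + 6 by omega)
    omega

end Levels


/-! ### The test of the candidates -/

/-- A loop that ends after at most `k` iterations. -/
theorem Program.Runs.while_le {G : Type*} [Group G] {W : ℕ} {c : Test} {P : Program} {n : ℕ}
    (I : ℕ → Store G → Prop) (hB : ∀ k σ, I k σ → σ.Bdd W)
    (hs : ∀ k σ, I k σ → c.Holds σ → ∃ k', k = k' + 1 ∧ P.Runs W σ n (I k')) (k : ℕ)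
    (σ : Store G) (h : I k σ) :
    (Program.while c P).Runs W σ (k * (n + 1) + 1) fun σ' => ∃ k', I k' σ' ∧ ¬ c.Holds σ' := by
  induction k generalizing σ with
  | zero =>
    rw [zero_mul, zero_add]
    have hc : ¬ c.Holds σ := fun hc => by
      obtain ⟨k', hk', -⟩ := hs 0 σ h hc
      omega
    exact .while_false (hB 0 σ h) hc ⟨0, h, hc⟩
  | succ k ih =>
    by_cases hc : c.Holds σ
    · obtain ⟨k', hk', hr⟩ := hs _ σ h hc
      obtain rfl : k = k' := by omega
      have h1 := Program.Runs.while_true (hB _ σ h) hc (hr.mono le_rfl fun σ' hσ' => ih σ' hσ')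
      exact h1.mono (by rw [add_mul]; omega) fun _ h => h
    · exact (Program.Runs.while_false (hB _ σ h) hc ⟨k + 1, h, hc⟩).mono (by omega) fun _ h => h

/-- Store the power of group register `0` with exponent `rRest'` in group register `2`, if group
register `3` holds the neutral element. -/
def powerProg (s : ℕ) : Program :=
  .seq (.groupMul 2 3 3) <|
  .seq (.groupMul 4 0 3) <|
  .while (.lt (.const 0) (.reg (rRest' s))) <|
    .seq (.ite (.eq (.mod (.reg (rRest' s)) (.const 2)) (.const 1)) (.groupMul 2 2 4) .skip) <|
    .seq (.groupMul 4 4 4) <|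
    .assign (rRest' s) (.div (.reg (rRest' s)) (.const 2))

/-- Go through the list and test whether one of the entries `8 a + q` yields the logarithm `a` of
group register `1`. -/
def checkProg (s : ℕ) : Program :=
  .seq (.assign (rOut s) (.const 0)) <|
  .seq (.assign (rRest s) (.reg (rList s))) <|
  .seq (.while (.lt (.const 0) (.reg (rRest s))) <|
    .seq (.assign (rEntry s) (.sub (.mod (.reg (rRest s)) (baseExpr s)) (.reg (rOff s)))) <|
    .seq (.assign (rRest s) (.div (.reg (rRest s)) (baseExpr s))) <|
    .seq (.assign (rEntry' s) (.div (.add (.reg (rEntry s)) (.const 1)) (.const 8))) <|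
    .ite (.and (.lt (.const 0) (.reg (rEntry' s))) (.lt (.reg (rEntry' s)) (.reg (rPow s))))
      (.seq (.assign (rRest' s) (.reg (rEntry' s))) <|
        .seq (powerProg s) <|
        .ite (.groupEq 2 1) (.assign (rOut s) (.reg (rEntry' s))) .skip)
      .skip) <|
  .assign 0 (.reg (rOut s))

section Check

variable {G : Type*} [Group G] {W s ℓ m N n : ℕ} {O : ℤ} {f : Fin s → ℕ × ℕ}

/-- Square and multiply: register 2 times the u-th power of register 4 stays equal to g^t while u is
halved. An exponent below 2^k vanishes after at most k halvings. -/
theorem powerProg_runs {σ : Store G} (hσ : σ.Bdd W) (h3 : σ.grp 3 = 1) {t k : ℕ}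
    (ht : σ.int (rRest' s) = t) (hk : t < 2 ^ k) :
    (powerProg s).Runs W σ (5 * k + 3) fun σ' =>
      σ'.Bdd W ∧ (∀ i, i ≠ rRest' s → σ'.int i = σ.int i) ∧
        σ'.grp 0 = σ.grp 0 ∧ σ'.grp 1 = σ.grp 1 ∧ σ'.grp 3 = 1 ∧ σ'.grp 2 = σ.grp 0 ^ t := by
  refine Program.Runs.mono (n := 1 + (1 + (k * (((1 + 1) + (1 + 1)) + 1) + 1))) ?_ (by omega)
    fun _ h => h
  -- Register 3 holds the neutral element, so these two multiplications reset register 2 and copy g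
  -- to register 4.
  refine .seq (.groupMul (.seq (.groupMul ?_)))
  refine Program.Runs.mono (Program.Runs.while_le (n := (1 + 1) + (1 + 1))
    (fun (k : ℕ) (σ' : Store G) => σ'.Bdd W ∧ (∀ i, i ≠ rRest' s → σ'.int i = σ.int i) ∧
      σ'.grp 0 = σ.grp 0 ∧ σ'.grp 1 = σ.grp 1 ∧ σ'.grp 3 = 1 ∧
      ∃ u : ℕ, u < 2 ^ k ∧ σ'.int (rRest' s) = u ∧
        σ'.grp 2 * σ'.grp 4 ^ u = σ.grp 0 ^ t) (fun k σ' hI => hI.1) ?_ k _ ?_) le_rfl ?_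
  · rintro k σ' ⟨hB, hag, h0, h1, h3, u, hu, hreg, hpow⟩ hc
    have hu0 : 0 < u := by simpa [Test.Holds, Expr.eval, hreg] using hc
    obtain ⟨k', rfl⟩ : ∃ k', k = k' + 1 := by
      cases k with
      | zero => simp at hu; omega
      | succ k' => exact ⟨k', rfl⟩
    refine ⟨k', rfl, ?_⟩
    have hfin : ∀ τ : Store G, τ.int = σ'.int → τ.grp 0 = σ.grp 0 → τ.grp 1 = σ.grp 1 →
        τ.grp 3 = 1 → τ.grp 4 = σ'.grp 4 → τ.grp 2 = σ'.grp 2 * σ'.grp 4 ^ (u % 2) →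
        (Program.seq (.groupMul 4 4 4)
          (.assign (rRest' s) (.div (.reg (rRest' s)) (.const 2)))).Runs W τ (1 + 1) fun σ' =>
            σ'.Bdd W ∧ (∀ i, i ≠ rRest' s → σ'.int i = σ.int i) ∧ σ'.grp 0 = σ.grp 0 ∧
              σ'.grp 1 = σ.grp 1 ∧ σ'.grp 3 = 1 ∧ ∃ u : ℕ, u < 2 ^ k' ∧
                σ'.int (rRest' s) = u ∧ σ'.grp 2 * σ'.grp 4 ^ u = σ.grp 0 ^ t := by
      intro τ hτ e0 e1 e3 e4 e2
      have hBτ : τ.Bdd W := fun i => hτ ▸ hB i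
      refine .seq (.groupMul (.assign_eq (z := ((u / 2 : ℕ) : ℤ)) (fun i => hBτ i) ?_ ?_))
      · simp [Expr.eval, hτ, hreg]
      · refine ⟨Store.Bdd.set (fun i => hBτ i) ?_, fun i hi => ?_, by simpa using e0,
          by simpa using e1, by simpa using e3, u / 2, ?_, by simp, ?_⟩
        · refine lt_of_le_of_lt ?_ (hB (rRest' s))
          rw [hreg, Nat.abs_cast, Nat.abs_cast]
          exact_mod_cast Nat.div_le_self u 2
        · rw [Store.set_int, if_neg hi, Store.setGrp_int, hτ, hag i hi]
        · rw [pow_succ] at hu; omega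
        · simp only [Store.set_grp, Store.setGrp_grp]
          norm_num
          rw [e2, e4, ← hpow, mul_assoc, ← sq, ← pow_mul, ← pow_add, Nat.mod_add_div]
    refine .seq (.ite hB (fun hodd => .groupMul ?_) fun heven => .skip ?_)
    · have hu2 : u % 2 = 1 := by
        simp only [Test.Holds, Expr.eval, hreg] at hodd
        omega
      exact hfin _ rfl (by simpa using h0) (by simpa using h1) (by simpa using h3) (by simp)
        (by simp [hu2])
    · have hu2 : u % 2 = 0 := by
        simp only [Test.Holds, Expr.eval, hreg] at heven
        omega
      exact hfin _ rfl h0 h1 h3 rfl (by simp [hu2])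
  · refine ⟨fun i => hσ i, fun i _ => rfl, by simp, by simp, by simpa using h3, t, hk,
      by simpa using ht, by simp [h3]⟩
  · rintro σ' ⟨k', ⟨hB, hag, h0, h1, h3, u, hu, hreg, hpow⟩, hc⟩
    have hu0 : u = 0 := by
      simp only [Test.Holds, Expr.eval, hreg] at hc
      omega
    subst hu0
    exact ⟨hB, hag, h0, h1, h3, by simpa using hpow⟩

/-- Exponents below 2^m ≤ |G| are determined by the power of g, so the test accepts nothing but d.
This makes every nonzero output correct, whatever the list contains. -/
theorem checkProg_runs [Fintype G] {σ : Store G} {g : G} (hg : ∀ y : G, y ∈ Subgroup.zpowers g)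
    {d : ℕ} (hd : 0 < d) (hdm : d < 2 ^ m) (hcard : 2 ^ m ≤ Fintype.card G) (hσ : σ.Bdd W)
    (h : Ctx ℓ m N n O f σ) (h0 : σ.grp 0 = g) (h1 : σ.grp 1 = g ^ d) (h3 : σ.grp 3 = 1)
    {Z : List ℤ} (hfit : Fits O Z) (hlen : Z.length ≤ n) (hlist : σ.int (rList s) = encode O Z) :
    (checkProg s).Runs W σ (n * (5 * m + 11) + 4) fun σ' =>
      (σ'.int 0 = d ∨ σ'.int 0 = 0) ∧ (8 * (d : ℤ) + 1 ∈ Z → σ'.int 0 = d) := by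
  have hOW : |O| < 2 ^ W := h.off ▸ hσ (rOff s)
  have hmW : (2 ^ m : ℤ) < 2 ^ W := lt_of_le_of_lt (le_abs_self _) (h.pow ▸ hσ (rPow s))
  have hdW : |(d : ℤ)| < 2 ^ W := by
    rw [Nat.abs_cast]
    exact lt_trans (by exact_mod_cast hdm) hmW
  have hzero : |(0 : ℤ)| < 2 ^ W := by simp
  refine Program.Runs.mono (n := 1 + (1 + ((Z.length * ((5 * m + 10) + 1) + 1) + 1))) ?_
    (by have h4 : Z.length * ((5 * m + 10) + 1) ≤ n * (5 * m + 11) := Nat.mul_le_mul_right _ hlen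
        omega) fun _ h => h
  refine .assign_seq hσ (z := 0) rfl hzero fun hσ₁ => ?_
  refine .assign_seq hσ₁ (z := encode O Z) (by simp [Expr.eval, hlist]) (hlist ▸ hσ (rList s))
    fun hσ₂ => ?_
  refine .seq (Program.Runs.mono (Program.Runs.while_list (n := 5 * m + 10)
    (fun (l : List ℤ) (τ : Store G) => τ.Bdd W ∧ τ.int (rOff s) = O ∧ τ.int (rPow s) = 2 ^ m ∧
      τ.grp 0 = g ∧ τ.grp 1 = g ^ d ∧ τ.grp 3 = 1 ∧ τ.int (rRest s) = encode O l ∧ Fits O l ∧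
      (τ.int (rOut s) = d ∨ τ.int (rOut s) = 0 ∧ (8 * (d : ℤ) + 1 ∈ Z → 8 * (d : ℤ) + 1 ∈ l)))
    (fun l τ hI => hI.1) ?_ ?_ Z _ ?_) le_rfl ?_)
  · rintro τ ⟨-, -, -, -, -, -, hr, -⟩
    simp [Test.Holds, Expr.eval, hr, encode]
  · rintro w l τ ⟨hB, hO, hP, e0, e1, e3, hr, hf, hout⟩
    refine ⟨by simpa [Test.Holds, Expr.eval, hr] using encode_cons_pos hf, ?_⟩
    have hw := hf.head
    have hw' := abs_lt.1 hw
    have hO0 : 0 < O := by linarith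
    rw [abs_of_pos hO0] at hOW
    have hrW : |encode O l| < 2 ^ W := by
      rw [abs_of_nonneg (encode_nonneg hf.tail)]
      refine (encode_tail_le hf).trans_lt ?_
      rw [← hr]
      exact (le_abs_self _).trans_lt (hB _)
    refine Program.Runs.mono (n := 1 + (1 + (1 + ((1 + ((5 * m + 3) + (1 + 1))) + 1)))) ?_
      (by omega) fun _ h => h
    refine .assign_seq hB (z := w) ?_ (hw.trans hOW) fun hB₁ => ?_
    · simp [Expr.eval, baseExpr, hr, hO, encode_cons_emod hf]
    refine .assign_seq hB₁ (z := encode O l) ?_ hrW fun hB₂ => ?_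
    · simp [Expr.eval, baseExpr, hr, hO, encode_cons_ediv hf]
    obtain ⟨a, ha⟩ : ∃ a, (w + 1) / 8 = a := ⟨_, rfl⟩
    refine .assign_seq hB₂ (z := a) (by simp [Expr.eval, ha]) ?_ fun hB₃ => ?_
    · rw [abs_lt]
      constructor <;> omega
    -- An entry whose quotient is not d can be dropped, because (8 d + 2) / 8 = d shows that it is
    -- not 8 d + 1.
    have hskip : ∀ υ : Store G, υ.Bdd W → υ.int (rOff s) = O → υ.int (rPow s) = 2 ^ m →
        υ.grp 0 = g → υ.grp 1 = g ^ d → υ.grp 3 = 1 → υ.int (rRest s) = encode O l →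
        υ.int (rOut s) = τ.int (rOut s) → a ≠ d →
        (υ.Bdd W ∧ υ.int (rOff s) = O ∧ υ.int (rPow s) = 2 ^ m ∧
        υ.grp 0 = g ∧ υ.grp 1 = g ^ d ∧ υ.grp 3 = 1 ∧ υ.int (rRest s) = encode O l ∧ Fits O l ∧
        (υ.int (rOut s) = d ∨ υ.int (rOut s) = 0 ∧
          (8 * (d : ℤ) + 1 ∈ Z → 8 * (d : ℤ) + 1 ∈ l))) := by
      intro υ b1 b2 b3 b4 b5 b6 b7 b8 had
      refine ⟨b1, b2, b3, b4, b5, b6, b7, hf.tail, ?_⟩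
      rw [b8]
      refine hout.imp_right fun hout => ⟨hout.1, fun hZ => ?_⟩
      rcases List.mem_cons.1 (hout.2 hZ) with hwd | hmem
      · omega
      · exact hmem
    refine .ite hB₃ (fun hc => ?_) fun hc => ?_
    · have ha' : 0 < a ∧ a < 2 ^ m := by simpa [Test.Holds, Expr.eval, hP] using hc
      obtain ⟨t, rfl⟩ := Int.eq_ofNat_of_zero_le ha'.1.le
      have htm : t < 2 ^ m := by exact_mod_cast ha'.2
      have htW : |(t : ℤ)| < 2 ^ W := by
        rw [Nat.abs_cast]; exact ha'.2.trans hmW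
      refine .assign_seq hB₃ (z := t) (by simp [Expr.eval]) htW fun hB₄ => ?_
      refine .seq (Program.Runs.mono (powerProg_runs (t := t) (k := m) hB₄ (by simpa using e3)
        (by simp) htm) le_rfl ?_)
      rintro υ ⟨hBυ, hag, f0, f1, f3, f2⟩
      have hiff : υ.grp 2 = υ.grp 1 ↔ t = d := by
        simp only [Store.set_grp, e0, e1] at f1 f2
        rw [f1, f2]
        refine ⟨fun heq => ?_, fun heq => by rw [heq]⟩
        have : (t : ℤ) = d := zpow_injOn_of_lt hg (by
          have h4 : (2 ^ m : ℤ) ≤ Fintype.card G := by exact_mod_cast hcard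
          have h5 : (t : ℤ) < 2 ^ m := ha'.2
          have h6 : (d : ℤ) < 2 ^ m := by exact_mod_cast hdm
          rw [abs_lt]; constructor <;> omega) (by simpa using heq)
        exact_mod_cast this
      refine .ite hBυ (fun hc => ?_) fun hc => .skip ?_
      · have htd : t = d := hiff.1 hc
        refine .assign_eq hBυ (z := d) ?_ ⟨hBυ.set hdW, ?_, ?_, ?_, ?_, ?_, ?_, hf.tail,
          Or.inl (by simp)⟩
        · simp [Expr.eval, hag, htd]
        · simpa [hag] using hO
        · simpa [hag] using hP
        · simpa [f0] using e0
        · simpa [f1] using e1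
        · simpa using f3
        · simp [hag]
      · refine hskip _ hBυ ?_ ?_ ?_ ?_ f3 ?_ ?_ fun had => hc (hiff.2 (by exact_mod_cast had))
        · simpa [hag] using hO
        · simpa [hag] using hP
        · simpa [f0] using e0
        · simpa [f1] using e1
        · simp [hag]
        · simp [hag]
    · refine (Program.Runs.skip ?_).mono (by omega : 1 ≤ _) fun _ h => h
      refine hskip _ hB₃ (by simpa using hO) (by simpa using hP) e0 e1 e3 (by simp) (by simp)
        fun had => hc ?_
      have : (d : ℤ) < 2 ^ m := by exact_mod_cast hdm
      simp [Test.Holds, Expr.eval, hP, had, hd, this]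
  · refine ⟨hσ₂, by simpa using h.off, by simpa using h.pow, h0, h1, h3, by simp, hfit, ?_⟩
    exact Or.inr ⟨by simp, fun hZ => hZ⟩
  · rintro τ ⟨hB, -, -, -, -, -, -, -, hout⟩
    refine .assign_eq hB rfl ⟨?_, fun hZ => ?_⟩
    · simp only [Store.set_int, if_true, Expr.eval]
      exact hout.imp_right fun h => h.1
    · simp only [Store.set_int, if_true, Expr.eval]
      rcases hout with hout | hout
      · exact hout
      · exact absurd (hout.2 hZ) (by simp)

end Check


/-! ### The initialization of the registers -/

/-- Store the power of two with exponent `e` in register `r`. -/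
def twoPowProg (s r : ℕ) (e : Expr) : Program :=
  .seq (.assign r (.const 1)) <|
  .seq (.assign (rCount s) e) <|
  .while (.lt (.const 0) (.reg (rCount s))) <|
    .seq (.assign r (.mul (.reg r) (.const 2))) <|
    .assign (rCount s) (.sub (.reg (rCount s)) (.const 1))

def Expr.pow (e : Expr) : ℕ → Expr
  | 0 => .const 1
  | n + 1 => .mul (e.pow n) e

theorem Expr.eval_pow (σ : ℕ → ℤ) (e : Expr) (n : ℕ) : (e.pow n).eval σ = e.eval σ ^ n := by
  induction n with
  | zero => simp [Expr.pow, Expr.eval]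
  | succ n ih => rw [Expr.pow, Expr.eval, ih, pow_succ]

/-- The parameter `κ` up to which the tuples are balanced. -/
def balanceExpr (κ₀ : ℕ) : Expr := .mul (.const κ₀) (.add (.reg 1) (.const 1))

/-- A quarter of the size of the boxes at level zero. -/
def boxScale (s c κ : ℕ) : ℕ := 2 ^ (s * c) + coveringBound s κ

def boxScaleExpr (s c κ₀ : ℕ) : Expr :=
  .add (.const ((2 ^ (s * c) : ℕ) : ℤ)) (.mul (.const (s + 1 : ℕ)) (.mul (.const 2)
    ((Expr.mul (.const 3) (.mul (.const (s + 1 : ℕ)) (balanceExpr κ₀))).pow s)))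

def boxBoundExpr (s κ₀ : ℕ) : Expr :=
  .mul (.mul (.const 3) (.add (.mul (.const 2) (.mul (balanceExpr κ₀)
      (.mul (.reg (rA s)) (.const ((2 ^ s : ℕ) : ℤ))))) (.const 1)))
    ((Expr.add (.mul (.const 2) (.mul (balanceExpr κ₀) (.reg (rA s)))) (.const 1)).pow s)

/-- The offset of the encoding of lists, which exceeds all entries of lists. -/
def offset (s c κ ℓ m : ℕ) : ℕ := 16 * 2 ^ s * 2 ^ (s * c) * (4 * boxScale s c κ * 2 ^ (ℓ + m))

def setupProg (s c κ₀ : ℕ) : Program :=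
  .seq (twoPowProg s (rN s) (.add (.reg 0) (.reg 1))) <|
  .seq (twoPowProg s (rPow s) (.reg 1)) <|
  .seq (.assign (rA s) (.mul (.const 4) (boxScaleExpr s c κ₀))) <|
  .seq (.assign (rE s) (.mul (.reg (rA s)) (.reg (rN s)))) <|
  .seq (.assign (rOff s) (.mul (.const ((16 * 2 ^ s * 2 ^ (s * c) : ℕ) : ℤ)) (.reg (rE s)))) <|
  .assign (rMax s) (boxBoundExpr s κ₀)

/-- The registers that `setupProg` modifies. -/
def setupRegs (s : ℕ) : List ℕ := [rN s, rPow s, rA s, rE s, rOff s, rMax s, rCount s]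

section Setup

variable {G : Type*} [Group G] {W s ℓ m : ℕ}

/-- The exponent is evaluated after the target register has been reset, so its value must not depend
on that register. -/
theorem twoPowProg_runs {σ : Store G} (hσ : σ.Bdd W) {r k : ℕ} {e : Expr} (hr : r ≠ rCount s)
    (he : ∀ z, e.eval (σ.set r z).int = k) (hk : (2 ^ k : ℤ) < 2 ^ W) :
    (twoPowProg s r e).Runs W σ (3 * k + 3) fun σ' =>
      σ'.Bdd W ∧ σ.Agree [r, rCount s] σ' ∧ σ'.int r = 2 ^ k := by
  have hpow : ∀ i ≤ k, (2 ^ i : ℤ) < 2 ^ W := fun i hi =>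
    (pow_le_pow_right₀ (by norm_num) hi).trans_lt hk
  have hcount : ∀ i ≤ k, |(i : ℤ)| < 2 ^ W := fun i hi => by
    rw [Nat.abs_cast]
    exact lt_trans (by exact_mod_cast Nat.lt_two_pow_self) (hpow i hi)
  refine Program.Runs.mono (n := 1 + (1 + (k * ((1 + 1) + 1) + 1))) ?_ (by omega) fun _ h => h
  refine .assign_seq hσ (z := 1) rfl (by simpa using hpow 0 (Nat.zero_le _)) fun hσ₁ => ?_
  refine .assign_seq hσ₁ (z := k) (he 1) (hcount k le_rfl) fun hσ₂ => ?_
  refine Program.Runs.mono (Program.Runs.while_nat (n := 1 + 1)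
    (fun (i : ℕ) (τ : Store G) => τ.Bdd W ∧ σ.Agree [r, rCount s] τ ∧ i ≤ k ∧
      τ.int (rCount s) = i ∧ τ.int r = 2 ^ (k - i)) (fun i τ hI => hI.1) ?_ ?_ k _ ?_) le_rfl ?_
  · rintro τ ⟨-, -, -, hc, -⟩
    simp [Test.Holds, Expr.eval, hc]
  · rintro i τ ⟨hB, hAg, hi, hc, hτ⟩
    refine ⟨by simp only [Test.Holds, Expr.eval, hc]; positivity, ?_⟩
    refine .assign_seq hB (z := 2 ^ (k - i)) ?_ ?_ fun hB₁ => ?_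
    · rw [Expr.eval, Expr.eval, Expr.eval, hτ, ← pow_succ]
      congr 1
      omega
    · rw [abs_of_nonneg (by positivity)]
      exact hpow _ (Nat.sub_le _ _)
    · refine .assign_eq hB₁ (z := i) (by simp [Expr.eval, hr.symm, hc])
        ⟨hB₁.set (hcount i (by omega)), (hAg.set (by simp) _).set (by simp) _, by omega, by simp, by simp [hr]⟩
  · exact ⟨hσ₂, ((Store.Agree.refl _ σ).set (by simp) _).set (by simp) _, le_rfl, by simp,
      by simp [hr]⟩
  · rintro τ ⟨hB, hAg, -, -, hτ⟩
    exact ⟨hB, hAg, hτ⟩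

theorem boxScale_pos (s c κ : ℕ) : 0 < boxScale s c κ :=
  Nat.add_pos_left (Nat.two_pow_pos _) _

theorem setupProg_runs {σ : Store G} {c κ₀ κ : ℕ} (hσ : σ.Bdd W) (h0 : σ.int 0 = ℓ)
    (h1 : σ.int 1 = m) (hκ : κ = κ₀ * (m + 1))
    (hO : (offset s c κ ℓ m : ℤ) < 2 ^ W)
    (hn : (boxBound s κ (4 * boxScale s c κ) : ℤ) < 2 ^ W) :
    (setupProg s c κ₀).Runs W σ (3 * ℓ + 6 * m + 10) fun σ' =>
      σ'.Bdd W ∧ σ.Agree (setupRegs s) σ' ∧ σ'.int (rN s) = ((2 ^ (ℓ + m) : ℕ) : ℤ) ∧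
        σ'.int (rPow s) = 2 ^ m ∧ σ'.int (rA s) = ((4 * boxScale s c κ : ℕ) : ℤ) ∧
        σ'.int (rE s) = ((4 * boxScale s c κ : ℕ) : ℤ) * ((2 ^ (ℓ + m) : ℕ) : ℤ) ∧
        σ'.int (rOff s) = offset s c κ ℓ m ∧
        σ'.int (rMax s) = boxBound s κ (4 * boxScale s c κ) := by
  set M := 4 * boxScale s c κ with hM
  set N := 2 ^ (ℓ + m) with hN
  have hMpos : 0 < M := Nat.mul_pos (by norm_num) (boxScale_pos s c κ)
  have hNpos : 0 < N := Nat.two_pow_pos _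
  have hE : M * N ≤ offset s c κ ℓ m := Nat.le_mul_of_pos_left _ (by positivity)
  have habs : ∀ {k : ℕ}, k ≤ offset s c κ ℓ m → |(k : ℤ)| < 2 ^ W := fun hk => by
    rw [Nat.abs_cast]
    exact lt_of_le_of_lt (by exact_mod_cast hk) hO
  have hNO : N ≤ offset s c κ ℓ m := (Nat.le_mul_of_pos_left _ hMpos).trans hE
  have hMO : M ≤ offset s c κ ℓ m := (Nat.le_mul_of_pos_right _ hNpos).trans hE
  have hNW : (2 ^ (ℓ + m) : ℤ) < 2 ^ W := by
    have := habs hNO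
    rw [Nat.abs_cast] at this
    exact_mod_cast this
  have hne : ∀ {i : ℕ}, i < 2 → ∀ k, i ≠ workReg s k := fun hi k => lt_workReg (by omega) k
  have hne0 : ∀ k, 0 ≠ workReg s k := hne (by norm_num)
  have hne1 : ∀ k, 1 ≠ workReg s k := hne (by norm_num)
  refine Program.Runs.mono (n := (3 * (ℓ + m) + 3) + ((3 * m + 3) + (1 + (1 + (1 + 1))))) ?_
    (by omega) fun _ h => h
  refine .seq (Program.Runs.mono (twoPowProg_runs (k := ℓ + m) hσ (by simp) ?_ hNW) le_rfl ?_)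
  · intro z
    simp [Expr.eval, hne0, hne1, h0, h1]
  rintro σ₁ ⟨hσ₁, hAg₁, hrN⟩
  have h1' : σ₁.int 1 = m := (hAg₁.1 _ (by simp [hne1])).trans h1
  refine .seq (Program.Runs.mono (twoPowProg_runs (k := m) hσ₁ (by simp) ?_ ?_) le_rfl ?_)
  · intro z
    simp [Expr.eval, hne1, h1']
  · exact lt_of_le_of_lt (pow_le_pow_right₀ (by norm_num) (Nat.le_add_left _ _)) hNW
  rintro σ₂ ⟨hσ₂, hAg₂, hrPow⟩
  have h1'' : σ₂.int 1 = m := (hAg₂.1 _ (by simp [hne1])).trans h1'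
  have hrN' : σ₂.int (rN s) = N := by
    rw [hAg₂.1 _ (by simp), hrN, hN]; push_cast; rfl
  have hbal : ∀ τ : ℕ → ℤ, τ 1 = m → (balanceExpr κ₀).eval τ = κ := fun τ hτ => by
    simp [balanceExpr, Expr.eval, hτ, hκ]
  have hAg : σ.Agree (setupRegs s) σ₂ :=
    ((Store.Agree.refl _ σ).trans hAg₁ (by simp [setupRegs])).trans hAg₂ (by simp [setupRegs])
  refine .assign_seq hσ₂ (z := M) ?_ (habs hMO) fun hσ₃ => ?_
  · simp only [boxScaleExpr, Expr.eval, Expr.eval_pow, hbal _ h1'', hM, boxScale, coveringBound]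
    push_cast
    ring
  refine .assign_seq hσ₃ (z := M * N) ?_ ?_ fun hσ₄ => ?_
  · simp [Expr.eval, hrN']
  · have := habs hE
    push_cast at this
    exact this
  refine .assign_seq hσ₄ (z := offset s c κ ℓ m) ?_ (habs le_rfl) fun hσ₅ => ?_
  · simp only [Expr.eval, Store.set_int, if_true, offset, hM, hN]
    push_cast
    ring
  refine .assign_eq hσ₅ (z := boxBound s κ M) ?_ ⟨hσ₅.set ?_, ?_, ?_, ?_, ?_, ?_, ?_, ?_⟩
  · simp only [boxBoundExpr, Expr.eval, Expr.eval_pow]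
    rw [hbal _ (by simpa [hne1] using h1'')]
    simp [boxBound]
  · rw [Nat.abs_cast]; exact hn
  · exact (((hAg.set (by simp [setupRegs]) _).set (by simp [setupRegs]) _).set
      (by simp [setupRegs]) _).set (by simp [setupRegs]) _
  · simpa using hrN'
  · simpa using hrPow
  · simp
  · simp
  · simp
  · simp

end Setup

section Input

variable {G : Type*} [Group G] {s ℓ m : ℕ} {g x : G} {f : Fin s → ℕ × ℕ}

theorem inputStore_fst (i : Fin s) :
    (inputStore ℓ m g x f).int (2 * i.val + 2) = (f i).1 := by
  have h : (2 * i.val + 2 - 2) / 2 = i.val := by omega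
  simp only [inputStore]
  rw [if_neg (by omega), if_neg (by omega), dif_pos (by rw [h]; exact i.2), if_pos (by omega)]
  congr 3
  exact Fin.ext h

theorem inputStore_snd (i : Fin s) :
    (inputStore ℓ m g x f).int (2 * i.val + 3) = (f i).2 := by
  have h : (2 * i.val + 3 - 2) / 2 = i.val := by omega
  simp only [inputStore]
  rw [if_neg (by omega), if_neg (by omega), dif_pos (by rw [h]; exact i.2), if_neg (by omega)]
  congr 3
  exact Fin.ext h

theorem inputStore_bdd {W : ℕ} (hW : (2 ^ (ℓ + m) : ℤ) < 2 ^ W)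
    (hf : ∀ i, (f i).1 < 2 ^ (ℓ + m) ∧ (f i).2 < 2 ^ ℓ) : (inputStore ℓ m g x f).Bdd W := by
  have key : ∀ k : ℕ, k < 2 ^ (ℓ + m) → |(k : ℤ)| < 2 ^ W := fun k hk => by
    rw [Nat.abs_cast]
    exact lt_trans (by exact_mod_cast hk) hW
  have hle : 2 ^ ℓ ≤ 2 ^ (ℓ + m) := Nat.pow_le_pow_right (by norm_num) (Nat.le_add_right _ _)
  intro n
  simp only [inputStore]
  split_ifs with h1 h2 h3 h4
  · exact key _ ((Nat.lt_two_pow_self).trans_le hle)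
  · exact key _ ((Nat.lt_two_pow_self).trans_le
      (Nat.pow_le_pow_right (by norm_num) (Nat.le_add_left _ _)))
  · exact key _ (hf _).1
  · exact key _ ((hf _).2.trans_le hle)
  · simp

end Input


/-! ### The classical algorithm -/

/-- List all integers `8 a + q` in a box that contains `8 d + 1`, and test the `a`. -/
def recoverProg (s c κ₀ : ℕ) : Program :=
  .seq (setupProg s c κ₀) <| .seq (initProg s) <| .seq (levelsProg s) (checkProg s)

/-- The maximal length of lists. -/
def listBound (s c κ : ℕ) : ℕ := boxBound s κ (4 * boxScale s c κ)

/-- The length in bits of the integers in `recoverProg`. -/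
def wordLength (s c κ m : ℕ) : ℕ :=
  (7 + boxScale s c κ + s + s * c + (2 * m + c)) * listBound s c κ

/-- The number of elementary steps of `recoverProg`. -/
def stepBound (s c κ ℓ m : ℕ) : ℕ :=
  (3 * ℓ + 6 * m + 10) + (((16 * (4 * boxScale s c κ) + 3) * (4 * listBound s c κ + 8) + 5) +
    ((ℓ * (4 * 2 ^ s * (20 * (listBound s c κ + 1) ^ 3 + 3) + 6) + 2) +
      (listBound s c κ * (5 * m + 11) + 4)))

section Recover

variable {G : Type*} [Group G] {s c κ κ₀ ℓ m d : ℕ}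

theorem le_add_of_mul_le (hs : 1 ≤ s) (h : s * ℓ ≤ m + s * c) : ℓ ≤ m + c := by
  rcases le_total ℓ c with h' | h'
  · omega
  · obtain ⟨e, rfl⟩ := Nat.exists_eq_add_of_le h'
    have h1 : e ≤ s * e := Nat.le_mul_of_pos_left _ hs
    rw [mul_add] at h
    omega

theorem listBound_pos (s c κ : ℕ) : 0 < listBound s c κ := by
  unfold listBound boxBound
  positivity

/-- A list of maximal length has a code below (2 O)^n. The first factor of the word length bounds
the bits of 2 O; the second is the number of entries. -/
theorem offset_pow_lt (hℓ : ℓ ≤ m + c) :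
    (2 * offset s c κ ℓ m) ^ listBound s c κ < 2 ^ wordLength s c κ m := by
  rw [wordLength, pow_mul]
  refine Nat.pow_lt_pow_left ?_ (listBound_pos s c κ).ne'
  have h1 : boxScale s c κ < 2 ^ boxScale s c κ := Nat.lt_two_pow_self
  have h2 : 2 * offset s c κ ℓ m = 2 ^ 7 * 2 ^ s * 2 ^ (s * c) * 2 ^ (ℓ + m) * boxScale s c κ := by
    rw [offset]; ring
  have h3 : 2 ^ (ℓ + m) ≤ 2 ^ (2 * m + c) := Nat.pow_le_pow_right (by norm_num) (by omega)
  calc 2 * offset s c κ ℓ m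
      = 2 ^ 7 * 2 ^ s * 2 ^ (s * c) * 2 ^ (ℓ + m) * boxScale s c κ := h2
    _ < 2 ^ 7 * 2 ^ s * 2 ^ (s * c) * 2 ^ (ℓ + m) * 2 ^ boxScale s c κ :=
        Nat.mul_lt_mul_of_pos_left h1 (by positivity)
    _ ≤ 2 ^ 7 * 2 ^ s * 2 ^ (s * c) * 2 ^ (2 * m + c) * 2 ^ boxScale s c κ := by gcongr
    _ = 2 ^ (7 + boxScale s c κ + s + s * c + (2 * m + c)) := by simp only [pow_add]; ring

/-- Goodness is the box condition for a = d and q = 1, with room to spare in the distances. -/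
theorem inBox_of_goodPair {N M' : ℕ} {f : Fin s → ℕ × ℕ} (hN : N = 2 ^ (ℓ + m))
    (hdA : d ≤ M' * 2 ^ (s * ℓ)) (hM' : 0 < M') (hf : ∀ i, GoodPair ℓ m d (f i)) :
    InBox m N f (4 * M' * 2 ^ (s * ℓ)) (4 * M' * 2 ^ m) (8 * d + 1) := by
  refine ⟨d, 1, rfl, by simp, ?_, fun i => ?_⟩
  · rw [Nat.abs_cast]
    have h1 : (d : ℤ) ≤ M' * 2 ^ (s * ℓ) := by exact_mod_cast hdA
    have h2 : (0 : ℤ) ≤ M' * 2 ^ (s * ℓ) := by positivity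
    linarith
  · obtain ⟨z, hz⟩ := hf i
    refine ⟨z, ?_⟩
    rw [hN, one_mul]
    push_cast
    have h1 : (1 : ℤ) ≤ M' := by exact_mod_cast hM'
    have h2 : (2 ^ m : ℤ) ≤ M' * 2 ^ m := le_mul_of_one_le_left (by positivity) h1
    have h3 := abs_nonneg (d * (f i).1 + 2 ^ m * (f i).2 - z * 2 ^ (ℓ + m) : ℤ)
    linarith

/-- The summand 2^(s c) of `boxScale` ensures that the final box reaches up to d, since d < 2^m ≤
2^(s c) 2^(s ℓ). The other summand is the covering bound, which is needed for splitting points into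
sums. -/
theorem recoverProg_runs [Fintype G] {g : G} (hg : ∀ y : G, y ∈ Subgroup.zpowers g) (hs : 1 ≤ s)
    (hd : 0 < d) (hdm : d < 2 ^ m) (hcard : 2 ^ m ≤ Fintype.card G)
    (hℓm : s * ℓ ≤ m + s * c) (hmℓ : m ≤ s * ℓ + s * c) (hκ₀ : 0 < κ₀) (hκ : κ = κ₀ * (m + 1))
    {f : Fin s → ℕ × ℕ} (hf : ∀ i, (f i).1 < 2 ^ (ℓ + m) ∧ (f i).2 < 2 ^ ℓ) :
    (recoverProg s c κ₀).Runs (wordLength s c κ m) (inputStore ℓ m g (g ^ d) f)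
      (stepBound s c κ ℓ m) fun σ => (σ.int 0 = d ∨ σ.int 0 = 0) ∧
        ((∀ i, GoodPair ℓ m d (f i)) → Balanced ℓ (2 ^ (ℓ + m)) κ (fun i => (f i).1) →
          σ.int 0 = d) := by
  obtain ⟨W, hWdef⟩ : ∃ W, wordLength s c κ m = W := ⟨_, rfl⟩
  obtain ⟨n, hndef⟩ : ∃ n, listBound s c κ = n := ⟨_, rfl⟩
  obtain ⟨O, hOdef⟩ : ∃ O, offset s c κ ℓ m = O := ⟨_, rfl⟩
  obtain ⟨M', hMdef⟩ : ∃ M', boxScale s c κ = M' := ⟨_, rfl⟩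
  have hn : 0 < n := hndef ▸ listBound_pos s c κ
  have hM' : 0 < M' := hMdef ▸ boxScale_pos s c κ
  have hℓ := le_add_of_mul_le hs hℓm
  have hκpos : 0 < κ := hκ ▸ Nat.mul_pos hκ₀ (Nat.succ_pos m)
  have hWpow : (2 * (O : ℤ)) ^ n < 2 ^ W := by
    have := offset_pow_lt (s := s) (κ := κ) hℓ
    rw [hOdef, hndef, hWdef] at this
    exact_mod_cast this
  have hnW : n ≤ W := by
    rw [← hWdef, wordLength, hndef]
    exact Nat.le_mul_of_pos_left _ (by omega)
  have hWn : (n : ℤ) < 2 ^ W := by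
    exact_mod_cast (Nat.lt_two_pow_self (n := n)).trans_le (Nat.pow_le_pow_right (by norm_num) hnW)
  have hOeq : O = 64 * (2 ^ s * (2 ^ (s * c) * (M' * 2 ^ (ℓ + m)))) := by
    rw [← hOdef, offset, hMdef]; ring
  have hbase : M' * 2 ^ (ℓ + m) ≤ 2 ^ s * (2 ^ (s * c) * (M' * 2 ^ (ℓ + m))) :=
    (Nat.le_mul_of_pos_left _ (Nat.two_pow_pos _)).trans
      (Nat.le_mul_of_pos_left _ (Nat.two_pow_pos _))
  have hpos : 0 < M' * 2 ^ (ℓ + m) := by positivity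
  have hNle : 2 ^ (ℓ + m) ≤ M' * 2 ^ (ℓ + m) := Nat.le_mul_of_pos_left _ hM'
  have hOW : (O : ℤ) < 2 ^ W := by
    have h1 : (1 : ℤ) ≤ O := by exact_mod_cast (by omega : 1 ≤ O)
    have := lt_of_le_of_lt (le_self_pow₀ (by linarith : (1 : ℤ) ≤ 2 * O) hn.ne') hWpow
    linarith
  have hNO : 2 ^ (ℓ + m) < O := by omega
  have hEO : 4 * M' * 2 ^ (ℓ + m) < O := by
    rw [mul_assoc]; omega
  -- The offset exceeds the codes of all points of the largest box because s ℓ ≤ m + s c.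
  have hAO : 8 * (4 * M' * 2 ^ s * 2 ^ (s * ℓ)) + 1 < O := by
    have h1 : 2 ^ (s * ℓ) ≤ 2 ^ (s * c) * 2 ^ (ℓ + m) := by
      rw [← pow_add]
      exact Nat.pow_le_pow_right (by norm_num) (by omega)
    have h2 : 2 ^ s * M' * 2 ^ (s * ℓ) ≤ 2 ^ s * M' * (2 ^ (s * c) * 2 ^ (ℓ + m)) :=
      Nat.mul_le_mul_left _ h1
    have h3 : 2 ^ s * M' * (2 ^ (s * c) * 2 ^ (ℓ + m)) =
      2 ^ s * (2 ^ (s * c) * (M' * 2 ^ (ℓ + m))) := by ring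
    have h4 : 8 * (4 * M' * 2 ^ s * 2 ^ (s * ℓ)) = 32 * (2 ^ s * M' * 2 ^ (s * ℓ)) := by ring
    omega
  have hsO : 4 * 2 ^ s < O := by
    have h1 : 2 ^ s ≤ 2 ^ s * (2 ^ (s * c) * (M' * 2 ^ (ℓ + m))) :=
      Nat.le_mul_of_pos_right _ (by positivity)
    have h2 : 0 < 2 ^ s := Nat.two_pow_pos s
    omega
  have hℓO : ℓ < O := lt_trans (Nat.lt_two_pow_self.trans_le
    (Nat.pow_le_pow_right (by norm_num) (Nat.le_add_right ℓ m))) hNO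
  have hMO : 8 * (4 * M') + 1 < O := by
    refine lt_of_le_of_lt ?_ hAO
    have : 4 * M' ≤ 4 * M' * 2 ^ s * 2 ^ (s * ℓ) :=
      (Nat.le_mul_of_pos_right _ (Nat.two_pow_pos _)).trans
        (Nat.le_mul_of_pos_right _ (Nat.two_pow_pos _))
    omega
  have hN : 0 < 2 ^ (ℓ + m) := Nat.two_pow_pos _
  have hB : (inputStore ℓ m g (g ^ d) f).Bdd W :=
    inputStore_bdd (lt_trans (by exact_mod_cast hNO) hOW) hf
  rw [stepBound, hndef, hMdef, hWdef]
  set σ₀ := inputStore ℓ m g (g ^ d) f with hσ₀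
  refine .seq (Program.Runs.mono (setupProg_runs (s := s) (c := c) (ℓ := ℓ) (m := m) hB rfl rfl hκ
    (hOdef ▸ hOW) (by rw [← listBound, hndef]; exact hWn)) le_rfl ?_)
  rintro σ₁ ⟨hB₁, hAg₁, hrN, hrPow, hrA, hrE, hrOff, hrMax⟩
  rw [hMdef] at hrA hrE
  rw [hOdef] at hrOff
  rw [← listBound, hndef] at hrMax
  have hkeep : ∀ i < 2 * s + 2, σ₁.int i = σ₀.int i := fun i hi =>
    hAg₁.1 i (by simp [setupRegs, lt_workReg hi])
  have hctx : Ctx ℓ m (2 ^ (ℓ + m)) n O f σ₁ :=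
    ⟨hkeep 0 (by omega), hkeep 1 (by omega),
      fun i => (hkeep _ (by omega)).trans (inputStore_fst i),
      fun i => (hkeep _ (by omega)).trans (inputStore_snd i), hrN, hrPow, hrOff, hrMax⟩
  refine .seq (Program.Runs.mono (initProg_runs hB₁ hN hn hctx hWpow hWn hrA hrE
    (by exact_mod_cast hMO)) le_rfl ?_)
  rintro σ₂ ⟨hB₂, hAg₂, hlist⟩
  have hctx₂ := hctx.of_agree (by simp [insertRegs, workReg]) hAg₂
  have hbox := holdsBox_init (ℓ := ℓ) (κ := κ) hN (by rw [← hndef, listBound, hMdef])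
    (by exact_mod_cast hMO) hlist
  push_cast at hbox hrA hrE
  refine .seq (Program.Runs.mono (levelsProg_runs (M' := M') hB₂ hn hctx₂ hWpow hWn hκpos
    (by rw [← hMdef]; exact Nat.le_add_left _ _) (by rw [← hndef, listBound, hMdef])
    (by exact_mod_cast hAO) (by exact_mod_cast hEO) (by exact_mod_cast hsO)
    (by exact_mod_cast hℓO) ((hAg₂.1 _ (by simp [insertRegs])).trans hrA)
    ((hAg₂.1 _ (by simp [insertRegs])).trans hrE) hbox) le_rfl ?_)
  rintro σ₃ ⟨hB₃, hAg₃, Z, hfit, hlen, henc, hmem⟩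
  have hctx₃ := hctx₂.of_agree (by simp [listRegs, workReg]) hAg₃
  have hgrp : σ₃.grp = σ₀.grp := hAg₃.2.trans (hAg₂.2.trans hAg₁.2)
  refine (checkProg_runs hg hd hdm hcard hB₃ hctx₃ (by rw [hgrp]; rfl) (by rw [hgrp]; rfl)
    (by rw [hgrp]; rfl) hfit hlen henc).mono le_rfl ?_
  rintro σ₄ ⟨hout, hfound⟩
  refine ⟨hout, fun hgood hbal => hfound (hmem hbal _ (inBox_of_goodPair rfl ?_ hM' hgood))⟩
  calc d ≤ 2 ^ m := hdm.le
    _ ≤ 2 ^ (s * c) * 2 ^ (s * ℓ) := by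
        rw [← pow_add]; exact Nat.pow_le_pow_right (by norm_num) (by omega)
    _ ≤ M' * 2 ^ (s * ℓ) := Nat.mul_le_mul_right _ (by rw [← hMdef]; exact Nat.le_add_right _ _)

end Recover

/-! ### Polynomial running time -/

/-- The functions given by polynomials. -/
def IsPoly (F : ℕ → ℕ) : Prop := ∃ p : Polynomial ℕ, ∀ m, p.eval m = F m

theorem IsPoly.const (a : ℕ) : IsPoly fun _ => a := ⟨.C a, by simp⟩

theorem IsPoly.id : IsPoly fun m => m := ⟨.X, by simp⟩

theorem IsPoly.add {F F' : ℕ → ℕ} (h : IsPoly F) (h' : IsPoly F') : IsPoly fun m => F m + F' m := by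
  obtain ⟨p, hp⟩ := h
  obtain ⟨p', hp'⟩ := h'
  exact ⟨p + p', by simp [hp, hp']⟩

theorem IsPoly.mul {F F' : ℕ → ℕ} (h : IsPoly F) (h' : IsPoly F') : IsPoly fun m => F m * F' m := by
  obtain ⟨p, hp⟩ := h
  obtain ⟨p', hp'⟩ := h'
  exact ⟨p * p', by simp [hp, hp']⟩

theorem IsPoly.pow {F : ℕ → ℕ} (h : IsPoly F) (n : ℕ) : IsPoly fun m => F m ^ n := by
  obtain ⟨p, hp⟩ := h
  exact ⟨p ^ n, by simp [hp]⟩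

section Poly

variable {s c : ℕ} {κ : ℕ → ℕ}

theorem isPoly_boxScale (hκ : IsPoly κ) : IsPoly fun m => boxScale s c (κ m) :=
  (IsPoly.const _).add ((IsPoly.const _).mul ((IsPoly.const _).mul
    (((IsPoly.const _).mul ((IsPoly.const _).mul hκ)).pow s)))

theorem isPoly_listBound (hκ : IsPoly κ) : IsPoly fun m => listBound s c (κ m) := by
  have hM : IsPoly fun m => 4 * boxScale s c (κ m) := (IsPoly.const _).mul (isPoly_boxScale hκ)
  exact ((IsPoly.const _).mul (((IsPoly.const _).mul (hκ.mul (hM.mul (IsPoly.const _)))).add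
    (IsPoly.const _))).mul ((((IsPoly.const _).mul (hκ.mul hM)).add (IsPoly.const _)).pow s)

theorem isPoly_wordLength (hκ : IsPoly κ) : IsPoly fun m => wordLength s c (κ m) m :=
  (((((IsPoly.const 7).add (isPoly_boxScale hκ)).add (IsPoly.const s)).add
    (IsPoly.const (s * c))).add (((IsPoly.const 2).mul IsPoly.id).add (IsPoly.const c))).mul
      (isPoly_listBound hκ)

theorem isPoly_stepBound (hκ : IsPoly κ) : IsPoly fun m => stepBound s c (κ m) (m + c) m := by
  have hn : IsPoly fun m => listBound s c (κ m) := isPoly_listBound hκ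
  have hM : IsPoly fun m => boxScale s c (κ m) := isPoly_boxScale hκ
  have hℓ : IsPoly fun m => m + c := IsPoly.id.add (IsPoly.const c)
  have h₁ : IsPoly fun m => 3 * (m + c) + 6 * m + 10 :=
    (((IsPoly.const 3).mul hℓ).add ((IsPoly.const 6).mul IsPoly.id)).add (IsPoly.const 10)
  have h₂ : IsPoly fun m =>
      (16 * (4 * boxScale s c (κ m)) + 3) * (4 * listBound s c (κ m) + 8) + 5 :=
    ((((IsPoly.const 16).mul ((IsPoly.const 4).mul hM)).add (IsPoly.const 3)).mul
      (((IsPoly.const 4).mul hn).add (IsPoly.const 8))).add (IsPoly.const 5)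
  have h₃ : IsPoly fun m =>
      (m + c) * (4 * 2 ^ s * (20 * (listBound s c (κ m) + 1) ^ 3 + 3) + 6) + 2 :=
    (hℓ.mul (((IsPoly.const (4 * 2 ^ s)).mul (((IsPoly.const 20).mul
      ((hn.add (IsPoly.const 1)).pow 3)).add (IsPoly.const 3))).add (IsPoly.const 6))).add
        (IsPoly.const 2)
  have h₄ : IsPoly fun m => listBound s c (κ m) * (5 * m + 11) + 4 :=
    (hn.mul (((IsPoly.const 5).mul IsPoly.id).add (IsPoly.const 11))).add (IsPoly.const 4)
  exact h₁.add (h₂.add (h₃.add h₄))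

end Poly

/-- The program recovers `d` from good pairs that are balanced, in polynomial time, and never
outputs anything wrong. -/
theorem exists_polynomial_recoverProg {s c κ₀ : ℕ} (hs : 1 ≤ s) (hκ₀ : 0 < κ₀) :
    ∃ p : Polynomial ℕ, ∀ (m ℓ d : ℕ), 0 < d → d < 2 ^ m →
      |(ℓ : ℝ) - (m : ℝ) / (s : ℝ)| ≤ (c : ℝ) →
      ∀ (G : Type*) [Group G] [Fintype G] (g : G), (∀ y : G, y ∈ Subgroup.zpowers g) →
        2 ^ m ≤ Fintype.card G →
        ∀ f : Fin s → ℕ × ℕ, (∀ i, (f i).1 < 2 ^ (ℓ + m) ∧ (f i).2 < 2 ^ ℓ) →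
          ∃ out : ℤ, (recoverProg s c κ₀).OutputsWithin (p.eval m) ℓ m g (g ^ d) f out ∧
            (out = d ∨ out = 0) ∧
            ((∀ i, GoodPair ℓ m d (f i)) →
              Balanced ℓ (2 ^ (ℓ + m)) (κ₀ * (m + 1)) (fun i => (f i).1) → out = d) := by
  have hκ : IsPoly fun m => κ₀ * (m + 1) := (IsPoly.const κ₀).mul (IsPoly.id.add (IsPoly.const 1))
  obtain ⟨p, hp⟩ : IsPoly fun m => stepBound s c (κ₀ * (m + 1)) (m + c) m *
      ((recoverProg s c κ₀).weight * (wordLength s c (κ₀ * (m + 1)) m + 1)) ^ 2 :=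
    (isPoly_stepBound hκ).mul (((IsPoly.const _).mul
      ((isPoly_wordLength hκ).add (IsPoly.const 1))).pow 2)
  refine ⟨p, fun m ℓ d hd hdm hclose G _ _ g hg hcard f hf => ?_⟩
  obtain ⟨hℓm, hmℓ⟩ := le_of_abs_sub_div_le hs hclose
  obtain ⟨σ, T, hex, hT, hout, hfound⟩ :=
    recoverProg_runs hg hs hd hdm hcard hℓm hmℓ hκ₀ rfl hf
  refine ⟨σ.int 0, ⟨σ, T, hex, ?_, rfl⟩, hout, hfound⟩
  rw [hp]
  refine hT.trans (Nat.mul_le_mul_right _ ?_)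
  -- The step bound is increasing in ℓ, and ℓ ≤ m + c; this substitution makes it a polynomial in m
  -- alone.
  have hℓ := le_add_of_mul_le hs hℓm
  unfold stepBound
  gcongr

end ShortDLog

theorem theorem1 :
    -- the operations of the quantum algorithm
    (∃ K : ℕ, ∀ ℓ m : ℕ,
      (circuit ℓ m).exponentLengths .g = [ℓ + m] ∧
      (circuit ℓ m).exponentLengths .x = [ℓ] ∧
      (circuit ℓ m).elementaryCount ≤ K * (ℓ + m) ^ 2) ∧
    -- the recovery of `d` from the pairs yielded by `C * s` runs
    ∀ δ : ℝ, 0 < δ → ∃ C : ℕ, ∀ s : ℕ, 1 ≤ s → ∀ c : ℕ,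
      ∃ (P : Program) (p : Polynomial ℕ),
        ∀ (m ℓ d : ℕ), 0 < d → d < 2 ^ m → |(ℓ : ℝ) - (m : ℝ) / (s : ℝ)| ≤ (c : ℝ) →
        ∀ (G : Type*) [Group G] [Fintype G] (g : G), (∀ y : G, y ∈ Subgroup.zpowers g) →
          2 ^ (ℓ + m) + 2 ^ ℓ * d ≤ Fintype.card G →
          -- a run yields a pair according to a probability distribution
          (∑ w : Outcome ℓ m, (circuit ℓ m).prob g (g ^ d) w = 1) ∧
          -- on any `s` pairs the classical algorithm outputs `d` or `0` (failure) in time `p m`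
          (∀ f : Fin s → ℕ × ℕ, (∀ i, (f i).1 < 2 ^ (ℓ + m) ∧ (f i).2 < 2 ^ ℓ) →
            ∃ out : ℤ, P.OutputsWithin (p.eval m) ℓ m g (g ^ d) f out ∧
              (out = (d : ℤ) ∨ out = 0)) ∧
          -- with probability at least `1 - δ` it outputs `d` on some `s`-subset of the pairs
          1 - δ ≤ probOfRuns ((circuit ℓ m).prob g (g ^ d)) (C * s) fun ω =>
            ∃ I : Finset (Fin (C * s)), I.card = s ∧ ∀ e : Fin s ≃ I,
              P.OutputsWithin (p.eval m) ℓ m g (g ^ d) (fun i => (ω (e i)).pair) (d : ℤ) := by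
  refine ⟨⟨8, fun ℓ m => ⟨circuit_exponentLengths_g ℓ m, circuit_exponentLengths_x ℓ m,
    circuit_elementaryCount_le ℓ m⟩⟩, fun δ hδ => ?_⟩
  obtain ⟨C, hC⟩ := exists_runs_constant δ hδ
  refine ⟨C, fun s hs c => ?_⟩
  obtain ⟨κ₀, hκ₀, hprob⟩ := hC s hs c
  obtain ⟨p, hp⟩ := exists_polynomial_recoverProg (c := c) hs hκ₀
  refine ⟨recoverProg s c κ₀, p, fun m ℓ d hd hdm hclose G _ _ g hg hcard => ?_⟩
  have hcard' : 2 ^ (ℓ + m) ≤ Fintype.card G := (Nat.le_add_right _ _).trans hcard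
  have hcard'' : 2 ^ m ≤ Fintype.card G :=
    (Nat.pow_le_pow_right (by norm_num) (Nat.le_add_left m ℓ)).trans hcard'
  have hrec := hp m ℓ d hd hdm hclose G g hg hcard''
  refine ⟨sum_circuit_prob_eq_one hg hcard', fun f hf => ?_, ?_⟩
  · obtain ⟨out, hout, hor, -⟩ := hrec f hf
    exact ⟨out, hout, hor⟩
  · refine (hprob m ℓ d hdm hclose G g hg hcard).trans
      (probOfRuns_mono (fun w => circuit_prob_nonneg w) ?_)
    rintro ω ⟨I, hI, hgood⟩
    refine ⟨I, hI, fun e => ?_⟩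
    obtain ⟨hpair, hbal⟩ := hgood e
    obtain ⟨out, hout, -, hfound⟩ := hrec (fun i => (ω (e i)).pair)
      fun i => ⟨pair_fst_lt _, pair_snd_lt _⟩
    exact hfound hpair hbal ▸ hout
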